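/- **Theorem 4 (CEDAS, smooth nonconvex case).** Let $n\ge 2$ agents be connected by an undirected connected graph with neighbourhoods $\mathcal N_i$, and let $W=(w_{ij})\in\mathbb R^{n\times n}$ be nonnegative, symmetric and stochastic ($W\mathbf 1=\mathbf 1$), where for $i\ne j$ there is a link between $i$ and $j$ if and only if $w_{ij}>0$. Let $W=Q\,\mathrm{diag}(\lambda_1,\dots,\lambda_n)Q^{\top}$ with $Q$ orthogonal and $\lambda_1\ge\lambda_2\ge\dots\ge\lambda_n$, let $Q_1\in\mathbb R^{n\times(n-1)}$ consist of the columns $2,\dots,n$ of $Q$, and put $\tilde\lambda_t=1-\frac{\gamma}{2}(1-\lambda_t)$, $\tilde\Lambda_1=\mathrm{diag}(\tilde\lambda_2,\dots,\tilde\lambda_n)$. *Objectives.* Each $f_i:\mathbb R^p\to\mathbb R$ is differentiable with $L$-Lipschitz gradient, $L>0$, and bounded below by $\underline f_i$; $f=\frac1n\sum_i f_i$ and $f^{\inf}=\frac1n\sum_i\underline f_i$. *Algorithm (constant stepsize $\eta>0$, parameters $\gamma>0$, $0<\alpha\le 1$).* Given deterministic $x_{i,-1},h_{i,0}\in\mathbb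 R^p$, set $d_{i,0}=0$, $(h_w)_{i,0}=\sum_{j\in\mathcal N_i\cup\{i\}}w_{ij}h_{j,0}$, $x_{i,0}=x_{i,-1}-\eta g_{i,-1}$, and for $k\ge0$ $$\begin{aligned} y_{i,k}&=x_{i,k}-\eta g_{i,k}-d_{i,k},\qquad q_{i,k}=\mathcal C(y_{i,k}-h_{i,k}),\\ \hat y_{i,k}&=h_{i,k}+q_{i,k},\qquad (\hat y_w)_{i,k}=(h_w)_{i,k}+\sum_{j\in\mathcal N_i\cup\{i\}}w_{ij}q_{j,k},\\ h_{i,k+1}&=(1-\alpha)h_{i,k}+\alpha\hat y_{i,k},\qquad (h_w)_{i,k+1}=(1-\alpha)(h_w)_{i,k}+\alpha(\hat y_w)_{i,k},\\ d_{i,k+1}&=d_{i,k}+\tfrac{\gamma}{2}\big(\hat y_{i,k}-(\hat y_w)_{i,k}\big),\qquad x_{i,k+1}=x_{i,k}-\eta g_{i,k}-d_{i,k+1}.\end{aligned}$$ Here $g_{i,k}=\nabla f_i(x_{i,k};\xi_{i,k})$, $k\ge-1$, are noisy gradients: conditionally on everything drawn before, the samples $\xi_{1,k},\dots,\xi_{n,k}$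 are independent, $\mathbb E[g_{i,k}\mid\text{past}]=\nabla f_i(x_{i,k})$ and $\mathbb E[\|g_{i,k}-\nabla f_i(x_{i,k})\|^2\mid\text{past}]\le\sigma^2$, $\sigma>0$. The randomized compressor $\mathcal C$ satisfies $\mathbb E[\mathcal C(x)]=x$ and $\mathbb E\|\mathcal C(x)-x\|^2\le C\|x\|^2$ for all $x\in\mathbb R^p$, with $C>0$, and each application uses randomness that is independent of the past. *Notation.* $\bar x_k=\frac1n\sum_i x_{i,k}$; $\mathbf x_k,\mathbf y_k,H_k,D_k\in\mathbb R^{n\times p}$ are the matrices with rows $x_{i,k},y_{i,k},h_{i,k},d_{i,k}$; norms of matrices are Frobenius norms; $\nabla F(\mathbf 1\bar x_0^{\top})$ has rows $\nabla f_i(\bar x_0)$. Let $\hat r_0=D_0+\eta\nabla F(\mathbf 1\bar x_0^{\top})$, and let $\check h_0$ be the complex vector whose part for $t\in\{2,\dots,n\}$ is $Z_t^{-1}\binom{a_t}{b_t}$, where $a_t$ and $b_t$ are the rows (for the index $t$) of $Q_1^{\top}\mathbf x_0$ and $(I-\tilde\Lambda_1)^{-1/2}Q_1^{\top}\hat r_0$,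 and $Z_t=\begin{pmatrix} \mathrm i\sqrt{\tilde\lambda_t}&-\mathrm i\sqrt{\tilde\lambda_t}\\1&1\end{pmatrix}$. *Claim.* Suppose $$\alpha\le\frac1{12C},\qquad \gamma\le\min\Big\{\frac{\sqrt\alpha}{2\sqrt C},\frac12,\frac{\alpha^2(1-\lambda_2)}{1728C}\Big\},\qquad \eta\le\min\Big\{\frac{\sqrt\alpha}{2\sqrt3L},\frac{\gamma(1-\lambda_2)}{16L}\Big\}.$$ Then for every $K\ge1$ all expectations below are finite and $$\begin{aligned}\frac1K\sum_{k=-1}^{K-1}\mathbb E\|\nabla f(\bar x_k)\|^2\le{}&\frac{4(f(\bar x_{-1})-f^{\inf})}{\eta K}+\frac{32L^2\,\mathbb E\|\check h_0\|^2}{n(1-\tilde\lambda_2)K}+\frac{384\gamma CL^2\,\mathbb E\|\mathbf y_0-H_0\|^2}{n\alpha(1-\tilde\lambda_2)K}\\&+\frac{4L\eta\sigma^2}{n}+\frac{168\eta^2L^2\sigma^2}{1-\tilde\lambda_2}+\frac{4L^2\|\mathbf x_{-1}\|^2}{nK}+\frac{2L\eta\sigma^2}{nK}.\end{aligned}$$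 -/

import Mathlib

open MeasureTheory ProbabilityTheory

noncomputable section

namespace Cedas

/-- The decision space `ℝ^p` with the Euclidean norm. -/
abbrev Vec (p : ℕ) : Type := EuclideanSpace ℝ (Fin p)

/-! ### Network, mixing matrix and spectrum -/

/-- `W` is a mixing matrix compliant with the undirected connected graph `G`: for `i ≠ j` there is
a link iff `w_ij > 0`, and `W` is nonnegative, symmetric and stochastic. -/
structure IsMixingMatrix {n : ℕ} (G : SimpleGraph (Fin n)) (W : Matrix (Fin n) (Fin n) ℝ) :
    Prop where
  connected : G.Connected
  adj_iff : ∀ i j, i ≠ j → (G.Adj i j ↔ 0 < W i j)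
  nonneg : ∀ i j, 0 ≤ W i j
  symm : W.IsSymm
  stochastic : ∀ i, ∑ j, W i j = 1

/-- `W = Q diag(lam) Qᵀ` with `Q` orthogonal and the eigenvalues listed in non-increasing order.
The index `0` is the first eigenvalue, the index `1` the second. -/
structure IsSortedEigendecomposition {n : ℕ} (W Q : Matrix (Fin n) (Fin n) ℝ) (lam : Fin n → ℝ) :
    Prop where
  orthogonal : Q ∈ Matrix.orthogonalGroup (Fin n) ℝ
  eq : W = Q * Matrix.diagonal lam * Q.transpose
  antitone : Antitone lam

/-- The eigenvalue `1 - (γ/2)(1 - l)` of `I - (γ/2)(I - W)` that corresponds to the eigenvalue `l`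
of `W`. -/
def tildeEig (γ l : ℝ) : ℝ := 1 - γ / 2 * (1 - l)

/-! ### Objective functions -/

/-- The global objective `f = (1/n) ∑ f_i`. -/
def avgObj {n p : ℕ} (f : Fin n → Vec p → ℝ) (x : Vec p) : ℝ := (1 / (n : ℝ)) * ∑ i, f i x

/-- Each `f_i` is differentiable with `L`-Lipschitz gradient and bounded from below by `flow i`. -/
structure IsSmoothBddBelow {n p : ℕ} (f : Fin n → Vec p → ℝ) (L : ℝ) (flow : Fin n → ℝ) :
    Prop where
  differentiable : ∀ i, Differentiable ℝ (f i)
  lipschitz : ∀ i x y, ‖gradient (f i) x - gradient (f i) y‖ ≤ L * ‖x - y‖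
  lower_bound : ∀ i x, flow i ≤ f i x

/-! ### Compressors -/

/-- The random operator `x ↦ comp x z`, `z ∼ ν`, is an unbiased compressor with constant `C > 0`:
`E[comp x] = x` and `E‖comp x - x‖² ≤ C‖x‖²` for all `x`. -/
structure IsUnbiasedCompressor {p : ℕ} {Z : Type*} [MeasurableSpace Z] (ν : Measure Z)
    (comp : Vec p → Z → Vec p) (C : ℝ) : Prop where
  pos : 0 < C
  measurable : Measurable (Function.uncurry comp)
  memLp : ∀ x, MemLp (fun z => comp x z) 2 ν
  unbiased : ∀ x, ∫ z, comp x z ∂ν = x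
  variance : ∀ x, ∫ z, ‖comp x z - x‖ ^ 2 ∂ν ≤ C * ‖x‖ ^ 2

/-! ### The algorithm -/

/-- The variables `x_i`, `h_i`, `(h_w)_i`, `d_i` held by the agents. -/
structure State (n p : ℕ) where
  x : Fin n → Vec p
  h : Fin n → Vec p
  hw : Fin n → Vec p
  d : Fin n → Vec p

/-- The inputs of the algorithm, with a constant stepsize `η`: the network, the parameters, the
stochastic gradient oracles `(x, ξ) ↦ ∇f_i(x; ξ)`, the (randomized) compressor, and the
initial values `x_{i,-1}` and `h_{i,0}`. -/
structure Algorithm (n p : ℕ) (Ξ Z : Type*) where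
  G : SimpleGraph (Fin n)
  W : Matrix (Fin n) (Fin n) ℝ
  η : ℝ
  γ : ℝ
  α : ℝ
  grad : Fin n → Vec p → Ξ → Vec p
  comp : Vec p → Z → Vec p
  xInit : Fin n → Vec p
  hInit : Fin n → Vec p

namespace Algorithm

variable {n p : ℕ} {Ξ Z : Type*} (A : Algorithm n p Ξ Z)

open scoped Classical in
/-- `∑_{j ∈ N_i ∪ {i}} w_ij v_j`. -/
def mix (v : Fin n → Vec p) (i : Fin n) : Vec p :=
  ∑ j ∈ Finset.univ.filter (fun j => j = i ∨ A.G.Adj i j), A.W i j • v j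

/-- The state at iteration `0`, computed with the samples `ξ_{i,-1}`. -/
def init (ξ : Fin n → Ξ) : State n p where
  x i := A.xInit i - A.η • A.grad i (A.xInit i) (ξ i)
  h := A.hInit
  hw := A.mix A.hInit
  d _ := 0

/-- `y_i = x_i - η ∇f_i(x_i; ξ_i) - d_i`. -/
def y (ξ : Fin n → Ξ) (S : State n p) (i : Fin n) : Vec p :=
  S.x i - A.η • A.grad i (S.x i) (ξ i) - S.d i

/-- The transmitted variable `q_i = comp (y_i - h_i)`, drawn with the seed `ζ_i`. -/
def q (ξ : Fin n → Ξ) (ζ : Fin n → Z) (S : State n p) (i : Fin n) : Vec p :=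
  A.comp (A.y ξ S i - S.h i) (ζ i)

/-- `ŷ_i = h_i + q_i`. -/
def yHat (ξ : Fin n → Ξ) (ζ : Fin n → Z) (S : State n p) (i : Fin n) : Vec p :=
  S.h i + A.q ξ ζ S i

/-- `(ŷ_w)_i = (h_w)_i + ∑_{j ∈ N_i ∪ {i}} w_ij q_j`. -/
def yHatW (ξ : Fin n → Ξ) (ζ : Fin n → Z) (S : State n p) (i : Fin n) : Vec p :=
  S.hw i + A.mix (A.q ξ ζ S) i

/-- `d_i⁺ = d_i + (γ/2)(ŷ_i - (ŷ_w)_i)`. -/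
def dNext (ξ : Fin n → Ξ) (ζ : Fin n → Z) (S : State n p) (i : Fin n) : Vec p :=
  S.d i + (A.γ / 2) • (A.yHat ξ ζ S i - A.yHatW ξ ζ S i)

/-- One iteration, with gradient samples `ξ_i` and compression seeds `ζ_i`. -/
def step (ξ : Fin n → Ξ) (ζ : Fin n → Z) (S : State n p) : State n p where
  x i := S.x i - A.η • A.grad i (S.x i) (ξ i) - A.dNext ξ ζ S i
  h i := (1 - A.α) • S.h i + A.α • A.yHat ξ ζ S i
  hw i := (1 - A.α) • S.hw i + A.α • A.yHatW ξ ζ S i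
  d := A.dNext ξ ζ S

end Algorithm

/-! ### The random input and the stochastic process -/

/-- The random input: gradient samples `ξ_{i,-1}` (`xiInit i`), gradient samples `ξ_{i,k}`
(`xi k i`) and compression seeds (`zeta k i`) for `k ≥ 0`. -/
structure Samples (n : ℕ) (Ω Ξ Z : Type*) where
  xiInit : Fin n → Ω → Ξ
  xi : ℕ → Fin n → Ω → Ξ
  zeta : ℕ → Fin n → Ω → Z

namespace Samples

variable {n : ℕ} {Ω Ξ Z : Type*} [MeasurableSpace Ξ] [MeasurableSpace Z] (s : Samples n Ω Ξ Z)

/-- The history before the gradient samples of iteration `k` are drawn. -/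
abbrev gradPast (k : ℕ) : MeasurableSpace Ω :=
  (⨆ i, MeasurableSpace.comap (s.xiInit i) inferInstance) ⊔
    ⨆ l, ⨆ (_ : l < k), ⨆ i, MeasurableSpace.comap (s.xi l i) inferInstance ⊔
      MeasurableSpace.comap (s.zeta l i) inferInstance

/-- The history before the compression seeds of iteration `k` are drawn; it includes the gradient
samples of iteration `k`. -/
abbrev compPast (k : ℕ) : MeasurableSpace Ω :=
  s.gradPast k ⊔ ⨆ i, MeasurableSpace.comap (s.xi k i) inferInstance

end Samples

/-- The state of the algorithm at iteration `k ≥ 0`. -/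
def Algorithm.state {n p : ℕ} {Ω Ξ Z : Type*} (A : Algorithm n p Ξ Z) (s : Samples n Ω Ξ Z)
    (ω : Ω) : ℕ → State n p
  | 0 => A.init (fun i => s.xiInit i ω)
  | k + 1 => A.step (fun i => s.xi k i ω) (fun i => s.zeta k i ω) (A.state s ω k)

/-- The random variables `X_i` are conditionally independent given the σ-algebra `m`. -/
def CondIndepFamily {ι Ω Ξ : Type*} [Fintype ι] [MeasurableSpace Ξ] (m : MeasurableSpace Ω)
    {mΩ : MeasurableSpace Ω} (X : ι → Ω → Ξ) (μ : Measure Ω) : Prop :=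
  ∀ B : ι → Set Ξ, (∀ i, MeasurableSet (B i)) →
    μ⟦⋂ i, X i ⁻¹' B i | m⟧ =ᵐ[μ] fun ω => ∏ i, (μ⟦X i ⁻¹' B i | m⟧) ω

/-- The gradient samples at iterations `-1, 0, 1, …`: the samples of different agents are
independent (given the history), and, conditionally on the history, the noisy gradients along the
iterates are unbiased with variance at most `σ²`. -/
structure IsStochasticGradient {n p : ℕ} {Ω Ξ Z : Type*} [MeasurableSpace Ξ] [MeasurableSpace Z]
    {mΩ : MeasurableSpace Ω} (μ : Measure Ω) (A : Algorithm n p Ξ Z) (s : Samples n Ω Ξ Z)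
    (f : Fin n → Vec p → ℝ) (σ : ℝ) : Prop where
  measurable_grad : ∀ i, Measurable (Function.uncurry (A.grad i))
  measurable_xiInit : ∀ i, Measurable (s.xiInit i)
  measurable_xi : ∀ k i, Measurable (s.xi k i)
  indep_init : iIndepFun s.xiInit μ
  indep : ∀ k, CondIndepFamily (s.gradPast k) (s.xi k) μ
  memLp_init : ∀ i, MemLp
    (fun ω => A.grad i (A.xInit i) (s.xiInit i ω) - gradient (f i) (A.xInit i)) 2 μ
  unbiased_init : ∀ i, ∫ ω, A.grad i (A.xInit i) (s.xiInit i ω) ∂μ = gradient (f i) (A.xInit i)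
  variance_init : ∀ i,
    ∫ ω, ‖A.grad i (A.xInit i) (s.xiInit i ω) - gradient (f i) (A.xInit i)‖ ^ 2 ∂μ ≤ σ ^ 2
  memLp : ∀ k i, MemLp (fun ω => A.grad i ((A.state s ω k).x i) (s.xi k i ω) -
    gradient (f i) ((A.state s ω k).x i)) 2 μ
  unbiased : ∀ k i, μ[fun ω => A.grad i ((A.state s ω k).x i) (s.xi k i ω) | s.gradPast k]
    =ᵐ[μ] fun ω => gradient (f i) ((A.state s ω k).x i)
  variance : ∀ k i, μ[fun ω => ‖A.grad i ((A.state s ω k).x i) (s.xi k i ω) -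
      gradient (f i) ((A.state s ω k).x i)‖ ^ 2 | s.gradPast k]
    ≤ᵐ[μ] fun _ => σ ^ 2

/-- Every application of the compressor uses a seed with law `ν` that is independent of the past.
Nothing is assumed about the joint law of the seeds of different agents in one iteration. -/
structure IsFreshSeeds {n : ℕ} {Ω Ξ Z : Type*} [MeasurableSpace Ξ] [MeasurableSpace Z]
    {mΩ : MeasurableSpace Ω} (μ : Measure Ω) (ν : Measure Z) (s : Samples n Ω Ξ Z) : Prop where
  measurable : ∀ k i, Measurable (s.zeta k i)
  law : ∀ k i, μ.map (s.zeta k i) = ν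
  indep : ∀ k i, Indep (MeasurableSpace.comap (s.zeta k i) inferInstance) (s.compPast k) μ

/-! ### Error quantities -/

/-- The squared Frobenius norm `∑_i ‖v_i‖²` of stacked variables. -/
def stackSq {n p : ℕ} (v : Fin n → Vec p) : ℝ := ∑ i, ‖v i‖ ^ 2

/-- The average `v̄ = (1/n) ∑ v_i`. -/
def mean {n p : ℕ} (v : Fin n → Vec p) : Vec p := (1 / (n : ℝ)) • ∑ i, v i

/-- The stacked variable `r̂ = D + η ∇F(1 x̄ᵀ)`. -/
def rHat {n p : ℕ} (η : ℝ) (f : Fin n → Vec p → ℝ) (S : State n p) (i : Fin n) : Vec p :=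
  S.d i + η • gradient (f i) (mean S.x)

/-- The matrix whose columns are eigenvectors of `[[l, -l√(1-l)], [√(1-l), l]]`. -/
def zMat (l : ℝ) : Matrix (Fin 2) (Fin 2) ℂ :=
  !![Complex.I * (Real.sqrt l : ℂ), -(Complex.I * (Real.sqrt l : ℂ)); 1, 1]

/-- The transformed consensus error
`ȟ = J⁻¹ [Q₁ᵀ x ; (I - Λ̃₁)^{-1/2} Q₁ᵀ r̂]`, where `Q₁` consists of the columns of `Q` after the
first one. As `J` is, up to permutations, block diagonal with blocks `zMat λ̃_t`, the entries of `ȟ`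
are indexed by the eigenvalue index `t`, the coordinate `j` and the position in the block. -/
def checkH {n p : ℕ} (Q : Matrix (Fin n) (Fin n) ℝ) (lam : Fin n → ℝ) (γ η : ℝ)
    (f : Fin n → Vec p → ℝ) (S : State n p) (t : {t : Fin n // 0 < (t : ℕ)}) (j : Fin p) :
    Fin 2 → ℂ :=
  (zMat (tildeEig γ (lam t)))⁻¹.mulVec
    ![((∑ i, Q i t * S.x i j : ℝ) : ℂ),
      (((Real.sqrt (1 - tildeEig γ (lam t)))⁻¹ * ∑ i, Q i t * rHat η f S i j : ℝ) : ℂ)]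

/-- `‖ȟ‖²`. -/
def checkHSq {n p : ℕ} (Q : Matrix (Fin n) (Fin n) ℝ) (lam : Fin n → ℝ) (γ η : ℝ)
    (f : Fin n → Vec p → ℝ) (S : State n p) : ℝ :=
  ∑ t, ∑ j, ∑ b, ‖checkH Q lam γ η f S t j b‖ ^ 2

/-- `‖y_k - H_k‖²`. -/
def compErrSq {n p : ℕ} {Ω Ξ Z : Type*} (A : Algorithm n p Ξ Z) (s : Samples n Ω Ξ Z)
    (k : ℕ) (ω : Ω) : ℝ :=
  stackSq (fun i => A.y (fun i => s.xi k i ω) (A.state s ω k) i - (A.state s ω k).h i)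

/-- `‖∇f(x̄_k)‖²` for `k ≥ 0`. -/
def gradSq {n p : ℕ} {Ω Ξ Z : Type*} (A : Algorithm n p Ξ Z) (s : Samples n Ω Ξ Z)
    (f : Fin n → Vec p → ℝ) (k : ℕ) (ω : Ω) : ℝ :=
  ‖gradient (avgObj f) (mean (A.state s ω k).x)‖ ^ 2

end Cedas

end

/-! The proof couples three quantities: the objective at the average x̄, the consensus error
measured by ‖ȟ‖², and the compression input ‖y - H‖².

Average. `W` is symmetric and stochastic, so the rows of `D` always sum to zero, and x̄ performs a
stochastic gradient step in which the compression error does not appear (`mean_state_succ_x`). The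
descent lemma and polarization give a decrease of f(x̄) by η/2 times ‖∇f(x̄)‖² and almost η/2 times
the squared average of the local gradients, up to L²/n times the consensus error and the variance
σ²/n of the averaged noise (`avgObj_step_le`, `integral_avgObj_step_le`).

Consensus. Let l be an eigenvalue of I - (γ/2)(I - W) other than the first, and let a, r be the
components of x and r̂ along its eigenvector. Without noise one step maps (a, r) to (l(a - r), lr +
(1-l)a), and this multiplies the energy ½(‖a‖²/l + ‖r‖²/(1-l)) by exactly l
(`modeEnergy_contraction`). Summed over the modes this energy is ‖ȟ‖² (`checkHSq_eq`), so the
complex diagonalization is needed only to identify the norm. Gradient noise and compression error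
have zero-mean cross terms; what remains are their variances, the gradient differences between x_i
and x̄, and the movement of x̄ (`checkHSq_succ_le`).

Compression. Apart from the new gradient noise, y - H contracts by the factor 1 - α before the
compression error is added, and it is driven by terms controlled by ‖ȟ‖², ‖∇f(x̄)‖² and the noise
(`compErrSq_succ_le`). The compression error has variance at most C‖y - H‖², and it enters the
consensus recursion with the small factor γ.

Closing the loop. With ρ = 1 - λ̃₂, the stepsize bounds give Lη ≤ ρ/8, γC ≤ α²/864 and γ²C ≤
α²ρ/864. Summing over k turns each recursion into a linear inequality between sums. The feedback
from consensus through compression back to consensus then has gain below one (`sum_consensus_le`),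
and the gradient terms created by the consensus error are absorbed by the descent
(`sum_gradient_le`). -/

noncomputable section

namespace Cedas
open scoped InnerProductSpace

variable {n p : ℕ}

/-! ### Mixing matrices and their eigenmodes -/

/-- The component `∑_i Q_{it} v_i` of stacked variables along the column `t` of `Q`. -/
def mode (Q : Matrix (Fin n) (Fin n) ℝ) (t : Fin n) : (Fin n → Vec p) →ₗ[ℝ] Vec p :=
  ∑ i, Q i t • LinearMap.proj i

lemma mode_apply (Q : Matrix (Fin n) (Fin n) ℝ) (t : Fin n) (v : Fin n → Vec p) :
    mode Q t v = ∑ i, Q i t • v i := by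
  simp [mode, LinearMap.sum_apply]

/-- The matrix product `W v` for stacked variables. -/
def mulStack (W : Matrix (Fin n) (Fin n) ℝ) (v : Fin n → Vec p) (i : Fin n) : Vec p :=
  ∑ j, W i j • v j

lemma mulStack_add (W : Matrix (Fin n) (Fin n) ℝ) (v w : Fin n → Vec p) :
    mulStack W (v + w) = mulStack W v + mulStack W w := by
  ext1 i
  simp [mulStack, smul_add, Finset.sum_add_distrib]

lemma mulStack_smul (W : Matrix (Fin n) (Fin n) ℝ) (c : ℝ) (v : Fin n → Vec p) :
    mulStack W (c • v) = c • mulStack W v := by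
  ext1 i
  simp only [mulStack, Pi.smul_apply, Finset.smul_sum]
  exact Finset.sum_congr rfl fun j _ => smul_comm _ _ _

/-- Outside the closed neighbourhood the weights are nonnegative and not positive, hence zero. -/
lemma Algorithm.mix_eq_mulStack {Ξ Z : Type*} {A : Algorithm n p Ξ Z}
    (hW : IsMixingMatrix A.G A.W) (v : Fin n → Vec p) : A.mix v = mulStack A.W v := by
  classical
  ext1 i
  unfold Algorithm.mix mulStack
  refine Finset.sum_subset (Finset.filter_subset _ _) fun j _ hj => ?_
  simp only [Finset.mem_filter, Finset.mem_univ, true_and, not_or] at hj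
  have h0 : A.W i j = 0 := by
    refine le_antisymm ?_ (hW.nonneg i j)
    by_contra! h
    exact hj.2 ((hW.adj_iff i j (Ne.symm hj.1)).2 h)
  simp [h0]

lemma stackSq_nonneg (v : Fin n → Vec p) : 0 ≤ stackSq v :=
  Finset.sum_nonneg fun _ _ => sq_nonneg _

lemma sum_mul_col_of_mem_orthogonalGroup {Q : Matrix (Fin n) (Fin n) ℝ}
    (hQ : Q ∈ Matrix.orthogonalGroup (Fin n) ℝ) (i j : Fin n) :
    ∑ t, Q i t * Q j t = if i = j then 1 else 0 := by
  have h := (Matrix.mem_orthogonalGroup_iff _ _).1 hQ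
  have := congrFun (congrFun h i) j
  simpa [Matrix.mul_apply, Matrix.star_apply, Matrix.one_apply] using this

lemma sum_mul_row_of_mem_orthogonalGroup {Q : Matrix (Fin n) (Fin n) ℝ}
    (hQ : Q ∈ Matrix.orthogonalGroup (Fin n) ℝ) (s t : Fin n) :
    ∑ i, Q i s * Q i t = if s = t then 1 else 0 := by
  have h := (Matrix.mem_orthogonalGroup_iff' _ _).1 hQ
  have := congrFun (congrFun h s) t
  simpa [Matrix.mul_apply, Matrix.star_apply, Matrix.one_apply] using this

lemma sum_norm_mode_sq {Q : Matrix (Fin n) (Fin n) ℝ}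
    (hQ : Q ∈ Matrix.orthogonalGroup (Fin n) ℝ) (v : Fin n → Vec p) :
    ∑ t, ‖mode Q t v‖ ^ 2 = stackSq v := by
  have h1 : ∀ t, ‖mode Q t v‖ ^ 2 = ∑ i, ∑ j, (Q i t * Q j t) * ⟪v i, v j⟫_ℝ := by
    intro t
    rw [← real_inner_self_eq_norm_sq, mode_apply, sum_inner]
    refine Finset.sum_congr rfl fun i _ => ?_
    rw [inner_sum]
    refine Finset.sum_congr rfl fun j _ => ?_
    rw [real_inner_smul_left, real_inner_smul_right, mul_assoc]
  simp_rw [h1]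
  rw [Finset.sum_comm]
  unfold stackSq
  refine Finset.sum_congr rfl fun i _ => ?_
  rw [Finset.sum_comm]
  simp_rw [← Finset.sum_mul, sum_mul_col_of_mem_orthogonalGroup hQ]
  simp

lemma stackSq_eq_stackSq_sub_mean_add (hn : 0 < n) (v : Fin n → Vec p) :
    stackSq v = stackSq (fun i => v i - mean v) + n * ‖mean v‖ ^ 2 := by
  have hn' : (n : ℝ) ≠ 0 := by positivity
  have hs : ∑ i, v i = (n : ℝ) • mean v := by
    simp [mean, smul_smul, hn']
  have h : ∀ i, ‖v i - mean v‖ ^ 2 = ‖v i‖ ^ 2 - 2 * ⟪v i, mean v⟫_ℝ + ‖mean v‖ ^ 2 := fun i =>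
    norm_sub_sq_real _ _
  unfold stackSq
  simp_rw [h]
  rw [Finset.sum_add_distrib, Finset.sum_sub_distrib, ← Finset.mul_sum, ← sum_inner, hs,
    real_inner_smul_left, real_inner_self_eq_norm_sq]
  simp
  ring

lemma norm_mean_sq_le (hn : 0 < n) (v : Fin n → Vec p) :
    n * ‖mean v‖ ^ 2 ≤ stackSq v := by
  rw [stackSq_eq_stackSq_sub_mean_add hn v]
  linarith [stackSq_nonneg (fun i => v i - mean v)]

/-- The indices of the eigenvalues other than the first one. -/
abbrev Tail (n : ℕ) : Type := {t : Fin n // 0 < (t : ℕ)}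

lemma sum_tail_le {g : Fin n → ℝ} (hg : ∀ t, 0 ≤ g t) : ∑ t : Tail n, g t ≤ ∑ t, g t := by
  classical
  rw [← Fintype.sum_subtype_add_sum_subtype (fun t : Fin n => 0 < (t : ℕ)) g]
  exact le_add_of_nonneg_right (Finset.sum_nonneg fun t _ => hg t)

lemma sum_eq_zero_add_sum_tail (hn : 0 < n) (g : Fin n → ℝ) :
    ∑ t, g t = g ⟨0, hn⟩ + ∑ t : Tail n, g t := by
  classical
  rw [← Fintype.sum_subtype_add_sum_subtype (fun t : Fin n => 0 < (t : ℕ)) g, add_comm]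
  congr 1
  have : Unique {t : Fin n // ¬ 0 < (t : ℕ)} :=
    { default := ⟨⟨0, hn⟩, by simp⟩
      uniq := fun t => by
        apply Subtype.ext
        apply Fin.ext
        have := t.2
        simp
        omega }
  rw [Fintype.sum_unique]
  have h := this.uniq ⟨⟨0, hn⟩, by simp⟩
  rw [← h]

lemma sum_tail_norm_mode_sq_le {Q : Matrix (Fin n) (Fin n) ℝ}
    (hQ : Q ∈ Matrix.orthogonalGroup (Fin n) ℝ) (v : Fin n → Vec p) :
    ∑ t : Tail n, ‖mode Q t v‖ ^ 2 ≤ stackSq v := by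
  rw [← sum_norm_mode_sq hQ]
  exact sum_tail_le (g := fun t => ‖mode Q t v‖ ^ 2) fun t => sq_nonneg _

/-! ### Spectrum of a mixing matrix -/

section Spectrum

variable {G : SimpleGraph (Fin n)} {W Q : Matrix (Fin n) (Fin n) ℝ} {lam : Fin n → ℝ}

lemma IsSortedEigendecomposition.sum_mul_right (hQ : IsSortedEigendecomposition W Q lam)
    (i t : Fin n) : ∑ j, W i j * Q j t = lam t * Q i t := by
  have h : W * Q = Q * Matrix.diagonal lam := by
    conv_lhs => rw [hQ.eq]
    have := (Matrix.mem_orthogonalGroup_iff' _ _).1 hQ.orthogonal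
    rw [Matrix.mul_assoc]
    have h2 : Q.transpose * Q = 1 := this
    rw [h2, Matrix.mul_one]
  have := congrFun (congrFun h i) t
  rw [Matrix.mul_diagonal, Matrix.mul_apply] at this
  rw [this, mul_comm]

lemma IsSortedEigendecomposition.sum_mul_left (hW : IsMixingMatrix G W)
    (hQ : IsSortedEigendecomposition W Q lam) (j t : Fin n) :
    ∑ i, Q i t * W i j = lam t * Q j t := by
  rw [← hQ.sum_mul_right]
  refine Finset.sum_congr rfl fun i _ => ?_
  rw [mul_comm, hW.symm.apply]

lemma mode_mulStack (hW : IsMixingMatrix G W) (hQ : IsSortedEigendecomposition W Q lam)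
    (t : Fin n) (v : Fin n → Vec p) : mode Q t (mulStack W v) = lam t • mode Q t v := by
  simp only [mode_apply, mulStack, Finset.smul_sum, smul_smul]
  rw [Finset.sum_comm]
  refine Finset.sum_congr rfl fun j _ => ?_
  rw [← Finset.sum_smul, hQ.sum_mul_left hW]

lemma sum_mulStack (hW : IsMixingMatrix G W) (v : Fin n → Vec p) :
    ∑ i, mulStack W v i = ∑ i, v i := by
  unfold mulStack
  rw [Finset.sum_comm]
  refine Finset.sum_congr rfl fun j _ => ?_
  rw [← Finset.sum_smul]
  have : ∑ i, W i j = 1 := by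
    rw [← hW.stochastic j]
    exact Finset.sum_congr rfl fun i _ => hW.symm.apply _ _
  rw [this, one_smul]

/-- For a unit eigenvector q the nonnegative form ∑ w_ij (q_i + q_j)² equals 2 + 2λ, because the
rows and columns of `W` sum to 1. -/
lemma neg_one_le_eigenvalue (hW : IsMixingMatrix G W) (hQ : IsSortedEigendecomposition W Q lam)
    (t : Fin n) : -1 ≤ lam t := by
  have h1 : ∑ i, Q i t * Q i t = 1 := by
    simpa using sum_mul_row_of_mem_orthogonalGroup hQ.orthogonal t t
  have h2 : ∑ i, ∑ j, W i j * (Q i t * Q j t) = lam t := by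
    have : ∀ i, ∑ j, W i j * (Q i t * Q j t) = lam t * (Q i t * Q i t) := fun i => by
      rw [mul_left_comm, ← hQ.sum_mul_right, Finset.mul_sum]
      exact Finset.sum_congr rfl fun j _ => by ring
    simp_rw [this]
    rw [← Finset.mul_sum, h1, mul_one]
  have h3 : ∑ i, ∑ j, W i j * (Q i t * Q i t) = 1 := by
    simp_rw [← Finset.sum_mul, hW.stochastic, one_mul, h1]
  have h4 : ∑ i, ∑ j, W i j * (Q j t * Q j t) = 1 := by
    rw [Finset.sum_comm, ← h3]
    refine Finset.sum_congr rfl fun i _ => Finset.sum_congr rfl fun j _ => ?_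
    rw [hW.symm.apply]
  have h5 : 0 ≤ ∑ i, ∑ j, W i j * (Q i t + Q j t) ^ 2 :=
    Finset.sum_nonneg fun i _ => Finset.sum_nonneg fun j _ =>
      mul_nonneg (hW.nonneg i j) (sq_nonneg _)
  have h6 : ∑ i, ∑ j, W i j * (Q i t + Q j t) ^ 2 = 2 + 2 * lam t := by
    have : ∀ i j, W i j * (Q i t + Q j t) ^ 2 = W i j * (Q i t * Q i t) +
      W i j * (Q j t * Q j t) + 2 * (W i j * (Q i t * Q j t)) := fun i j => by ring
    simp_rw [this, Finset.sum_add_distrib, ← Finset.mul_sum, h2, h3, h4]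
    norm_num
  linarith

lemma sum_col_eq_zero (hW : IsMixingMatrix G W) (hQ : IsSortedEigendecomposition W Q lam)
    {t : Fin n} (ht : lam t ≠ 1) : ∑ i, Q i t = 0 := by
  have h : ∑ i, Q i t = lam t * ∑ i, Q i t := by
    rw [Finset.mul_sum]
    simp_rw [← hQ.sum_mul_left hW]
    rw [Finset.sum_comm]
    refine Finset.sum_congr rfl fun i _ => ?_
    rw [← Finset.mul_sum, hW.stochastic, mul_one]
  have h2 : (1 - lam t) * ∑ i, Q i t = 0 := by linarith
  exact (mul_eq_zero.1 h2).resolve_left (sub_ne_zero.2 (Ne.symm ht))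

lemma sum_tail_norm_mode_sq (hn : 0 < n) (hW : IsMixingMatrix G W)
    (hQ : IsSortedEigendecomposition W Q lam) (hlam : ∀ t : Tail n, lam t ≠ 1)
    (v : Fin n → Vec p) :
    ∑ t : Tail n, ‖mode Q t v‖ ^ 2 = stackSq (fun i => v i - mean v) := by
  have hn' : (n : ℝ) ≠ 0 := by positivity
  have hc : ∀ t : Tail n, ∑ i, Q i t = 0 := fun t => sum_col_eq_zero hW hQ (hlam t)
  have hm : ∀ t : Tail n, mode Q t v = mode Q t (fun i => v i - mean v) := fun t => by
    simp only [mode_apply, smul_sub, Finset.sum_sub_distrib, ← Finset.sum_smul, hc, zero_smul,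
      sub_zero]
  -- The tail columns sum to zero, so summing row i of QQᵀ = I leaves only Q_{i0} c = 1. Hence
  -- column 0 is the constant vector 1/c, and the mode 0 of a stack with mean zero vanishes.
  set c := ∑ i, Q i ⟨0, hn⟩ with hcdef
  have hrow : ∀ i, Q i ⟨0, hn⟩ * c = 1 := fun i => by
    have h1 : ∑ j, ∑ t, Q i t * Q j t = 1 := by
      simp_rw [sum_mul_col_of_mem_orthogonalGroup hQ.orthogonal]
      simp
    rw [Finset.sum_comm] at h1
    simp_rw [← Finset.mul_sum] at h1
    rw [sum_eq_zero_add_sum_tail hn] at h1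
    simpa [hc] using h1
  have hc0 : c ≠ 0 := fun h => by simpa [h] using hrow ⟨0, hn⟩
  have h0 : mode Q ⟨0, hn⟩ (fun i => v i - mean v) = 0 := by
    have h1 : c • mode Q ⟨0, hn⟩ (fun i => v i - mean v) = 0 := by
      rw [mode_apply, Finset.smul_sum]
      simp_rw [smul_smul, mul_comm c, hrow, one_smul]
      simp [mean, ← Nat.cast_smul_eq_nsmul ℝ, smul_smul, hn']
    exact (smul_eq_zero.1 h1).resolve_left hc0
  simp_rw [hm]
  rw [← sum_norm_mode_sq hQ.orthogonal, sum_eq_zero_add_sum_tail hn, h0]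
  simp

end Spectrum

/-! ### The transformed consensus error -/

/-- The squared norm `½(‖a‖²/l + ‖r‖²/(1-l))` in which one step of the dynamics of an eigenmode with
eigenvalue `l` contracts by the factor `l`. -/
def modeEnergy (l : ℝ) (a r : Vec p) : ℝ := (‖a‖ ^ 2 / l + ‖r‖ ^ 2 / (1 - l)) / 2

lemma zMat_inv {l : ℝ} (hl : 0 < l) :
    (zMat l)⁻¹ = !![-(Complex.I / (2 * (Real.sqrt l : ℂ))), 1 / 2;
      Complex.I / (2 * (Real.sqrt l : ℂ)), 1 / 2] := by
  have hs : (Real.sqrt l : ℂ) ≠ 0 := by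
    exact_mod_cast (Real.sqrt_pos.2 hl).ne'
  apply Matrix.inv_eq_right_inv
  ext i j
  fin_cases i <;> fin_cases j <;>
    simp [zMat, Matrix.mul_apply, Fin.sum_univ_two] <;> field_simp <;>
    norm_num [Complex.I_sq]

/-- For real a and b the two entries are the conjugate numbers b/2 ∓ i a/(2√l), so they have the
same modulus. -/
lemma sum_norm_zMat_inv_mulVec_sq {l : ℝ} (hl : 0 < l) (a b : ℝ) :
    ∑ i, ‖(zMat l)⁻¹.mulVec ![(a : ℂ), (b : ℂ)] i‖ ^ 2 = (a ^ 2 / l + b ^ 2) / 2 := by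
  have hs := Real.sqrt_pos.2 hl
  have hsq := Real.sq_sqrt hl.le
  rw [zMat_inv hl, Fin.sum_univ_two]
  have e0 : (!![-(Complex.I / (2 * (Real.sqrt l : ℂ))), 1 / 2;
      Complex.I / (2 * (Real.sqrt l : ℂ)), 1 / 2].mulVec ![(a : ℂ), (b : ℂ)] 0)
      = ((b / 2 : ℝ) : ℂ) + ((-(a / (2 * Real.sqrt l)) : ℝ) : ℂ) * Complex.I := by
    simp [Matrix.mulVec, dotProduct, Fin.sum_univ_two]
    ring
  have e1 : (!![-(Complex.I / (2 * (Real.sqrt l : ℂ))), 1 / 2;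
      Complex.I / (2 * (Real.sqrt l : ℂ)), 1 / 2].mulVec ![(a : ℂ), (b : ℂ)] 1)
      = ((b / 2 : ℝ) : ℂ) + ((a / (2 * Real.sqrt l) : ℝ) : ℂ) * Complex.I := by
    simp [Matrix.mulVec, dotProduct, Fin.sum_univ_two]
    ring
  rw [e0, e1, Complex.sq_norm, Complex.sq_norm, Complex.normSq_add_mul_I,
    Complex.normSq_add_mul_I]
  have : (a / (2 * Real.sqrt l)) ^ 2 = a ^ 2 / (4 * l) := by
    rw [div_pow, mul_pow, hsq]; norm_num
  rw [neg_sq, this]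
  field_simp
  ring

lemma mode_apply_coord (Q : Matrix (Fin n) (Fin n) ℝ) (t : Fin n) (v : Fin n → Vec p) (j : Fin p) :
    mode Q t v j = ∑ i, Q i t * v i j := by
  simp [mode_apply]

/-- This replaces the complex norm by a real quadratic form in each mode; all later estimates use
only the latter. -/
lemma checkHSq_eq {Q : Matrix (Fin n) (Fin n) ℝ} {lam : Fin n → ℝ} {γ η : ℝ}
    {f : Fin n → Vec p → ℝ} (hl : ∀ t : Tail n, 0 < tildeEig γ (lam t))
    (hl1 : ∀ t : Tail n, tildeEig γ (lam t) < 1) (S : State n p) :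
    checkHSq Q lam γ η f S =
      ∑ t : Tail n, modeEnergy (tildeEig γ (lam t)) (mode Q t S.x) (mode Q t (rHat η f S)) := by
  unfold checkHSq
  refine Finset.sum_congr rfl fun t _ => ?_
  have h : ∀ j, ∑ b, ‖checkH Q lam γ η f S t j b‖ ^ 2 =
      ((mode Q t S.x j) ^ 2 / tildeEig γ (lam t) +
        (mode Q t (rHat η f S) j) ^ 2 / (1 - tildeEig γ (lam t))) / 2 := fun j => by
    unfold checkH
    rw [sum_norm_zMat_inv_mulVec_sq (hl t), mul_pow, inv_pow,
      Real.sq_sqrt (by linarith [hl1 t]), mode_apply_coord, mode_apply_coord, inv_mul_eq_div]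
  simp_rw [h]
  rw [modeEnergy, EuclideanSpace.norm_sq_eq, EuclideanSpace.norm_sq_eq, Finset.sum_div,
    Finset.sum_div, ← Finset.sum_add_distrib, Finset.sum_div]
  simp

end Cedas

namespace Cedas
open scoped InnerProductSpace

variable {n p : ℕ}

/-! ### Functions with Lipschitz gradient -/

/-- The descent lemma. -/
lemma le_add_inner_gradient_add_sq {g : Vec p → ℝ} {L : ℝ} (hg : Differentiable ℝ g)
    (hL : ∀ x y, ‖gradient g x - gradient g y‖ ≤ L * ‖x - y‖) (x y : Vec p) :
    g y ≤ g x + ⟪gradient g x, y - x⟫_ℝ + L / 2 * ‖y - x‖ ^ 2 := by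
  set d := y - x with hd
  -- φ is `g` along the segment minus the nonconstant part of its quadratic upper model. The
  -- Lipschitz bound makes its derivative nonpositive, and φ(1) ≤ φ(0) is the claim.
  let φ : ℝ → ℝ := fun t => g (x + t • d) - t * ⟪gradient g x, d⟫_ℝ - L / 2 * t ^ 2 * ‖d‖ ^ 2
  have hφ : ∀ t, HasDerivAt φ (⟪gradient g (x + t • d), d⟫_ℝ - ⟪gradient g x, d⟫_ℝ
      - L * t * ‖d‖ ^ 2) t := fun t => by
    have h1 : HasDerivAt (fun t : ℝ => x + t • d) d t := by
      simpa using ((hasDerivAt_id t).smul_const d).const_add x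
    have h2 : HasDerivAt (fun t : ℝ => g (x + t • d)) ⟪gradient g (x + t • d), d⟫_ℝ t := by
      have h3 := (hg (x + t • d)).hasGradientAt.hasFDerivAt.comp_hasDerivAt t h1
      simpa [Function.comp_def] using h3
    have h4 : HasDerivAt (fun t : ℝ => t * ⟪gradient g x, d⟫_ℝ) ⟪gradient g x, d⟫_ℝ t := by
      simpa using (hasDerivAt_id t).mul_const ⟪gradient g x, d⟫_ℝ
    have h5 : HasDerivAt (fun t : ℝ => L / 2 * t ^ 2 * ‖d‖ ^ 2) (L * t * ‖d‖ ^ 2) t := by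
      have := (((hasDerivAt_pow 2 t).const_mul (L / 2)).mul_const (‖d‖ ^ 2))
      refine this.congr_deriv ?_
      push_cast
      ring
    exact (h2.sub h4).sub h5
  have hanti : AntitoneOn φ (Set.Icc 0 1) := by
    refine antitoneOn_of_deriv_nonpos (convex_Icc 0 1)
      (fun t _ => (hφ t).continuousAt.continuousWithinAt)
      (fun t _ => (hφ t).differentiableAt.differentiableWithinAt) fun t ht => ?_
    rw [interior_Icc] at ht
    rw [(hφ t).deriv, ← inner_sub_left]
    have h1 : ⟪gradient g (x + t • d) - gradient g x, d⟫_ℝ ≤ L * t * ‖d‖ ^ 2 := by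
      calc _ ≤ ‖gradient g (x + t • d) - gradient g x‖ * ‖d‖ := real_inner_le_norm _ _
        _ ≤ L * ‖x + t • d - x‖ * ‖d‖ := by gcongr; exact hL _ _
        _ = L * t * ‖d‖ ^ 2 := by
          rw [add_sub_cancel_left, norm_smul, Real.norm_of_nonneg ht.1.le]; ring
    linarith
  have h := hanti (Set.left_mem_Icc.2 zero_le_one) (Set.right_mem_Icc.2 zero_le_one) zero_le_one
  have hy : x + d = y := by rw [hd, add_sub_cancel]
  simp only [φ, one_smul, zero_smul, add_zero, hy] at h
  linarith

lemma mean_sub (v w : Fin n → Vec p) : mean (fun i => v i - w i) = mean v - mean w := by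
  simp [mean, smul_sub]

lemma mean_add (v w : Fin n → Vec p) : mean (fun i => v i + w i) = mean v + mean w := by
  simp [mean, smul_add, Finset.sum_add_distrib]

lemma mean_smul (c : ℝ) (v : Fin n → Vec p) : mean (fun i => c • v i) = c • mean v := by
  simp [mean, ← Finset.smul_sum, smul_comm c]

/-! ### The average of smooth objectives -/

section Smooth

variable {f : Fin n → Vec p → ℝ} {L : ℝ} {flow : Fin n → ℝ}

lemma IsSmoothBddBelow.hasGradientAt_avgObj (hf : IsSmoothBddBelow f L flow) (x : Vec p) :
    HasGradientAt (avgObj f) (mean fun i => gradient (f i) x) x := by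
  rw [hasGradientAt_iff_hasFDerivAt]
  have h : HasFDerivAt (fun y => ∑ i, f i y)
      (∑ i, InnerProductSpace.toDual ℝ (Vec p) (gradient (f i) x)) x :=
    HasFDerivAt.fun_sum fun i _ => (hf.differentiable i x).hasGradientAt.hasFDerivAt
  have h2 := h.const_mul (1 / (n : ℝ))
  refine h2.congr_fderiv ?_
  rw [mean, map_smul, map_sum]

lemma IsSmoothBddBelow.gradient_avgObj (hf : IsSmoothBddBelow f L flow) (x : Vec p) :
    gradient (avgObj f) x = mean fun i => gradient (f i) x :=
  (hf.hasGradientAt_avgObj x).gradient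

lemma IsSmoothBddBelow.differentiable_avgObj (hf : IsSmoothBddBelow f L flow) :
    Differentiable ℝ (avgObj f) := fun x =>
  (hf.hasGradientAt_avgObj x).hasFDerivAt.differentiableAt

lemma norm_mean_le (hn : 0 < n) {v : Fin n → Vec p} {c : ℝ} (hv : ∀ i, ‖v i‖ ≤ c) :
    ‖mean v‖ ≤ c := by
  have hn' : (n : ℝ) ≠ 0 := by positivity
  rw [mean, norm_smul, Real.norm_of_nonneg (by positivity)]
  calc 1 / (n : ℝ) * ‖∑ i, v i‖ ≤ 1 / (n : ℝ) * ∑ _i : Fin n, c := by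
        gcongr
        exact norm_sum_le_of_le _ fun i _ => hv i
    _ = c := by simp [hn']

lemma IsSmoothBddBelow.lipschitz_avgObj (hn : 0 < n) (hf : IsSmoothBddBelow f L flow)
    (x y : Vec p) : ‖gradient (avgObj f) x - gradient (avgObj f) y‖ ≤ L * ‖x - y‖ := by
  rw [hf.gradient_avgObj, hf.gradient_avgObj, ← mean_sub]
  exact norm_mean_le hn fun i => hf.lipschitz i x y

lemma IsSmoothBddBelow.le_avgObj (hf : IsSmoothBddBelow f L flow) (x : Vec p) :
    (1 / (n : ℝ)) * ∑ i, flow i ≤ avgObj f x := by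
  unfold avgObj
  gcongr with i
  exact hf.lower_bound i x

lemma continuous_of_norm_sub_le {g : Vec p → Vec p} {L : ℝ}
    (h : ∀ x y, ‖g x - g y‖ ≤ L * ‖x - y‖) : Continuous g := by
  have : LipschitzWith (Real.toNNReal L) g := LipschitzWith.of_dist_le' fun x y => by
    simpa [dist_eq_norm] using h x y
  exact this.continuous

lemma IsSmoothBddBelow.continuous_gradient (hf : IsSmoothBddBelow f L flow) (i : Fin n) :
    Continuous (gradient (f i)) := continuous_of_norm_sub_le (hf.lipschitz i)

lemma IsSmoothBddBelow.continuous_gradient_avgObj (hn : 0 < n) (hf : IsSmoothBddBelow f L flow) :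
    Continuous (gradient (avgObj f)) := continuous_of_norm_sub_le (hf.lipschitz_avgObj hn)

end Smooth

end Cedas

namespace Cedas
open scoped InnerProductSpace

/-! ### Square integrable random vectors -/

section L2

variable {p : ℕ} {Ω : Type*} {mΩ : MeasurableSpace Ω} {μ : Measure Ω}

lemma integrable_norm_sq_of_memLp {X : Ω → Vec p} (hX : MemLp X 2 μ) :
    Integrable (fun ω => ‖X ω‖ ^ 2) μ := by
  simpa using hX.integrable_norm_pow (by norm_num)

lemma integrable_inner_of_memLp {X Y : Ω → Vec p} (hX : MemLp X 2 μ) (hY : MemLp Y 2 μ) :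
    Integrable (fun ω => ⟪X ω, Y ω⟫_ℝ) μ := by
  have h1 := integrable_norm_sq_of_memLp hX
  have h2 := integrable_norm_sq_of_memLp hY
  refine (h1.add h2).mono' (hX.1.inner hY.1) (Filter.Eventually.of_forall fun ω => ?_)
  have := norm_inner_le_norm (𝕜 := ℝ) (X ω) (Y ω)
  simp only [Pi.add_apply]
  nlinarith [sq_nonneg (‖X ω‖ - ‖Y ω‖), sq_nonneg (‖X ω‖), sq_nonneg (‖Y ω‖)]

lemma memLp_comp_of_norm_sub_le [IsFiniteMeasure μ] {g : Vec p → Vec p} {L : ℝ}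
    (hg : ∀ x y, ‖g x - g y‖ ≤ L * ‖x - y‖) {X : Ω → Vec p} (hX : MemLp X 2 μ) :
    MemLp (fun ω => g (X ω)) 2 μ := by
  have h : MemLp (fun ω => g (X ω) - g 0) 2 μ := by
    refine MemLp.of_le_mul (c := L) hX
      (((continuous_of_norm_sub_le hg).comp_aestronglyMeasurable hX.1).sub
        aestronglyMeasurable_const) (Filter.Eventually.of_forall fun ω => ?_)
    simpa using hg (X ω) 0
  exact (h.add (memLp_const (g 0))).ae_eq (Filter.Eventually.of_forall fun ω => by simp)

end L2

/-! ### Conditional independence -/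

section CondIndep

variable {p : ℕ} {Ω : Type*} {m m₁ m₂ mΩ : MeasurableSpace Ω} {μ : Measure Ω}

lemma sup_eq_generateFrom_image2_inter (m₁ m₂ : MeasurableSpace Ω) :
    m₁ ⊔ m₂ = MeasurableSpace.generateFrom
      (Set.image2 (· ∩ ·) {s | MeasurableSet[m₁] s} {t | MeasurableSet[m₂] t}) := by
  apply le_antisymm
  · refine sup_le (fun s hs => ?_) fun t ht => ?_
    · exact MeasurableSpace.measurableSet_generateFrom ⟨s, hs, Set.univ, MeasurableSet.univ, by simp⟩
    · exact MeasurableSpace.measurableSet_generateFrom ⟨Set.univ, MeasurableSet.univ, t, ht, by simp⟩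
  · refine MeasurableSpace.generateFrom_le ?_
    rintro _ ⟨s, hs, t, ht, rfl⟩
    exact @MeasurableSet.inter _ (m₁ ⊔ m₂) _ _ ((le_sup_left : m₁ ≤ m₁ ⊔ m₂) s hs)
      ((le_sup_right : m₂ ≤ m₁ ⊔ m₂) t ht)

lemma isPiSystem_image2_inter (m₁ m₂ : MeasurableSpace Ω) :
    IsPiSystem (Set.image2 (· ∩ ·) {s | MeasurableSet[m₁] s} {t | MeasurableSet[m₂] t}) := by
  rintro _ ⟨s, hs, t, ht, rfl⟩ _ ⟨s', hs', t', ht', rfl⟩ _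
  exact ⟨s ∩ s', MeasurableSet.inter hs hs', t ∩ t', MeasurableSet.inter ht ht',
    Set.inter_inter_inter_comm _ _ _ _⟩

/-- A π-λ argument on the intersections s ∩ t. The case s = t = Ω supplies the vanishing total
integral that complements require. -/
lemma setIntegral_eq_zero_of_sup {E : Type*} [NormedAddCommGroup E] [NormedSpace ℝ E]
    {φ : Ω → E} (hm₁ : m₁ ≤ mΩ) (hm₂ : m₂ ≤ mΩ) (hφ : Integrable φ μ)
    (h : ∀ s t, MeasurableSet[m₁] s → MeasurableSet[m₂] t → ∫ ω in s ∩ t, φ ω ∂μ = 0)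
    {A : Set Ω} (hA : MeasurableSet[m₁ ⊔ m₂] A) : ∫ ω in A, φ ω ∂μ = 0 := by
  have hle : m₁ ⊔ m₂ ≤ mΩ := sup_le hm₁ hm₂
  induction A, hA using MeasurableSpace.induction_on_inter
    (sup_eq_generateFrom_image2_inter m₁ m₂) (isPiSystem_image2_inter m₁ m₂) with
  | empty => simp
  | basic u hu =>
    obtain ⟨s, hs, t, ht, rfl⟩ := hu
    exact h s t hs ht
  | compl t ht ih =>
    have h1 := integral_add_compl (hle t ht) hφ
    have h2 := h Set.univ Set.univ MeasurableSet.univ MeasurableSet.univ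
    simp only [Set.inter_univ, Measure.restrict_univ] at h2
    rw [h2, ih, zero_add] at h1
    exact h1
  | iUnion g hd hg ih =>
    rw [integral_iUnion (fun i => hle _ (hg i)) hd hφ.integrableOn]
    simp [ih]

/-- It suffices to test on M ∩ B with M in `m` and B in `m₂`. There P(A | m) integrates to the
integral over M of P(A | m) P(B | m), which is P(A ∩ B | m) by conditional independence. -/
lemma condExp_indicator_sup_of_condIndep [IsProbabilityMeasure μ] (hm : m ≤ mΩ) (hm₁ : m₁ ≤ mΩ) (hm₂ : m₂ ≤ mΩ)
    (h : ∀ A B, MeasurableSet[m₁] A → MeasurableSet[m₂] B →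
      μ⟦A ∩ B | m⟧ =ᵐ[μ] fun ω => (μ⟦A | m⟧) ω * (μ⟦B | m⟧) ω)
    {A : Set Ω} (hA : MeasurableSet[m₁] A) : μ⟦A | m ⊔ m₂⟧ =ᵐ[μ] μ⟦A | m⟧ := by
  have hind : ∀ S, MeasurableSet[mΩ] S → Integrable (S.indicator fun _ : Ω => (1 : ℝ)) μ :=
    fun S hS => (integrable_const (1 : ℝ)).indicator hS
  have hint : Integrable (fun ω => (μ⟦A | m⟧) ω - A.indicator (fun _ => (1 : ℝ)) ω) μ :=
    integrable_condExp.sub (hind A (hm₁ A hA))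
  symm
  refine ae_eq_condExp_of_forall_setIntegral_eq (sup_le hm hm₂) (hind A (hm₁ A hA))
    (fun _ _ _ => integrable_condExp.integrableOn) (fun S hS _ => ?_)
    ((stronglyMeasurable_condExp (m := m)).mono (le_sup_left : m ≤ m ⊔ m₂)).aestronglyMeasurable
  rw [← sub_eq_zero, ← integral_sub integrable_condExp.integrableOn
    (hind A (hm₁ A hA)).integrableOn]
  refine setIntegral_eq_zero_of_sup hm hm₂ hint (fun M B hM hB => ?_) hS
  rw [integral_sub integrable_condExp.integrableOn (hind A (hm₁ A hA)).integrableOn, sub_eq_zero]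
  have hBm := hm₂ B hB
  have hAm := hm₁ A hA
  have hprod : Integrable (B.indicator (fun _ => (1 : ℝ)) * μ⟦A | m⟧) μ := by
    have : B.indicator (fun _ => (1 : ℝ)) * μ⟦A | m⟧ = B.indicator (μ⟦A | m⟧) := by
      ext ω
      by_cases hω : ω ∈ B <;> simp [hω]
    rw [this]
    exact integrable_condExp.indicator hBm
  calc ∫ ω in M ∩ B, (μ⟦A | m⟧) ω ∂μ
      = ∫ ω in M, (B.indicator (fun _ => (1 : ℝ)) * μ⟦A | m⟧) ω ∂μ := by
        rw [← setIntegral_indicator hBm]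
        refine integral_congr_ae (Filter.Eventually.of_forall fun ω => ?_)
        by_cases hω : ω ∈ B <;> simp [hω]
    _ = ∫ ω in M, (μ[B.indicator (fun _ => (1 : ℝ)) * μ⟦A | m⟧ | m]) ω ∂μ :=
        (setIntegral_condExp hm hprod hM).symm
    _ = ∫ ω in M, (μ⟦A ∩ B | m⟧) ω ∂μ := by
        refine integral_congr_ae (ae_restrict_of_ae ?_)
        filter_upwards [condExp_mul_of_aestronglyMeasurable_right (m := m)
          (stronglyMeasurable_condExp (m := m) (μ := μ)
            (f := A.indicator fun _ => (1 : ℝ))).aestronglyMeasurable hprod (hind B hBm),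
          h A B hA hB] with ω h1 h2
        rw [h1, h2, Pi.mul_apply, mul_comm]
    _ = ∫ ω in M, (A ∩ B).indicator (fun _ => (1 : ℝ)) ω ∂μ :=
        setIntegral_condExp hm (hind _ (hAm.inter hBm)) hM
    _ = ∫ ω in M ∩ B, A.indicator (fun _ => (1 : ℝ)) ω ∂μ := by
        rw [← setIntegral_indicator hBm, Set.inter_comm A B, Set.indicator_indicator]

/-- This gives uncorrelated gradient noise: learning the sample of one agent does not bias the noise
of another. Since `V` depends on `m ⊔ m₂`, the indicator of an event A of `m₁` may be replaced by
P(A | m ⊔ m₂) = P(A | m). That weight is `m`-measurable, so E[V | m] = 0 applies. -/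
lemma condExp_sup_eq_zero_of_condIndep [IsProbabilityMeasure μ] (hm : m ≤ mΩ) (hm₁ : m₁ ≤ mΩ) (hm₂ : m₂ ≤ mΩ)
    (h : ∀ A B, MeasurableSet[m₁] A → MeasurableSet[m₂] B →
      μ⟦A ∩ B | m⟧ =ᵐ[μ] fun ω => (μ⟦A | m⟧) ω * (μ⟦B | m⟧) ω)
    {V : Ω → Vec p} (hV : Integrable V μ) (hVm : AEStronglyMeasurable[m ⊔ m₂] V μ)
    (hV0 : μ[V | m] =ᵐ[μ] 0) : μ[V | m ⊔ m₁] =ᵐ[μ] 0 := by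
  symm
  refine ae_eq_condExp_of_forall_setIntegral_eq (sup_le hm hm₁) hV
    (fun _ _ _ => (integrable_zero _ _ _).integrableOn) (fun S hS _ => ?_)
    aestronglyMeasurable_zero
  simp only [Pi.zero_apply, integral_zero]
  symm
  refine setIntegral_eq_zero_of_sup hm hm₁ hV (fun M A hM hA => ?_) hS
  have hAm := hm₁ A hA
  have hMm := hm M hM
  have hsmul : ∀ (S : Set Ω) (W : Ω → Vec p),
      (S.indicator (fun _ => (1 : ℝ))) • W = S.indicator W := fun S W => by
    ext1 ω
    by_cases hω : ω ∈ S <;> simp [hω]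
  have hind : Integrable (A.indicator fun _ : Ω => (1 : ℝ)) μ :=
    (integrable_const (1 : ℝ)).indicator hAm
  have hMV : Integrable (M.indicator V) μ := hV.indicator hMm
  have hMVm : AEStronglyMeasurable[m ⊔ m₂] (M.indicator V) μ :=
    ⟨M.indicator (hVm.mk V),
      hVm.stronglyMeasurable_mk.indicator ((le_sup_left : m ≤ m ⊔ m₂) M hM), by
      filter_upwards [hVm.ae_eq_mk] with ω hω
      by_cases hM' : ω ∈ M <;> simp [hM', hω]⟩
  have hAMV : Integrable ((A.indicator (fun _ => (1 : ℝ))) • M.indicator V) μ := by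
    rw [hsmul]
    exact hMV.indicator hAm
  have hb : ∀ᵐ ω ∂μ, |(μ⟦A | m⟧) ω| ≤ 1 := by
    have := ae_bdd_abs_condExp_of_ae_bdd_abs (m := m) (μ := μ) (R := 1)
      (f := A.indicator fun _ : Ω => (1 : ℝ)) (Filter.Eventually.of_forall fun ω => by
        by_cases hω : ω ∈ A <;> simp [hω])
    simpa using this
  have hPV : Integrable (μ⟦A | m⟧ • V) μ := by
    refine hV.norm.mono' ((stronglyMeasurable_condExp.mono hm).aestronglyMeasurable.smul hV.1) ?_
    filter_upwards [hb] with ω hω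
    rw [Pi.smul_apply', norm_smul, Real.norm_eq_abs]
    exact mul_le_of_le_one_left (norm_nonneg _) hω
  calc ∫ ω in M ∩ A, V ω ∂μ
      = ∫ ω, ((A.indicator (fun _ => (1 : ℝ))) • M.indicator V) ω ∂μ := by
        rw [hsmul, integral_indicator hAm, setIntegral_indicator hMm, Set.inter_comm]
    _ = ∫ ω, (μ[(A.indicator (fun _ => (1 : ℝ))) • M.indicator V | m ⊔ m₂]) ω ∂μ :=
        (integral_condExp (sup_le hm hm₂)).symm
    _ = ∫ ω, M.indicator (μ⟦A | m⟧ • V) ω ∂μ := by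
        refine integral_congr_ae ?_
        filter_upwards [condExp_smul_of_aestronglyMeasurable_right hind hAMV hMVm,
          condExp_indicator_sup_of_condIndep hm hm₁ hm₂ h hA] with ω h1 h2
        rw [h1, Pi.smul_apply', h2]
        by_cases hω : ω ∈ M <;> simp [hω]
    _ = ∫ ω in M, (μ⟦A | m⟧ • V) ω ∂μ := integral_indicator hMm
    _ = ∫ ω in M, (μ[μ⟦A | m⟧ • V | m]) ω ∂μ := (setIntegral_condExp hm hPV hM).symm
    _ = ∫ ω in M, (0 : Vec p) ∂μ := by
        refine integral_congr_ae (ae_restrict_of_ae ?_)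
        filter_upwards [condExp_smul_of_aestronglyMeasurable_left (m := m)
          stronglyMeasurable_condExp.aestronglyMeasurable hPV hV, hV0] with ω h1 h2
        rw [h1, Pi.smul_apply', h2, Pi.zero_apply, smul_zero]
    _ = 0 := by simp

lemma integral_inner_eq_zero_of_condExp_eq_zero [IsFiniteMeasure μ] (hm : m ≤ mΩ)
    {U V : Ω → Vec p}
    (hU : AEStronglyMeasurable[m] U μ) (hU2 : MemLp U 2 μ) (hV2 : MemLp V 2 μ)
    (hV0 : μ[V | m] =ᵐ[μ] 0) : ∫ ω, ⟪U ω, V ω⟫_ℝ ∂μ = 0 := by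
  rw [← integral_condExp hm]
  have h := condExp_bilin_of_aestronglyMeasurable_left (m := m) (μ := μ)
    (innerSL ℝ : Vec p →L[ℝ] Vec p →L[ℝ] ℝ) hU
    (integrable_inner_of_memLp hU2 hV2) (hV2.integrable (by norm_num))
  calc _ = ∫ _, (0 : ℝ) ∂μ := by
        refine integral_congr_ae ?_
        filter_upwards [h, hV0] with ω h1 h2
        have h3 : (μ[fun ω => ⟪U ω, V ω⟫_ℝ | m]) ω = innerSL ℝ (U ω) ((μ[V | m]) ω) := h1
        rw [h3, h2]
        simp
    _ = 0 := by simp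

end CondIndep

/-! ### Centered noise -/

section Noise

variable {n p : ℕ} {Ω : Type*} {m mΩ : MeasurableSpace Ω} {μ : Measure Ω}

/-- Square integrable random vectors `v_i` that are orthogonal to the square integrable
`m`-measurable random vectors, uncorrelated, and have variance at most `σ²`. -/
structure IsCenteredNoise (m : MeasurableSpace Ω) {mΩ : MeasurableSpace Ω} (μ : Measure Ω)
    (v : Fin n → Ω → Vec p) (σ : ℝ) : Prop where
  memLp : ∀ i, MemLp (v i) 2 μ
  orthogonal : ∀ i (X : Ω → Vec p), Measurable[m] X → MemLp X 2 μ →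
    ∫ ω, ⟪X ω, v i ω⟫_ℝ ∂μ = 0
  uncorrelated : ∀ i j, i ≠ j → ∫ ω, ⟪v i ω, v j ω⟫_ℝ ∂μ = 0
  variance : ∀ i, ∫ ω, ‖v i ω‖ ^ 2 ∂μ ≤ σ ^ 2

lemma memLp_mean {v : Fin n → Ω → Vec p} (hv : ∀ i, MemLp (v i) 2 μ) :
    MemLp (fun ω => mean fun i => v i ω) 2 μ :=
  (memLp_finsetSum Finset.univ fun i _ => hv i).const_smul (1 / (n : ℝ))

lemma integrable_stackSq {v : Fin n → Ω → Vec p} (hv : ∀ i, MemLp (v i) 2 μ) :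
    Integrable (fun ω => stackSq fun i => v i ω) μ :=
  integrable_finsetSum _ fun i _ => integrable_norm_sq_of_memLp (hv i)

lemma integral_stackSq {v : Fin n → Ω → Vec p} (hv : ∀ i, MemLp (v i) 2 μ) :
    ∫ ω, stackSq (fun i => v i ω) ∂μ = ∑ i, ∫ ω, ‖v i ω‖ ^ 2 ∂μ :=
  integral_finsetSum _ fun i _ => integrable_norm_sq_of_memLp (hv i)

lemma norm_mean_sq (v : Fin n → Vec p) :
    ‖mean v‖ ^ 2 = (1 / (n : ℝ)) ^ 2 * ∑ i, ∑ j, ⟪v i, v j⟫_ℝ := by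
  rw [mean, norm_smul, mul_pow, ← real_inner_self_eq_norm_sq (∑ i, v i), sum_inner]
  simp_rw [inner_sum]
  simp

lemma IsCenteredNoise.integral_stackSq_le {v : Fin n → Ω → Vec p} {σ : ℝ}
    (hv : IsCenteredNoise m μ v σ) : ∫ ω, stackSq (fun i => v i ω) ∂μ ≤ n * σ ^ 2 := by
  rw [integral_stackSq hv.memLp]
  calc _ ≤ ∑ _i : Fin n, σ ^ 2 := Finset.sum_le_sum fun i _ => hv.variance i
    _ = _ := by simp

/-- Only the n diagonal terms of the double sum survive. This is the source of the linear speedup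
σ²/n. -/
lemma IsCenteredNoise.integral_norm_mean_sq_le {v : Fin n → Ω → Vec p} {σ : ℝ}
    (hv : IsCenteredNoise m μ v σ) (hn : 0 < n) :
    ∫ ω, ‖mean fun i => v i ω‖ ^ 2 ∂μ ≤ σ ^ 2 / n := by
  have hn' : (n : ℝ) ≠ 0 := by positivity
  simp_rw [norm_mean_sq]
  rw [integral_const_mul, integral_finsetSum _ fun i _ => integrable_finsetSum _ fun j _ =>
    integrable_inner_of_memLp (hv.memLp i) (hv.memLp j)]
  have h : ∀ i, ∫ ω, ∑ j, ⟪v i ω, v j ω⟫_ℝ ∂μ ≤ σ ^ 2 := fun i => by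
    rw [integral_finsetSum _ fun j _ => integrable_inner_of_memLp (hv.memLp i) (hv.memLp j),
      Finset.sum_eq_single i (fun j _ hj => hv.uncorrelated i j hj.symm) (by simp)]
    simp_rw [real_inner_self_eq_norm_sq]
    exact hv.variance i
  calc _ ≤ (1 / (n : ℝ)) ^ 2 * ∑ _i : Fin n, σ ^ 2 := by
        gcongr with i
        exact h i
    _ = _ := by simp; field_simp

end Noise

/-! ### Compression errors -/

section Compression

variable {p : ℕ} {Ω Z : Type*} [MeasurableSpace Z] {m mΩ : MeasurableSpace Ω} {μ : Measure Ω}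
  [IsProbabilityMeasure μ] {ν : Measure Z} {comp : Vec p → Z → Vec p}
  {C : ℝ} {Y : Ω → Vec p} {ζ : Ω → Z}

/-- A fresh seed has a product law with every past variable, so the compressor bounds, stated for a
fixed input, extend to random inputs by Fubini. -/
lemma map_prodMk_eq_of_indep (hm : m ≤ mΩ) {E : Type*} [MeasurableSpace E] {U : Ω → E}
    (hU : Measurable[m] U) (hζ : Measurable ζ) (hlaw : μ.map ζ = ν)
    (hind : Indep (MeasurableSpace.comap ζ inferInstance) m μ) :
    μ.map (fun ω => (U ω, ζ ω)) = (μ.map U).prod ν := by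
  have h : IndepFun U ζ μ := (indep_of_indep_of_le_right hind hU.comap_le).symm
  rw [(indepFun_iff_map_prod_eq_prod_map_map (hU.mono hm le_rfl).aemeasurable hζ.aemeasurable).1 h,
    hlaw]

variable [IsProbabilityMeasure ν]

lemma IsUnbiasedCompressor.integrable_norm_sub_sq (hcomp : IsUnbiasedCompressor ν comp C)
    {κ : Measure (Vec p)} [IsProbabilityMeasure κ] (hκ : Integrable (fun y => ‖y‖ ^ 2) κ) :
    Integrable (fun w : Vec p × Z => ‖comp w.1 w.2 - w.1‖ ^ 2) (κ.prod ν) := by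
  have hmeas : Measurable fun w : Vec p × Z => ‖comp w.1 w.2 - w.1‖ ^ 2 :=
    ((hcomp.measurable.sub measurable_fst).norm).pow_const 2
  rw [integrable_prod_iff hmeas.aestronglyMeasurable]
  refine ⟨Filter.Eventually.of_forall fun y =>
    integrable_norm_sq_of_memLp ((hcomp.memLp y).sub (memLp_const y)), ?_⟩
  refine (hκ.const_mul C).mono' ?_ (Filter.Eventually.of_forall fun y => ?_)
  · exact hmeas.norm.aestronglyMeasurable.integral_prod_right'
  · rw [Real.norm_of_nonneg (integral_nonneg fun _ => norm_nonneg _)]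
    simpa using hcomp.variance y

lemma IsUnbiasedCompressor.memLp_error (hcomp : IsUnbiasedCompressor ν comp C) (hm : m ≤ mΩ)
    (hY : Measurable[m] Y) (hY2 : MemLp Y 2 μ) (hζ : Measurable ζ) (hlaw : μ.map ζ = ν)
    (hind : Indep (MeasurableSpace.comap ζ inferInstance) m μ) :
    MemLp (fun ω => comp (Y ω) (ζ ω) - Y ω) 2 μ := by
  have hY' : Measurable Y := hY.mono hm le_rfl
  have := Measure.isProbabilityMeasure_map (μ := μ) hY'.aemeasurable
  have hmeas : Measurable fun ω => comp (Y ω) (ζ ω) - Y ω :=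
    (hcomp.measurable.comp (hY'.prodMk hζ)).sub hY'
  rw [memLp_two_iff_integrable_sq_norm hmeas.aestronglyMeasurable]
  have h : Integrable (fun w : Vec p × Z => ‖comp w.1 w.2 - w.1‖ ^ 2) ((μ.map Y).prod ν) := by
    refine hcomp.integrable_norm_sub_sq ?_
    rw [integrable_map_measure (by fun_prop) hY'.aemeasurable]
    exact integrable_norm_sq_of_memLp hY2
  have hmeas2 : Measurable fun w : Vec p × Z => ‖comp w.1 w.2 - w.1‖ ^ 2 :=
    (hcomp.measurable.sub measurable_fst).norm.pow_const 2
  rw [← map_prodMk_eq_of_indep hm hY hζ hlaw hind, integrable_map_measure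
    hmeas2.aestronglyMeasurable (hY'.prodMk hζ).aemeasurable] at h
  exact h

lemma IsUnbiasedCompressor.integral_error_sq_le (hcomp : IsUnbiasedCompressor ν comp C)
    (hm : m ≤ mΩ) (hY : Measurable[m] Y) (hY2 : MemLp Y 2 μ) (hζ : Measurable ζ)
    (hlaw : μ.map ζ = ν) (hind : Indep (MeasurableSpace.comap ζ inferInstance) m μ) :
    ∫ ω, ‖comp (Y ω) (ζ ω) - Y ω‖ ^ 2 ∂μ ≤ C * ∫ ω, ‖Y ω‖ ^ 2 ∂μ := by
  have hY' : Measurable Y := hY.mono hm le_rfl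
  have := Measure.isProbabilityMeasure_map (μ := μ) hY'.aemeasurable
  have hmeas : Measurable fun w : Vec p × Z => ‖comp w.1 w.2 - w.1‖ ^ 2 :=
    (hcomp.measurable.sub measurable_fst).norm.pow_const 2
  have hsq : Integrable (fun y : Vec p => ‖y‖ ^ 2) (μ.map Y) := by
    rw [integrable_map_measure (by fun_prop) hY'.aemeasurable]
    exact integrable_norm_sq_of_memLp hY2
  have h := hcomp.integrable_norm_sub_sq hsq
  calc ∫ ω, ‖comp (Y ω) (ζ ω) - Y ω‖ ^ 2 ∂μ
      = ∫ w, ‖comp w.1 w.2 - w.1‖ ^ 2 ∂(μ.map fun ω => (Y ω, ζ ω)) :=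
        (integral_map (hY'.prodMk hζ).aemeasurable hmeas.aestronglyMeasurable).symm
    _ = ∫ y, ∫ z, ‖comp y z - y‖ ^ 2 ∂ν ∂(μ.map Y) := by
        rw [map_prodMk_eq_of_indep hm hY hζ hlaw hind, integral_prod _ h]
    _ ≤ ∫ y, C * ‖y‖ ^ 2 ∂(μ.map Y) :=
        integral_mono h.integral_prod_left (hsq.const_mul C) fun y => hcomp.variance y
    _ = C * ∫ ω, ‖Y ω‖ ^ 2 ∂μ := by
        rw [integral_const_mul, integral_map hY'.aemeasurable (by fun_prop)]

/-- The pair (X, Y) is independent of the seed; for each fixed value of the pair the inner integral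
vanishes by unbiasedness. -/
lemma IsUnbiasedCompressor.integral_inner_error (hcomp : IsUnbiasedCompressor ν comp C)
    (hm : m ≤ mΩ) (hY : Measurable[m] Y) (hY2 : MemLp Y 2 μ) (hζ : Measurable ζ)
    (hlaw : μ.map ζ = ν) (hind : Indep (MeasurableSpace.comap ζ inferInstance) m μ)
    {X : Ω → Vec p} (hX : Measurable[m] X) (hX2 : MemLp X 2 μ) :
    ∫ ω, ⟪X ω, comp (Y ω) (ζ ω) - Y ω⟫_ℝ ∂μ = 0 := by
  have hU : Measurable[m] fun ω => (X ω, Y ω) := hX.prodMk hY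
  have hU' : Measurable fun ω => (X ω, Y ω) := hU.mono hm le_rfl
  have := Measure.isProbabilityMeasure_map (μ := μ) hU'.aemeasurable
  have hmeas : Measurable fun w : (Vec p × Vec p) × Z => ⟪w.1.1, comp w.1.2 w.2 - w.1.2⟫_ℝ := by
    refine Measurable.inner (by fun_prop) (Measurable.sub ?_ (by fun_prop))
    exact hcomp.measurable.comp ((measurable_snd.comp measurable_fst).prodMk measurable_snd)
  have hint : Integrable (fun w : (Vec p × Vec p) × Z => ⟪w.1.1, comp w.1.2 w.2 - w.1.2⟫_ℝ)
      ((μ.map fun ω => (X ω, Y ω)).prod ν) := by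
    rw [← map_prodMk_eq_of_indep hm hU hζ hlaw hind,
      integrable_map_measure hmeas.aestronglyMeasurable (hU'.prodMk hζ).aemeasurable]
    exact integrable_inner_of_memLp hX2 (hcomp.memLp_error hm hY hY2 hζ hlaw hind)
  have hcomp1 : ∀ y, Integrable (fun z => comp y z) ν := fun y =>
    (hcomp.memLp y).integrable (by norm_num)
  calc ∫ ω, ⟪X ω, comp (Y ω) (ζ ω) - Y ω⟫_ℝ ∂μ
      = ∫ w, ⟪w.1.1, comp w.1.2 w.2 - w.1.2⟫_ℝ ∂(μ.map fun ω => ((X ω, Y ω), ζ ω)) :=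
        (integral_map (hU'.prodMk hζ).aemeasurable hmeas.aestronglyMeasurable).symm
    _ = ∫ u, ∫ z, ⟪u.1, comp u.2 z - u.2⟫_ℝ ∂ν ∂(μ.map fun ω => (X ω, Y ω)) := by
        rw [map_prodMk_eq_of_indep hm hU hζ hlaw hind, integral_prod _ hint]
    _ = 0 := by
        have h0 : ∀ u : Vec p × Vec p, ∫ z, ⟪u.1, comp u.2 z - u.2⟫_ℝ ∂ν = 0 := fun u => by
          have h1 : Integrable (fun z => comp u.2 z - u.2) ν :=
            (hcomp1 u.2).sub (integrable_const u.2)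
          rw [integral_inner h1, integral_sub (hcomp1 u.2) (integrable_const u.2), hcomp.unbiased]
          simp
        simp [h0]

end Compression

end Cedas

namespace Cedas
open scoped InnerProductSpace

variable {n p : ℕ} {Ω Ξ Z : Type*}

/-! ### Closure of the iteration under linear spaces of random vectors -/

/-- The square integrable random vectors. -/
def memLpSubmodule (p : ℕ) {mΩ : MeasurableSpace Ω} (μ : Measure Ω) :
    Submodule ℝ (Ω → Vec p) where
  carrier := {X | MemLp X 2 μ}
  zero_mem' := MemLp.zero
  add_mem' := fun hX hY => MemLp.add hX hY
  smul_mem' := fun c _ hX => MemLp.const_smul hX c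

/-- The `m`-measurable random vectors. -/
def measurableSubmodule (p : ℕ) (m : MeasurableSpace Ω) : Submodule ℝ (Ω → Vec p) where
  carrier := {X | Measurable[m] X}
  zero_mem' := measurable_const
  add_mem' := fun hX hY => Measurable.add hX hY
  smul_mem' := fun c _ hX => Measurable.const_smul hX c

/-- All components of the random state `S` belong to `V`. -/
structure StateMem (V : Submodule ℝ (Ω → Vec p)) (S : Ω → State n p) : Prop where
  x : ∀ i, (fun ω => (S ω).x i) ∈ V
  h : ∀ i, (fun ω => (S ω).h i) ∈ V
  hw : ∀ i, (fun ω => (S ω).hw i) ∈ V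
  d : ∀ i, (fun ω => (S ω).d i) ∈ V

lemma StateMem.mono {V V' : Submodule ℝ (Ω → Vec p)} (hV : V ≤ V') {S : Ω → State n p}
    (hS : StateMem V S) : StateMem V' S :=
  ⟨fun i => hV (hS.x i), fun i => hV (hS.h i), fun i => hV (hS.hw i), fun i => hV (hS.d i)⟩

section Closure

variable (A : Algorithm n p Ξ Z) (V : Submodule ℝ (Ω → Vec p))

lemma sum_smul_mem {v : Ω → Fin n → Vec p} (hv : ∀ i, (fun ω => v ω i) ∈ V)
    (t : Finset (Fin n)) (c : Fin n → ℝ) : (fun ω => ∑ i ∈ t, c i • v ω i) ∈ V := by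
  have h := V.sum_mem (t := t) (f := fun i => c i • fun ω => v ω i)
    fun i _ => V.smul_mem (c i) (hv i)
  convert h using 1
  ext1 ω
  simp

lemma mean_mem {v : Ω → Fin n → Vec p} (hv : ∀ i, (fun ω => v ω i) ∈ V) :
    (fun ω => mean (v ω)) ∈ V := by
  have h := sum_smul_mem V hv Finset.univ (fun _ => 1)
  have h2 := V.smul_mem (1 / (n : ℝ)) h
  simpa [mean, Pi.smul_def] using h2

lemma mode_mem {v : Ω → Fin n → Vec p} (hv : ∀ i, (fun ω => v ω i) ∈ V)
    (Q : Matrix (Fin n) (Fin n) ℝ) (t : Fin n) : (fun ω => mode Q t (v ω)) ∈ V := by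
  simp_rw [mode_apply]
  exact sum_smul_mem V hv _ _

variable {A V} {S : Ω → State n p} {ξ : Fin n → Ω → Ξ} {ζ : Fin n → Ω → Z}

lemma StateMem.y (hS : StateMem V S)
    (hg : ∀ i, (fun ω => A.grad i ((S ω).x i) (ξ i ω)) ∈ V) (i : Fin n) :
    (fun ω => A.y (fun i => ξ i ω) (S ω) i) ∈ V :=
  V.sub_mem (V.sub_mem (hS.x i) (V.smul_mem A.η (hg i))) (hS.d i)

/-- Apart from the gradients and the compressor the iteration is linear, so it preserves every
linear space containing their outputs. Used with both `measurableSubmodule` and `memLpSubmodule`. -/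
lemma StateMem.step (hS : StateMem V S)
    (hg : ∀ i, (fun ω => A.grad i ((S ω).x i) (ξ i ω)) ∈ V)
    (hq : ∀ i, (fun ω => A.q (fun i => ξ i ω) (fun i => ζ i ω) (S ω) i) ∈ V) :
    StateMem V fun ω => A.step (fun i => ξ i ω) (fun i => ζ i ω) (S ω) := by
  classical
  have hyHat : ∀ i, (fun ω => A.yHat (fun i => ξ i ω) (fun i => ζ i ω) (S ω) i) ∈ V := fun i =>
    V.add_mem (hS.h i) (hq i)
  have hyHatW : ∀ i, (fun ω => A.yHatW (fun i => ξ i ω) (fun i => ζ i ω) (S ω) i) ∈ V := fun i =>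
    V.add_mem (hS.hw i) (sum_smul_mem V hq _ _)
  have hd : ∀ i, (fun ω => A.dNext (fun i => ξ i ω) (fun i => ζ i ω) (S ω) i) ∈ V := fun i =>
    V.add_mem (hS.d i) (V.smul_mem (A.γ / 2) (V.sub_mem (hyHat i) (hyHatW i)))
  exact
    { x := fun i => V.sub_mem (V.sub_mem (hS.x i) (V.smul_mem A.η (hg i))) (hd i)
      h := fun i => V.add_mem (V.smul_mem (1 - A.α) (hS.h i)) (V.smul_mem A.α (hyHat i))
      hw := fun i => V.add_mem (V.smul_mem (1 - A.α) (hS.hw i)) (V.smul_mem A.α (hyHatW i))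
      d := hd }

lemma StateMem.init {ξ : Fin n → Ω → Ξ} (hconst : ∀ c : Vec p, (fun _ : Ω => c) ∈ V)
    (hg : ∀ i, (fun ω => A.grad i (A.xInit i) (ξ i ω)) ∈ V) :
    StateMem V fun ω => A.init fun i => ξ i ω where
  x := fun i => V.sub_mem (hconst _) (V.smul_mem A.η (hg i))
  h := fun _ => hconst _
  hw := fun _ => hconst _
  d := fun _ => V.zero_mem

end Closure

/-! ### Noise of the gradients and of the compression -/

/-- The noise of the gradients at iteration `-1`. -/
def gradNoiseInit (A : Algorithm n p Ξ Z) (s : Samples n Ω Ξ Z) (f : Fin n → Vec p → ℝ)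
    (i : Fin n) (ω : Ω) : Vec p :=
  A.grad i (A.xInit i) (s.xiInit i ω) - gradient (f i) (A.xInit i)

/-- The noise of the gradients at iteration `k ≥ 0`. -/
def gradNoise (A : Algorithm n p Ξ Z) (s : Samples n Ω Ξ Z) (f : Fin n → Vec p → ℝ)
    (k : ℕ) (i : Fin n) (ω : Ω) : Vec p :=
  A.grad i ((A.state s ω k).x i) (s.xi k i ω) - gradient (f i) ((A.state s ω k).x i)

/-- The compressed quantity `y_k - h_k`. -/
def compInput (A : Algorithm n p Ξ Z) (s : Samples n Ω Ξ Z) (k : ℕ) (i : Fin n) (ω : Ω) : Vec p :=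
  A.y (fun i => s.xi k i ω) (A.state s ω k) i - (A.state s ω k).h i

/-- The compression error `ŷ_k - y_k` at iteration `k`. -/
def compNoise (A : Algorithm n p Ξ Z) (s : Samples n Ω Ξ Z) (k : ℕ) (i : Fin n) (ω : Ω) : Vec p :=
  A.comp (compInput A s k i ω) (s.zeta k i ω) - compInput A s k i ω

/-! ### The histories before gradient sampling and before compression -/

section Filtration

variable [MeasurableSpace Ξ] [MeasurableSpace Z] (s : Samples n Ω Ξ Z)

lemma comap_xiInit_le_gradPast (k : ℕ) (i : Fin n) :
    MeasurableSpace.comap (s.xiInit i) inferInstance ≤ s.gradPast k :=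
  (le_iSup (fun i => MeasurableSpace.comap (s.xiInit i) inferInstance) i).trans le_sup_left

lemma comap_xi_sup_comap_zeta_le_gradPast {l k : ℕ} (hlk : l < k) (i : Fin n) :
    MeasurableSpace.comap (s.xi l i) inferInstance ⊔
      MeasurableSpace.comap (s.zeta l i) inferInstance ≤ s.gradPast k := by
  refine le_trans ?_ le_sup_right
  exact le_iSup₂_of_le l hlk (le_iSup (fun i => MeasurableSpace.comap (s.xi l i) inferInstance ⊔
      MeasurableSpace.comap (s.zeta l i) inferInstance) i)

lemma gradPast_mono {l k : ℕ} (hlk : l ≤ k) : s.gradPast l ≤ s.gradPast k := by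
  refine sup_le (iSup_le fun i => comap_xiInit_le_gradPast s k i) ?_
  exact iSup₂_le fun j hj => iSup_le fun i =>
    comap_xi_sup_comap_zeta_le_gradPast s (hj.trans_le hlk) i

lemma comap_xi_le_compPast (k : ℕ) (i : Fin n) :
    MeasurableSpace.comap (s.xi k i) inferInstance ≤ s.compPast k :=
  (le_iSup (fun i => MeasurableSpace.comap (s.xi k i) inferInstance) i).trans le_sup_right

lemma gradPast_le_compPast (k : ℕ) : s.gradPast k ≤ s.compPast k := le_sup_left

variable {s} {mΩ : MeasurableSpace Ω}

lemma gradPast_le (h0 : ∀ i, Measurable (s.xiInit i)) (h1 : ∀ k i, Measurable (s.xi k i))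
    (h2 : ∀ k i, Measurable (s.zeta k i)) (k : ℕ) : s.gradPast k ≤ mΩ :=
  sup_le (iSup_le fun i => (h0 i).comap_le) (iSup₂_le fun l _ => iSup_le fun i =>
    sup_le (h1 l i).comap_le (h2 l i).comap_le)

lemma compPast_le (h0 : ∀ i, Measurable (s.xiInit i)) (h1 : ∀ k i, Measurable (s.xi k i))
    (h2 : ∀ k i, Measurable (s.zeta k i)) (k : ℕ) : s.compPast k ≤ mΩ :=
  sup_le (gradPast_le h0 h1 h2 k) (iSup_le fun i => (h1 k i).comap_le)

end Filtration

section Noise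

variable [MeasurableSpace Ξ] [MeasurableSpace Z] {mΩ : MeasurableSpace Ω} {μ : Measure Ω}
  {ν : Measure Z} {A : Algorithm n p Ξ Z} {s : Samples n Ω Ξ Z}
  {f : Fin n → Vec p → ℝ} {flow : Fin n → ℝ} {L σ C : ℝ}

lemma measurable_state (hg : ∀ i, Measurable (Function.uncurry (A.grad i)))
    (hc : Measurable (Function.uncurry A.comp)) (k : ℕ) :
    StateMem (measurableSubmodule p (s.gradPast k)) fun ω => A.state s ω k := by
  induction k with
  | zero =>
    refine StateMem.init (fun c => ?_) fun i => ?_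
    · exact @measurable_const _ _ _ (s.gradPast 0) c
    · have hi : Measurable[s.gradPast 0] (s.xiInit i) :=
        Measurable.of_comap_le (comap_xiInit_le_gradPast s 0 i)
      exact (hg i).comp ((@measurable_const _ _ _ (s.gradPast 0) (A.xInit i)).prodMk hi)
  | succ k ih =>
    have ih' : StateMem (measurableSubmodule p (s.gradPast (k + 1))) fun ω => A.state s ω k :=
      ih.mono fun _ hX => Measurable.mono hX (gradPast_mono s k.le_succ) le_rfl
    have hxi : ∀ i, Measurable[s.gradPast (k + 1)] (s.xi k i) := fun i =>
      Measurable.of_comap_le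
        (le_sup_left.trans (comap_xi_sup_comap_zeta_le_gradPast s k.lt_succ_self i))
    have hzeta : ∀ i, Measurable[s.gradPast (k + 1)] (s.zeta k i) := fun i =>
      Measurable.of_comap_le
        (le_sup_right.trans (comap_xi_sup_comap_zeta_le_gradPast s k.lt_succ_self i))
    have hgrad : ∀ i, (fun ω => A.grad i ((A.state s ω k).x i) (s.xi k i ω)) ∈
        measurableSubmodule p (s.gradPast (k + 1)) := fun i =>
      (hg i).comp (Measurable.prodMk (ih'.x i) (hxi i))
    refine ih'.step hgrad fun i => ?_
    exact hc.comp (Measurable.prodMk (Submodule.sub_mem _ (ih'.y hgrad i) (ih'.h i)) (hzeta i))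

lemma measurable_grad_state (hg : ∀ i, Measurable (Function.uncurry (A.grad i)))
    (hc : Measurable (Function.uncurry A.comp)) (k : ℕ) (i : Fin n) :
    Measurable[s.gradPast k ⊔ MeasurableSpace.comap (s.xi k i) inferInstance]
      fun ω => A.grad i ((A.state s ω k).x i) (s.xi k i ω) :=
  (hg i).comp (Measurable.prodMk
    (Measurable.mono ((measurable_state hg hc k).x i) le_sup_left le_rfl)
    (Measurable.of_comap_le le_sup_right))

lemma measurable_gradNoise (hgc : ∀ i, Continuous (gradient (f i)))
    (hg : ∀ i, Measurable (Function.uncurry (A.grad i)))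
    (hc : Measurable (Function.uncurry A.comp)) (k : ℕ) (i : Fin n) :
    Measurable[s.gradPast k ⊔ MeasurableSpace.comap (s.xi k i) inferInstance]
      (gradNoise A s f k i) :=
  Measurable.sub (measurable_grad_state hg hc k i)
    (((hgc i).measurable.comp ((measurable_state hg hc k).x i)).mono le_sup_left le_rfl)

lemma measurable_y (hg : ∀ i, Measurable (Function.uncurry (A.grad i)))
    (hc : Measurable (Function.uncurry A.comp)) (k : ℕ) (i : Fin n) :
    Measurable[s.compPast k] fun ω => A.y (fun i => s.xi k i ω) (A.state s ω k) i :=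
  StateMem.y (V := measurableSubmodule p (s.compPast k))
    ((measurable_state hg hc k).mono fun _ hX =>
      Measurable.mono hX (gradPast_le_compPast s k) le_rfl)
    (fun i => (measurable_grad_state hg hc k i).mono
      (sup_le (gradPast_le_compPast s k) (comap_xi_le_compPast s k i)) le_rfl) i

lemma measurable_compInput (hg : ∀ i, Measurable (Function.uncurry (A.grad i)))
    (hc : Measurable (Function.uncurry A.comp)) (k : ℕ) (i : Fin n) :
    Measurable[s.compPast k] (compInput A s k i) :=
  Measurable.sub (measurable_y hg hc k i)
    (Measurable.mono ((measurable_state hg hc k).h i) (gradPast_le_compPast s k) le_rfl)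

lemma indicator_inter_condExp_of_condIndepFamily {ι : Type*} [Fintype ι] [DecidableEq ι]
    [IsProbabilityMeasure μ] {m : MeasurableSpace Ω} (hm : m ≤ mΩ) {X : ι → Ω → Ξ}
    (h : CondIndepFamily m X μ) {i j : ι} (hij : i ≠ j) (S T : Set Ω)
    (hS : MeasurableSet[MeasurableSpace.comap (X i) inferInstance] S)
    (hT : MeasurableSet[MeasurableSpace.comap (X j) inferInstance] T) :
    μ⟦S ∩ T | m⟧ =ᵐ[μ] fun ω => (μ⟦S | m⟧) ω * (μ⟦T | m⟧) ω := by
  obtain ⟨S', hS', rfl⟩ := hS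
  obtain ⟨T', hT', rfl⟩ := hT
  -- Test sets that are trivial except at i and j reduce the joint condition to the pair.
  let B : ι → Set Ξ := fun l => if l = i then S' else if l = j then T' else Set.univ
  have hBi : B i = S' := by simp [B]
  have hBj : B j = T' := by simp [B, hij.symm]
  have hBl : ∀ l, l ≠ i → l ≠ j → B l = Set.univ := fun l h1 h2 => by simp [B, h1, h2]
  have hB : ∀ l, MeasurableSet (B l) := fun l => by
    by_cases h1 : l = i
    · rw [h1, hBi]; exact hS'
    · by_cases h2 : l = j
      · rw [h2, hBj]; exact hT'
      · rw [hBl l h1 h2]; exact MeasurableSet.univ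
  have hinter : ⋂ l, X l ⁻¹' B l = X i ⁻¹' S' ∩ X j ⁻¹' T' := by
    ext ω
    simp only [Set.mem_iInter, Set.mem_inter_iff, Set.mem_preimage]
    refine ⟨fun H => ⟨hBi ▸ H i, hBj ▸ H j⟩, fun H l => ?_⟩
    by_cases h1 : l = i
    · subst h1; rw [hBi]; exact H.1
    · by_cases h2 : l = j
      · subst h2; rw [hBj]; exact H.2
      · rw [hBl l h1 h2]; trivial
  have hprod : ∀ ω, ∏ l, (μ⟦X l ⁻¹' B l | m⟧) ω =
      (μ⟦X i ⁻¹' S' | m⟧) ω * (μ⟦X j ⁻¹' T' | m⟧) ω := fun ω => by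
    rw [Finset.prod_eq_mul i j hij (fun l _ hl => ?_) (by simp) (by simp), hBi, hBj]
    rw [hBl l hl.1 hl.2, Set.preimage_univ, Set.indicator_univ, condExp_const hm]
  have := h B hB
  rw [hinter] at this
  filter_upwards [this] with ω hω
  rw [hω, hprod]

/-! ### Moments of the iterates and of the noise -/

section Assumptions

variable [IsProbabilityMeasure μ] [IsProbabilityMeasure ν]

lemma memLp_state (hf : IsSmoothBddBelow f L flow) (hgrad : IsStochasticGradient μ A s f σ)
    (hcomp : IsUnbiasedCompressor ν A.comp C) (hseed : IsFreshSeeds μ ν s) (k : ℕ) :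
    StateMem (memLpSubmodule p μ) fun ω => A.state s ω k := by
  induction k with
  | zero =>
    refine StateMem.init (fun c => memLp_const c) fun i => ?_
    have h := (memLpSubmodule p μ).add_mem (hgrad.memLp_init i)
      (memLp_const (gradient (f i) (A.xInit i)) : MemLp _ 2 μ)
    convert h using 1
    ext1 ω
    simp
  | succ k ih =>
    have hg : ∀ i, (fun ω => A.grad i ((A.state s ω k).x i) (s.xi k i ω)) ∈
        memLpSubmodule p μ := fun i => by
      have h := (memLpSubmodule p μ).add_mem (hgrad.memLp k i)
        (memLp_comp_of_norm_sub_le (hf.lipschitz i) (ih.x i))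
      convert h using 1
      ext1 ω
      simp
    refine ih.step hg fun i => ?_
    have hin : compInput A s k i ∈ memLpSubmodule p μ :=
      Submodule.sub_mem _ (ih.y hg i) (ih.h i)
    have h := (memLpSubmodule p μ).add_mem hin (hcomp.memLp_error
      (compPast_le hgrad.measurable_xiInit hgrad.measurable_xi hseed.measurable k)
      (measurable_compInput hgrad.measurable_grad hcomp.measurable k i) hin
      (hseed.measurable k i) (hseed.law k i) (hseed.indep k i))
    convert h using 1
    ext1 ω
    simp [compInput, Algorithm.q]

lemma memLp_y (hf : IsSmoothBddBelow f L flow) (hgrad : IsStochasticGradient μ A s f σ)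
    (hcomp : IsUnbiasedCompressor ν A.comp C) (hseed : IsFreshSeeds μ ν s) (k : ℕ) (i : Fin n) :
    MemLp (fun ω => A.y (fun i => s.xi k i ω) (A.state s ω k) i) 2 μ := by
  have ih := memLp_state hf hgrad hcomp hseed k
  refine ih.y (fun i => ?_) i
  have h := (memLpSubmodule p μ).add_mem (hgrad.memLp k i)
    (memLp_comp_of_norm_sub_le (hf.lipschitz i) (ih.x i))
  convert h using 1
  ext1 ω
  simp

lemma memLp_compInput (hf : IsSmoothBddBelow f L flow) (hgrad : IsStochasticGradient μ A s f σ)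
    (hcomp : IsUnbiasedCompressor ν A.comp C) (hseed : IsFreshSeeds μ ν s) (k : ℕ) (i : Fin n) :
    MemLp (compInput A s k i) 2 μ :=
  (memLp_y hf hgrad hcomp hseed k i).sub ((memLp_state hf hgrad hcomp hseed k).h i)

lemma memLp_compNoise (hf : IsSmoothBddBelow f L flow) (hgrad : IsStochasticGradient μ A s f σ)
    (hcomp : IsUnbiasedCompressor ν A.comp C) (hseed : IsFreshSeeds μ ν s) (k : ℕ) (i : Fin n) :
    MemLp (compNoise A s k i) 2 μ :=
  hcomp.memLp_error (compPast_le hgrad.measurable_xiInit hgrad.measurable_xi hseed.measurable k)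
    (measurable_compInput hgrad.measurable_grad hcomp.measurable k i)
    (memLp_compInput hf hgrad hcomp hseed k i)
    (hseed.measurable k i) (hseed.law k i) (hseed.indep k i)

lemma integral_inner_compNoise (hf : IsSmoothBddBelow f L flow)
    (hgrad : IsStochasticGradient μ A s f σ) (hcomp : IsUnbiasedCompressor ν A.comp C)
    (hseed : IsFreshSeeds μ ν s) (k : ℕ) (i : Fin n) {X : Ω → Vec p}
    (hX : Measurable[s.compPast k] X) (hX2 : MemLp X 2 μ) :
    ∫ ω, ⟪X ω, compNoise A s k i ω⟫_ℝ ∂μ = 0 :=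
  hcomp.integral_inner_error
    (compPast_le hgrad.measurable_xiInit hgrad.measurable_xi hseed.measurable k)
    (measurable_compInput hgrad.measurable_grad hcomp.measurable k i)
    (memLp_compInput hf hgrad hcomp hseed k i)
    (hseed.measurable k i) (hseed.law k i) (hseed.indep k i) hX hX2

lemma integral_stackSq_compNoise_le (hf : IsSmoothBddBelow f L flow)
    (hgrad : IsStochasticGradient μ A s f σ) (hcomp : IsUnbiasedCompressor ν A.comp C)
    (hseed : IsFreshSeeds μ ν s) (k : ℕ) :
    ∫ ω, stackSq (fun i => compNoise A s k i ω) ∂μ ≤ C * ∫ ω, compErrSq A s k ω ∂μ := by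
  rw [integral_stackSq (memLp_compNoise hf hgrad hcomp hseed k)]
  have : ∫ ω, compErrSq A s k ω ∂μ = ∑ i, ∫ ω, ‖compInput A s k i ω‖ ^ 2 ∂μ :=
    integral_stackSq (memLp_compInput hf hgrad hcomp hseed k)
  rw [this, Finset.mul_sum]
  refine Finset.sum_le_sum fun i _ => ?_
  exact hcomp.integral_error_sq_le
    (compPast_le hgrad.measurable_xiInit hgrad.measurable_xi hseed.measurable k)
    (measurable_compInput hgrad.measurable_grad hcomp.measurable k i)
    (memLp_compInput hf hgrad hcomp hseed k i)
    (hseed.measurable k i) (hseed.law k i) (hseed.indep k i)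

lemma condExp_gradNoise (hf : IsSmoothBddBelow f L flow) (hgrad : IsStochasticGradient μ A s f σ)
    (hcomp : IsUnbiasedCompressor ν A.comp C) (hseed : IsFreshSeeds μ ν s) (k : ℕ) (i : Fin n) :
    μ[gradNoise A s f k i | s.gradPast k] =ᵐ[μ] 0 := by
  have hm := gradPast_le hgrad.measurable_xiInit hgrad.measurable_xi hseed.measurable k
  have hv : Integrable (gradNoise A s f k i) μ := (hgrad.memLp k i).integrable (by norm_num)
  have hw : Integrable (fun ω => gradient (f i) ((A.state s ω k).x i)) μ :=
    (memLp_comp_of_norm_sub_le (hf.lipschitz i)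
      ((memLp_state hf hgrad hcomp hseed k).x i)).integrable (by norm_num)
  have hg : Integrable (fun ω => A.grad i ((A.state s ω k).x i) (s.xi k i ω)) μ := by
    refine (hv.add hw).congr (Filter.Eventually.of_forall fun ω => ?_)
    simp [gradNoise]
  have hwm : Measurable[s.gradPast k] fun ω => gradient (f i) ((A.state s ω k).x i) :=
    (hf.continuous_gradient i).measurable.comp
      ((measurable_state hgrad.measurable_grad hcomp.measurable k).x i)
  have h1 := condExp_sub hg hw (s.gradPast k)
  have h2 := condExp_of_stronglyMeasurable hm hwm.stronglyMeasurable hw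
  have h3 : (fun ω => A.grad i ((A.state s ω k).x i) (s.xi k i ω)) -
      (fun ω => gradient (f i) ((A.state s ω k).x i)) = gradNoise A s f k i := rfl
  rw [h3, h2] at h1
  filter_upwards [h1, hgrad.unbiased k i] with ω h4 h5
  rw [h4, Pi.sub_apply, h5]
  simp

lemma isCenteredNoise_gradNoise (hf : IsSmoothBddBelow f L flow)
    (hgrad : IsStochasticGradient μ A s f σ) (hcomp : IsUnbiasedCompressor ν A.comp C)
    (hseed : IsFreshSeeds μ ν s) (k : ℕ) :
    IsCenteredNoise (s.gradPast k) μ (gradNoise A s f k) σ where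
  memLp := hgrad.memLp k
  orthogonal i X hX hX2 := integral_inner_eq_zero_of_condExp_eq_zero
    (gradPast_le hgrad.measurable_xiInit hgrad.measurable_xi hseed.measurable k)
    hX.stronglyMeasurable.aestronglyMeasurable hX2 (hgrad.memLp k i)
    (condExp_gradNoise hf hgrad hcomp hseed k i)
  uncorrelated i j hij := by
    have hm := gradPast_le hgrad.measurable_xiInit hgrad.measurable_xi hseed.measurable k
    have hmeas := measurable_gradNoise (A := A) (s := s) hf.continuous_gradient
      hgrad.measurable_grad hcomp.measurable k
    -- Conditioning on the past together with the sample of agent i fixes the noise of i, while the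
    -- noise of j stays centered.
    refine integral_inner_eq_zero_of_condExp_eq_zero
      (sup_le hm (hgrad.measurable_xi k i).comap_le)
      (hmeas i).stronglyMeasurable.aestronglyMeasurable (hgrad.memLp k i) (hgrad.memLp k j) ?_
    exact condExp_sup_eq_zero_of_condIndep hm (hgrad.measurable_xi k i).comap_le
      (hgrad.measurable_xi k j).comap_le
      (fun S T => indicator_inter_condExp_of_condIndepFamily hm (hgrad.indep k) hij S T)
      ((hgrad.memLp k j).integrable (by norm_num))
      (hmeas j).stronglyMeasurable.aestronglyMeasurable
      (condExp_gradNoise hf hgrad hcomp hseed k j)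
  variance i := by
    have hm := gradPast_le hgrad.measurable_xiInit hgrad.measurable_xi hseed.measurable k
    rw [← integral_condExp hm]
    calc _ ≤ ∫ _, σ ^ 2 ∂μ :=
          integral_mono_ae integrable_condExp (integrable_const _) (hgrad.variance k i)
      _ = σ ^ 2 := by simp

omit [IsProbabilityMeasure ν] in
lemma isCenteredNoise_gradNoiseInit (hgrad : IsStochasticGradient μ A s f σ) :
    IsCenteredNoise ⊥ μ (gradNoiseInit A s f) σ := by
  have h0 : ∀ i, ∫ ω, gradNoiseInit A s f i ω ∂μ = 0 := fun i => by
    have hv : Integrable (gradNoiseInit A s f i) μ :=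
      (hgrad.memLp_init i).integrable (by norm_num)
    have hg : Integrable (fun ω => A.grad i (A.xInit i) (s.xiInit i ω)) μ := by
      refine (hv.add (integrable_const (gradient (f i) (A.xInit i)))).congr
        (Filter.Eventually.of_forall fun ω => ?_)
      simp [gradNoiseInit]
    unfold gradNoiseInit
    rw [integral_sub hg (integrable_const _), hgrad.unbiased_init i]
    simp
  refine ⟨hgrad.memLp_init, fun i X hX hX2 => ?_, fun i j hij => ?_, hgrad.variance_init⟩
  · refine integral_inner_eq_zero_of_condExp_eq_zero bot_le
      hX.stronglyMeasurable.aestronglyMeasurable hX2 (hgrad.memLp_init i) ?_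
    rw [condExp_bot, h0]
    rfl
  · have hφ : ∀ l, Measurable fun z =>
        A.grad l (A.xInit l) z - gradient (f l) (A.xInit l) := fun l =>
      ((hgrad.measurable_grad l).comp measurable_prodMk_left).sub_const _
    have hind : IndepFun (gradNoiseInit A s f i) (gradNoiseInit A s f j) μ :=
      (hgrad.indep_init.indepFun hij).comp (hφ i) (hφ j)
    have hmi : Measurable (gradNoiseInit A s f i) := (hφ i).comp (hgrad.measurable_xiInit i)
    refine integral_inner_eq_zero_of_condExp_eq_zero (hmi.comap_le)
      (Measurable.of_comap_le le_rfl).stronglyMeasurable.aestronglyMeasurable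
      (hgrad.memLp_init i) (hgrad.memLp_init j) ?_
    have hmj : Measurable (gradNoiseInit A s f j) := (hφ j).comp (hgrad.measurable_xiInit j)
    have := condExp_indep_eq (μ := μ) hmj.comap_le hmi.comap_le
      (Measurable.of_comap_le le_rfl).stronglyMeasurable hind.symm
    rw [h0] at this
    exact this

end Assumptions

end Noise

end Cedas

namespace Cedas
open scoped InnerProductSpace

variable {n p : ℕ}

/-! ### Quadratic inequalities -/

/-- The difference of the two sides is the square of (1-θ)x - θy divided by θ(1-θ). With θ close to
1 the main term x loses little, at the price of a large factor on y. -/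
lemma norm_add_sq_le_div {θ : ℝ} (h0 : 0 < θ) (h1 : θ < 1) (x y : Vec p) :
    ‖x + y‖ ^ 2 ≤ ‖x‖ ^ 2 / θ + ‖y‖ ^ 2 / (1 - θ) := by
  have h2 : 0 < 1 - θ := by linarith
  have h : ‖x‖ ^ 2 / θ + ‖y‖ ^ 2 / (1 - θ) - ‖x + y‖ ^ 2 =
      ‖(1 - θ) • x - θ • y‖ ^ 2 / (θ * (1 - θ)) := by
    rw [norm_add_sq_real, norm_sub_sq_real, norm_smul, norm_smul, real_inner_smul_left,
      real_inner_smul_right, mul_pow, mul_pow, Real.norm_of_nonneg h0.le,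
      Real.norm_of_nonneg h2.le]
    field_simp
    ring
  have : 0 ≤ ‖(1 - θ) • x - θ • y‖ ^ 2 / (θ * (1 - θ)) := by positivity
  linarith

lemma norm_add_four_sq_le (a b c d : Vec p) :
    ‖a + b + c + d‖ ^ 2 ≤ 4 * (‖a‖ ^ 2 + ‖b‖ ^ 2 + ‖c‖ ^ 2 + ‖d‖ ^ 2) := by
  have h : ‖a + b + c + d‖ ≤ ‖a‖ + ‖b‖ + ‖c‖ + ‖d‖ := norm_add₄_le
  have h2 : ‖a + b + c + d‖ ^ 2 ≤ (‖a‖ + ‖b‖ + ‖c‖ + ‖d‖) ^ 2 := by gcongr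
  nlinarith [sq_nonneg (‖a‖ - ‖b‖), sq_nonneg (‖a‖ - ‖c‖), sq_nonneg (‖a‖ - ‖d‖),
    sq_nonneg (‖b‖ - ‖c‖), sq_nonneg (‖b‖ - ‖d‖), sq_nonneg (‖c‖ - ‖d‖)]

lemma modeEnergy_nonneg {l : ℝ} (h0 : 0 < l) (h1 : l < 1) (a r : Vec p) :
    0 ≤ modeEnergy l a r := by
  have : 0 < 1 - l := by linarith
  unfold modeEnergy
  positivity

lemma norm_sq_le_modeEnergy {l : ℝ} (h0 : 0 < l) (h1 : l < 1) (a r : Vec p) :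
    ‖a‖ ^ 2 ≤ 2 * modeEnergy l a r := by
  have h2 : 0 < 1 - l := by linarith
  have h3 : 0 ≤ ‖r‖ ^ 2 / (1 - l) := by positivity
  have h4 : ‖a‖ ^ 2 ≤ ‖a‖ ^ 2 / l := by
    rw [le_div_iff₀ h0]
    nlinarith [sq_nonneg ‖a‖]
  unfold modeEnergy
  linarith

lemma norm_sq_le_mul_modeEnergy {l : ℝ} (h0 : 0 < l) (h1 : l < 1) (a r : Vec p) :
    ‖r‖ ^ 2 ≤ 2 * (1 - l) * modeEnergy l a r := by
  have h2 : 0 < 1 - l := by linarith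
  have h3 : 0 ≤ (1 - l) * (‖a‖ ^ 2 / l) := by positivity
  have h4 : (1 - l) * (‖r‖ ^ 2 / (1 - l)) = ‖r‖ ^ 2 := by field_simp
  unfold modeEnergy
  linarith

lemma norm_sq_add_norm_sq_le_modeEnergy {l : ℝ} (h0 : 0 < l) (h1 : l < 1) (a r : Vec p) :
    ‖a‖ ^ 2 + ‖r‖ ^ 2 ≤ 2 * modeEnergy l a r := by
  have h2 : 0 < 1 - l := by linarith
  have h3 : ‖r‖ ^ 2 ≤ ‖r‖ ^ 2 / (1 - l) := by
    rw [le_div_iff₀ h2]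
    nlinarith [sq_nonneg ‖r‖]
  have h4 : ‖a‖ ^ 2 ≤ ‖a‖ ^ 2 / l := by
    rw [le_div_iff₀ h0]
    nlinarith [sq_nonneg ‖a‖]
  unfold modeEnergy
  linarith

lemma modeEnergy_add_le {l θ : ℝ} (h0 : 0 < l) (h1 : l < 1) (hθ0 : 0 < θ) (hθ1 : θ < 1)
    (a a' r r' : Vec p) :
    modeEnergy l (a + a') (r + r') ≤ modeEnergy l a r / θ + modeEnergy l a' r' / (1 - θ) := by
  have h2 : 0 < 1 - l := by linarith
  unfold modeEnergy
  calc (‖a + a'‖ ^ 2 / l + ‖r + r'‖ ^ 2 / (1 - l)) / 2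
      ≤ ((‖a‖ ^ 2 / θ + ‖a'‖ ^ 2 / (1 - θ)) / l +
          (‖r‖ ^ 2 / θ + ‖r'‖ ^ 2 / (1 - θ)) / (1 - l)) / 2 := by
        gcongr
        · exact norm_add_sq_le_div hθ0 hθ1 _ _
        · exact norm_add_sq_le_div hθ0 hθ1 _ _
    _ = _ := by
        have : 1 - θ ≠ 0 := by linarith
        field_simp
        ring

/-- The compression error enters both components with the factor 1-l and opposite signs. Its square
is weighted by half of (1-l)²/l + (1-l) = (1-l)/l, which is of first order in 1-l. -/
lemma modeEnergy_sub_add {l : ℝ} (h0 : 0 < l) (h1 : l < 1) (a r e : Vec p) :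
    modeEnergy l (a - (1 - l) • e) (r + (1 - l) • e) =
      modeEnergy l a r + ⟪r - ((1 - l) / l) • a, e⟫_ℝ + (1 - l) / l * ‖e‖ ^ 2 / 2 := by
  have h2 : 0 < 1 - l := by linarith
  unfold modeEnergy
  rw [norm_sub_sq_real, norm_add_sq_real, inner_sub_left, real_inner_smul_left,
    real_inner_smul_right, real_inner_smul_right, norm_smul, mul_pow, Real.norm_of_nonneg h2.le]
  field_simp
  ring

/-- The weights 1/l and 1/(1-l) are those for which the mixed products of a with r and of r with v
cancel. Hence an equality, with contraction factor l and noise weight l²/l + (1-l)²/(1-l) = 1 before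
halving. -/
lemma modeEnergy_contraction {l η : ℝ} (h0 : 0 < l) (h1 : l < 1) (a r v : Vec p) :
    modeEnergy l (l • (a - r - η • v)) (r + (1 - l) • (a - r - η • v)) =
      l * modeEnergy l a r - η * ⟪a, v⟫_ℝ + η ^ 2 * ‖v‖ ^ 2 / 2 := by
  have h2 : 1 - l ≠ 0 := by linarith
  unfold modeEnergy
  have e1 : ‖a - r - η • v‖ ^ 2 = ‖a‖ ^ 2 - 2 * ⟪a, r⟫_ℝ + ‖r‖ ^ 2 -
      2 * (η * ⟪a, v⟫_ℝ - η * ⟪r, v⟫_ℝ) + η ^ 2 * ‖v‖ ^ 2 := by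
    rw [norm_sub_sq_real, norm_sub_sq_real, inner_sub_left, real_inner_smul_right,
      real_inner_smul_right, norm_smul, mul_pow, Real.norm_eq_abs, sq_abs]
  have e2 : ⟪r, a - r - η • v⟫_ℝ = ⟪a, r⟫_ℝ - ‖r‖ ^ 2 - η * ⟪r, v⟫_ℝ := by
    rw [inner_sub_right, inner_sub_right, real_inner_smul_right, real_inner_self_eq_norm_sq,
      real_inner_comm]
  rw [norm_add_sq_real, norm_smul, norm_smul, mul_pow, mul_pow, Real.norm_eq_abs, sq_abs,
    Real.norm_eq_abs, sq_abs, real_inner_smul_right, e1, e2]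
  field_simp
  ring

/-- The vector u enters both components with the factors l and 1-l, which offset the weights of the
energy; only δ, which enters r alone, pays 1/(1-l). -/
lemma modeEnergy_perturbation_le {l η : ℝ} (h0 : 0 < l) (h1 : l < 1) (u δ : Vec p) :
    modeEnergy l (l • η • u) ((1 - l) • η • u + η • δ) ≤
      η ^ 2 * ‖u‖ ^ 2 + η ^ 2 * ‖δ‖ ^ 2 / (1 - l) := by
  have h2 : 0 < 1 - l := by linarith
  have e1 : ‖(1 - l) • η • u + η • δ‖ ^ 2 ≤
      2 * ((1 - l) ^ 2 * (η ^ 2 * ‖u‖ ^ 2)) + 2 * (η ^ 2 * ‖δ‖ ^ 2) := by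
    have h := norm_add_sq_le_div (θ := 1 / 2) (by norm_num) (by norm_num)
      ((1 - l) • η • u) (η • δ)
    rw [norm_smul (1 - l), norm_smul, norm_smul, mul_pow, mul_pow, mul_pow] at h
    simp only [Real.norm_eq_abs, sq_abs] at h
    exact h.trans_eq (by ring)
  have e2 : ‖l • η • u‖ ^ 2 = l ^ 2 * (η ^ 2 * ‖u‖ ^ 2) := by
    rw [norm_smul, norm_smul, mul_pow, mul_pow]
    simp only [Real.norm_eq_abs, sq_abs]
  unfold modeEnergy
  rw [e2]
  calc (l ^ 2 * (η ^ 2 * ‖u‖ ^ 2) / l + ‖(1 - l) • η • u + η • δ‖ ^ 2 / (1 - l)) / 2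
      ≤ (l ^ 2 * (η ^ 2 * ‖u‖ ^ 2) / l + (2 * ((1 - l) ^ 2 * (η ^ 2 * ‖u‖ ^ 2)) +
          2 * (η ^ 2 * ‖δ‖ ^ 2)) / (1 - l)) / 2 := by gcongr
    _ = η ^ 2 * ‖u‖ ^ 2 + η ^ 2 * ‖δ‖ ^ 2 / (1 - l) - l / 2 * (η ^ 2 * ‖u‖ ^ 2) := by
        field_simp
        ring
    _ ≤ _ := by
        have : 0 ≤ l / 2 * (η ^ 2 * ‖u‖ ^ 2) := by positivity
        linarith

/-- One step of the dynamics of an eigenmode. -/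
lemma modeEnergy_step_le {l η ρ : ℝ} (h0 : 0 < l) (h1 : l < 1) (hρ : 0 < ρ) (hρ1 : ρ < 2)
    {a r u v e δ w : Vec p} (hw : w = a - r + η • u - η • v) :
    modeEnergy l (w - (1 - l) • (w + e)) (r + (1 - l) • (w + e) + η • δ) ≤
      (l * modeEnergy l a r - η * ⟪a, v⟫_ℝ + η ^ 2 * ‖v‖ ^ 2 / 2) / (1 - ρ / 2) +
        2 / ρ * (η ^ 2 * ‖u‖ ^ 2 + η ^ 2 * ‖δ‖ ^ 2 / (1 - l)) +
        ⟪r + (1 - l) • w + η • δ - ((1 - l) / l) • l • w, e⟫_ℝ +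
        (1 - l) / l * ‖e‖ ^ 2 / 2 := by
  have e1 : w - (1 - l) • (w + e) = l • w - (1 - l) • e := by module
  have e2 : r + (1 - l) • (w + e) + η • δ = (r + (1 - l) • w + η • δ) + (1 - l) • e := by module
  rw [e1, e2, modeEnergy_sub_add h0 h1]
  -- The gradient noise v stays in the exact part, so that its cross term with a can be averaged to
  -- zero. The terms u and δ form the perturbation: in the application neither is centered, and δ
  -- depends on v.
  have e3 : l • w = l • (a - r - η • v) + l • η • u := by rw [hw]; module
  have e4 : r + (1 - l) • w + η • δ =
      (r + (1 - l) • (a - r - η • v)) + ((1 - l) • η • u + η • δ) := by rw [hw]; module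
  have h3 : modeEnergy l (l • w) (r + (1 - l) • w + η • δ) ≤
      (l * modeEnergy l a r - η * ⟪a, v⟫_ℝ + η ^ 2 * ‖v‖ ^ 2 / 2) / (1 - ρ / 2) +
        2 / ρ * (η ^ 2 * ‖u‖ ^ 2 + η ^ 2 * ‖δ‖ ^ 2 / (1 - l)) := by
    rw [e3, e4, ← modeEnergy_contraction h0 h1]
    -- When l ≤ 1-ρ this choice of θ gives up about half of the contraction, since (1-ρ)/(1-ρ/2) ≤
    -- 1-ρ/2.
    refine (modeEnergy_add_le h0 h1 (θ := 1 - ρ / 2) (by linarith) (by linarith) _ _ _ _).trans ?_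
    rw [show 1 - (1 - ρ / 2) = ρ / 2 by ring, div_eq_mul_inv (modeEnergy l (l • η • u) _),
      mul_comm (modeEnergy l (l • η • u) _), inv_div]
    gcongr
    exact modeEnergy_perturbation_le h0 h1 u δ
  linarith

lemma stackSq_add_le_div {θ : ℝ} (h0 : 0 < θ) (h1 : θ < 1) (v w : Fin n → Vec p) :
    stackSq (fun i => v i + w i) ≤ stackSq v / θ + stackSq w / (1 - θ) := by
  unfold stackSq
  rw [Finset.sum_div, Finset.sum_div, ← Finset.sum_add_distrib]
  exact Finset.sum_le_sum fun i _ => norm_add_sq_le_div h0 h1 _ _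

lemma stackSq_smul (c : ℝ) (v : Fin n → Vec p) :
    stackSq (fun i => c • v i) = c ^ 2 * stackSq v := by
  unfold stackSq
  rw [Finset.mul_sum]
  refine Finset.sum_congr rfl fun i _ => ?_
  rw [norm_smul, mul_pow, Real.norm_eq_abs, sq_abs]

lemma stackSq_sub_smul (c : ℝ) (v w : Fin n → Vec p) :
    stackSq (fun i => v i - c • w i) =
      stackSq v - 2 * c * ∑ i, ⟪v i, w i⟫_ℝ + c ^ 2 * stackSq w := by
  unfold stackSq
  rw [Finset.mul_sum, Finset.mul_sum, ← Finset.sum_sub_distrib, ← Finset.sum_add_distrib]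
  refine Finset.sum_congr rfl fun i _ => ?_
  rw [norm_sub_sq_real, norm_smul, mul_pow, Real.norm_eq_abs, sq_abs, real_inner_smul_right]
  ring

/-! ### The dynamics in terms of the noise -/

/-- The scaled graph Laplacian `(γ/2)(I - W)`. -/
def lap (γ : ℝ) (W : Matrix (Fin n) (Fin n) ℝ) (v : Fin n → Vec p) : Fin n → Vec p :=
  (γ / 2) • (v - mulStack W v)

/-- The consensus error of the gradients, `∇f_i(x̄) - ∇f_i(x_i)`. -/
def gradDev (f : Fin n → Vec p → ℝ) (x : Fin n → Vec p) (i : Fin n) : Vec p :=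
  gradient (f i) (mean x) - gradient (f i) (x i)

/-- The average of the local gradients. -/
def meanGrad (f : Fin n → Vec p → ℝ) (x : Fin n → Vec p) : Vec p :=
  mean fun i => gradient (f i) (x i)

section Dynamics

variable {Ω Ξ Z : Type*} {A : Algorithm n p Ξ Z} {s : Samples n Ω Ξ Z}
  {f : Fin n → Vec p → ℝ} {flow : Fin n → ℝ} {L : ℝ}
  {G : SimpleGraph (Fin n)} {W Q : Matrix (Fin n) (Fin n) ℝ} {lam : Fin n → ℝ}

/-- The stacked variable `y_k`. -/
def yStack (A : Algorithm n p Ξ Z) (s : Samples n Ω Ξ Z) (k : ℕ) (ω : Ω) (i : Fin n) : Vec p :=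
  A.y (fun i => s.xi k i ω) (A.state s ω k) i

lemma mode_lap (hW : IsMixingMatrix G W) (hQ : IsSortedEigendecomposition W Q lam) (γ : ℝ)
    (t : Fin n) (v : Fin n → Vec p) :
    mode Q t (lap γ W v) = (1 - tildeEig γ (lam t)) • mode Q t v := by
  rw [lap, map_smul, map_sub, mode_mulStack hW hQ, tildeEig]
  module

lemma sum_lap (hW : IsMixingMatrix G W) (γ : ℝ) (v : Fin n → Vec p) :
    ∑ i, lap γ W v i = 0 := by
  simp only [lap, Pi.smul_apply, Pi.sub_apply, ← Finset.smul_sum, Finset.sum_sub_distrib,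
    sum_mulStack hW, sub_self, smul_zero]

/-- The agents never mix `h` again after the start: both variables are updated by the same linear
rule, so the relation is preserved. -/
lemma state_hw (hW : IsMixingMatrix A.G A.W) (ω : Ω) (k : ℕ) :
    (A.state s ω k).hw = mulStack A.W (A.state s ω k).h := by
  induction k with
  | zero => exact Algorithm.mix_eq_mulStack hW _
  | succ k ih =>
    have h1 : (A.state s ω (k + 1)).hw = (1 - A.α) • (A.state s ω k).hw +
      A.α • ((A.state s ω k).hw + A.mix (A.q (fun i => s.xi k i ω) (fun i => s.zeta k i ω)
        (A.state s ω k))) := rfl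
    have h2 : (A.state s ω (k + 1)).h = (1 - A.α) • (A.state s ω k).h +
      A.α • ((A.state s ω k).h + A.q (fun i => s.xi k i ω) (fun i => s.zeta k i ω)
        (A.state s ω k)) := rfl
    rw [h1, h2, ih, Algorithm.mix_eq_mulStack hW]
    simp only [mulStack_add, mulStack_smul]

lemma yHat_eq (ω : Ω) (k : ℕ) :
    A.yHat (fun i => s.xi k i ω) (fun i => s.zeta k i ω) (A.state s ω k) =
      fun i => yStack A s k ω i + compNoise A s k i ω := by
  ext1 i
  simp only [Algorithm.yHat, Algorithm.q, yStack, compNoise, compInput]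
  abel

lemma state_succ_d (hW : IsMixingMatrix A.G A.W) (ω : Ω) (k : ℕ) :
    (A.state s ω (k + 1)).d = (A.state s ω k).d +
      lap A.γ A.W (fun i => yStack A s k ω i + compNoise A s k i ω) := by
  rw [← yHat_eq]
  have h : A.yHatW (fun i => s.xi k i ω) (fun i => s.zeta k i ω) (A.state s ω k) =
      mulStack A.W (A.yHat (fun i => s.xi k i ω) (fun i => s.zeta k i ω) (A.state s ω k)) := by
    have h1 : A.yHatW (fun i => s.xi k i ω) (fun i => s.zeta k i ω) (A.state s ω k) =
      (A.state s ω k).hw + A.mix (A.q (fun i => s.xi k i ω) (fun i => s.zeta k i ω)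
        (A.state s ω k)) := rfl
    have h2 : A.yHat (fun i => s.xi k i ω) (fun i => s.zeta k i ω) (A.state s ω k) =
      (A.state s ω k).h + A.q (fun i => s.xi k i ω) (fun i => s.zeta k i ω)
        (A.state s ω k) := rfl
    rw [h1, h2, mulStack_add, state_hw hW, Algorithm.mix_eq_mulStack hW]
  rw [lap, ← h]
  rfl

lemma state_succ_x (hW : IsMixingMatrix A.G A.W) (ω : Ω) (k : ℕ) :
    (A.state s ω (k + 1)).x = yStack A s k ω -
      lap A.γ A.W (fun i => yStack A s k ω i + compNoise A s k i ω) := by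
  have h1 : (A.state s ω (k + 1)).x = fun i => (A.state s ω k).x i -
      A.η • A.grad i ((A.state s ω k).x i) (s.xi k i ω) - (A.state s ω (k + 1)).d i := rfl
  ext1 i
  rw [h1, state_succ_d hW]
  simp only [Pi.add_apply, Pi.sub_apply, yStack, Algorithm.y]
  abel

lemma state_succ_h (ω : Ω) (k : ℕ) (i : Fin n) :
    (A.state s ω (k + 1)).h i = (A.state s ω k).h i +
      A.α • (compInput A s k i ω + compNoise A s k i ω) := by
  have h1 : (A.state s ω (k + 1)).h i = (1 - A.α) • (A.state s ω k).h i + A.α •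
    A.yHat (fun i => s.xi k i ω) (fun i => s.zeta k i ω) (A.state s ω k) i := rfl
  rw [h1, yHat_eq]
  simp only [compInput, yStack]
  module

lemma sum_state_d (hW : IsMixingMatrix A.G A.W) (ω : Ω) (k : ℕ) :
    ∑ i, (A.state s ω k).d i = 0 := by
  induction k with
  | zero => exact Finset.sum_const_zero
  | succ k ih =>
    rw [state_succ_d hW]
    simp only [Pi.add_apply, Finset.sum_add_distrib, ih, sum_lap hW, add_zero]

lemma mean_rHat (hW : IsMixingMatrix A.G A.W) (hf : IsSmoothBddBelow f L flow) (η : ℝ) (ω : Ω)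
    (k : ℕ) : mean (rHat η f (A.state s ω k)) =
      η • gradient (avgObj f) (mean (A.state s ω k).x) := by
  have h : mean (A.state s ω k).d = 0 := by rw [mean, sum_state_d hW, smul_zero]
  rw [hf.gradient_avgObj, ← mean_smul]
  have := mean_add (A.state s ω k).d
    (fun i => η • gradient (f i) (mean (A.state s ω k).x))
  rw [h, zero_add] at this
  exact this

lemma yStack_eq (f : Fin n → Vec p → ℝ) (ω : Ω) (k : ℕ) : yStack A s k ω =
    (A.state s ω k).x - rHat A.η f (A.state s ω k) + A.η • gradDev f (A.state s ω k).x -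
      A.η • fun i => gradNoise A s f k i ω := by
  ext1 i
  simp only [yStack, Algorithm.y, rHat, gradDev, gradNoise, Pi.add_apply, Pi.sub_apply,
    Pi.smul_apply]
  module

/-- The correction `d` has mean zero, as it accumulates images of the Laplacian; the compression
error therefore never reaches the average. -/
lemma mean_state_succ_x (hW : IsMixingMatrix A.G A.W) (f : Fin n → Vec p → ℝ) (ω : Ω) (k : ℕ) :
    mean (A.state s ω (k + 1)).x = mean (A.state s ω k).x -
      A.η • (meanGrad f (A.state s ω k).x + mean fun i => gradNoise A s f k i ω) := by
  have h1 : (A.state s ω (k + 1)).x = fun i => (A.state s ω k).x i -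
      A.η • A.grad i ((A.state s ω k).x i) (s.xi k i ω) - (A.state s ω (k + 1)).d i := rfl
  have h2 : mean (A.state s ω (k + 1)).d = 0 := by rw [mean, sum_state_d hW, smul_zero]
  rw [h1, mean_sub (fun i => (A.state s ω k).x i -
      A.η • A.grad i ((A.state s ω k).x i) (s.xi k i ω)), h2, sub_zero, mean_sub, mean_smul,
    meanGrad, ← mean_add]
  simp [gradNoise]

lemma mean_state_zero_x (f : Fin n → Vec p → ℝ) (ω : Ω) :
    mean (A.state s ω 0).x = mean A.xInit -
      A.η • (meanGrad f A.xInit + mean fun i => gradNoiseInit A s f i ω) := by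
  have h1 : (A.state s ω 0).x = fun i => A.xInit i -
      A.η • A.grad i (A.xInit i) (s.xiInit i ω) := rfl
  rw [h1, mean_sub, mean_smul, meanGrad, ← mean_add]
  simp [gradNoiseInit]

end Dynamics

end Cedas

namespace Cedas
open scoped InnerProductSpace

/-! ### Pathwise recursions of the error quantities -/

section Pathwise

variable {n p : ℕ} {Ω Ξ Z : Type*} {A : Algorithm n p Ξ Z} {s : Samples n Ω Ξ Z}
  {f : Fin n → Vec p → ℝ} {flow : Fin n → ℝ} {L ρ γ : ℝ}
  {G : SimpleGraph (Fin n)} {W Q : Matrix (Fin n) (Fin n) ℝ} {lam : Fin n → ℝ}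

/-- Bounds for the eigenvalues of `(γ/2)(I - W)` other than the first one. -/
structure IsSpectralBound (γ ρ : ℝ) (lam : Fin n → ℝ) : Prop where
  pos : 0 < ρ
  le_half : ρ ≤ 1 / 2
  half_le : ∀ t : Tail n, 1 / 2 ≤ tildeEig γ (lam t)
  le_gap : ∀ t : Tail n, ρ ≤ 1 - tildeEig γ (lam t)
  gap_le : ∀ t : Tail n, 1 - tildeEig γ (lam t) ≤ γ

namespace IsSpectralBound

lemma eig_pos (h : IsSpectralBound γ ρ lam) (t : Tail n) : 0 < tildeEig γ (lam t) := by
  linarith [h.half_le t]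

lemma eig_lt_one (h : IsSpectralBound γ ρ lam) (t : Tail n) : tildeEig γ (lam t) < 1 := by
  linarith [h.le_gap t, h.pos]

lemma ne_one (h : IsSpectralBound γ ρ lam) (t : Tail n) : lam t ≠ 1 := fun h1 => by
  have := h.eig_lt_one t
  rw [h1, tildeEig] at this
  simp at this

lemma checkHSq_eq (h : IsSpectralBound γ ρ lam) {η : ℝ} (S : State n p) :
    checkHSq Q lam γ η f S =
      ∑ t : Tail n, modeEnergy (tildeEig γ (lam t)) (mode Q t S.x) (mode Q t (rHat η f S)) :=
  Cedas.checkHSq_eq h.eig_pos h.eig_lt_one S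

lemma checkHSq_nonneg {η : ℝ} (S : State n p) : 0 ≤ checkHSq Q lam γ η f S :=
  Finset.sum_nonneg fun _ _ => Finset.sum_nonneg fun _ _ => Finset.sum_nonneg fun _ _ =>
    sq_nonneg _

lemma sum_norm_mode_x_sq_le (h : IsSpectralBound γ ρ lam) {η : ℝ} (S : State n p) :
    ∑ t : Tail n, ‖mode Q t S.x‖ ^ 2 ≤ 2 * checkHSq Q lam γ η f S := by
  rw [h.checkHSq_eq, Finset.mul_sum]
  exact Finset.sum_le_sum fun t _ => norm_sq_le_modeEnergy (h.eig_pos t) (h.eig_lt_one t) _ _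

lemma stackSq_eq (h : IsSpectralBound γ ρ lam) (hn : 0 < n) (hW : IsMixingMatrix G W)
    (hQ : IsSortedEigendecomposition W Q lam) (v : Fin n → Vec p) :
    stackSq v = ∑ t : Tail n, ‖mode Q t v‖ ^ 2 + n * ‖mean v‖ ^ 2 := by
  rw [sum_tail_norm_mode_sq hn hW hQ h.ne_one, ← stackSq_eq_stackSq_sub_mean_add hn]

lemma stackSq_sub_mean_le (h : IsSpectralBound γ ρ lam) (hn : 0 < n) (hW : IsMixingMatrix G W)
    (hQ : IsSortedEigendecomposition W Q lam) {η : ℝ} (S : State n p) :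
    stackSq (fun i => S.x i - mean S.x) ≤ 2 * checkHSq Q lam γ η f S := by
  rw [← sum_tail_norm_mode_sq hn hW hQ h.ne_one]
  exact h.sum_norm_mode_x_sq_le S

lemma stackSq_gradDev_le (h : IsSpectralBound γ ρ lam) (hn : 0 < n) (hW : IsMixingMatrix G W)
    (hQ : IsSortedEigendecomposition W Q lam) (hf : IsSmoothBddBelow f L flow) {η : ℝ}
    (S : State n p) :
    stackSq (gradDev f S.x) ≤ L ^ 2 * (2 * checkHSq Q lam γ η f S) := by
  refine le_trans ?_ (mul_le_mul_of_nonneg_left (h.stackSq_sub_mean_le hn hW hQ S) (sq_nonneg L))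
  unfold stackSq
  rw [Finset.mul_sum]
  refine Finset.sum_le_sum fun i _ => ?_
  rw [← mul_pow, norm_sub_rev (S.x i)]
  exact pow_le_pow_left₀ (norm_nonneg _) (hf.lipschitz i _ _) 2

lemma stackSq_lap (h : IsSpectralBound γ ρ lam) (hn : 0 < n) (hW : IsMixingMatrix G W)
    (hQ : IsSortedEigendecomposition W Q lam) (v : Fin n → Vec p) :
    stackSq (lap γ W v) =
      ∑ t : Tail n, (1 - tildeEig γ (lam t)) ^ 2 * ‖mode Q t v‖ ^ 2 := by
  have hm : mean (lap γ W v) = 0 := by rw [mean, sum_lap hW, smul_zero]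
  rw [h.stackSq_eq hn hW hQ, hm]
  simp only [mode_lap hW hQ, norm_smul, mul_pow, Real.norm_eq_abs, sq_abs]
  simp

lemma stackSq_lap_le (h : IsSpectralBound γ ρ lam) (hn : 0 < n) (hW : IsMixingMatrix G W)
    (hQ : IsSortedEigendecomposition W Q lam) (v : Fin n → Vec p) :
    stackSq (lap γ W v) ≤ γ ^ 2 * stackSq v := by
  rw [h.stackSq_lap hn hW hQ]
  refine le_trans ?_ (mul_le_mul_of_nonneg_left
    (sum_tail_norm_mode_sq_le hQ.orthogonal v) (sq_nonneg γ))
  rw [Finset.mul_sum]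
  refine Finset.sum_le_sum fun t _ => ?_
  have h1 := h.gap_le t
  have h2 := h.le_gap t
  have h3 := h.pos
  gcongr
  linarith

/-- The mean of r̂ is η∇f(x̄) because `d` averages to zero. In the other modes the energy weights r
by 1/(1-l), which yields the factor 1-l ≤ γ. -/
lemma stackSq_rHat_le (h : IsSpectralBound A.γ ρ lam) (hn : 0 < n)
    (hW : IsMixingMatrix A.G A.W) (hQ : IsSortedEigendecomposition A.W Q lam)
    (hf : IsSmoothBddBelow f L flow) (k : ℕ) (ω : Ω) :
    stackSq (rHat A.η f (A.state s ω k)) ≤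
      2 * A.γ * checkHSq Q lam A.γ A.η f (A.state s ω k) + n * A.η ^ 2 * gradSq A s f k ω := by
  rw [h.stackSq_eq hn hW hQ, mean_rHat hW hf, norm_smul, mul_pow, Real.norm_eq_abs, sq_abs,
    h.checkHSq_eq, Finset.mul_sum, gradSq, mul_assoc]
  gcongr with t
  refine (norm_sq_le_mul_modeEnergy (h.eig_pos t) (h.eig_lt_one t) (mode Q t (A.state s ω k).x)
    _).trans ?_
  have := modeEnergy_nonneg (h.eig_pos t) (h.eig_lt_one t) (mode Q t (A.state s ω k).x)
    (mode Q t (rHat A.η f (A.state s ω k)))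
  have h1 := h.gap_le t
  gcongr

end IsSpectralBound

/-- The difference of the gradients at consecutive averages. -/
def gradDiff (f : Fin n → Vec p → ℝ) (x x' : Vec p) (i : Fin n) : Vec p :=
  gradient (f i) x' - gradient (f i) x

/-- The factor of the compression error in the recursion of the transformed consensus error. -/
def dualNoise (Q : Matrix (Fin n) (Fin n) ℝ) (lam : Fin n → ℝ) (A : Algorithm n p Ξ Z)
    (s : Samples n Ω Ξ Z) (f : Fin n → Vec p → ℝ) (k : ℕ) (t : Fin n) (ω : Ω) : Vec p :=
  mode Q t (rHat A.η f (A.state s ω k)) +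
    (1 - tildeEig A.γ (lam t)) • mode Q t (yStack A s k ω) +
    A.η • mode Q t (gradDiff f (mean (A.state s ω k).x) (mean (A.state s ω (k + 1)).x)) -
    ((1 - tildeEig A.γ (lam t)) / tildeEig A.γ (lam t)) •
      tildeEig A.γ (lam t) • mode Q t (yStack A s k ω)

lemma stackSq_gradDiff_le (hf : IsSmoothBddBelow f L flow) (x x' : Vec p) :
    stackSq (gradDiff f x x') ≤ n * (L ^ 2 * ‖x' - x‖ ^ 2) := by
  unfold stackSq
  calc _ ≤ ∑ _i : Fin n, L ^ 2 * ‖x' - x‖ ^ 2 := Finset.sum_le_sum fun i _ => by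
        rw [← mul_pow]
        exact pow_le_pow_left₀ (norm_nonneg _) (hf.lipschitz i _ _) 2
    _ = _ := by simp

lemma mode_state_succ_x (hW : IsMixingMatrix A.G A.W)
    (hQ : IsSortedEigendecomposition A.W Q lam) (t : Fin n) (ω : Ω) (k : ℕ) :
    mode Q t (A.state s ω (k + 1)).x = mode Q t (yStack A s k ω) -
      (1 - tildeEig A.γ (lam t)) • (mode Q t (yStack A s k ω) +
        mode Q t (fun i => compNoise A s k i ω)) := by
  rw [state_succ_x hW, map_sub, mode_lap hW hQ, ← map_add]
  rfl

lemma mode_rHat_succ (hW : IsMixingMatrix A.G A.W)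
    (hQ : IsSortedEigendecomposition A.W Q lam) (f : Fin n → Vec p → ℝ) (t : Fin n) (ω : Ω)
    (k : ℕ) :
    mode Q t (rHat A.η f (A.state s ω (k + 1))) = mode Q t (rHat A.η f (A.state s ω k)) +
      (1 - tildeEig A.γ (lam t)) • (mode Q t (yStack A s k ω) +
        mode Q t (fun i => compNoise A s k i ω)) +
      A.η • mode Q t (gradDiff f (mean (A.state s ω k).x) (mean (A.state s ω (k + 1)).x)) := by
  have h : rHat A.η f (A.state s ω (k + 1)) = rHat A.η f (A.state s ω k) +
      lap A.γ A.W (fun i => yStack A s k ω i + compNoise A s k i ω) +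
      A.η • gradDiff f (mean (A.state s ω k).x) (mean (A.state s ω (k + 1)).x) := by
    ext1 i
    simp only [rHat, gradDiff, Pi.add_apply, Pi.smul_apply]
    rw [state_succ_d hW, Pi.add_apply]
    module
  rw [h, map_add, map_add, mode_lap hW hQ, map_smul, ← map_add (mode Q t) (yStack A s k ω)]
  rfl

lemma mode_yStack (f : Fin n → Vec p → ℝ) (t : Fin n) (ω : Ω) (k : ℕ) :
    mode Q t (yStack A s k ω) = mode Q t (A.state s ω k).x -
      mode Q t (rHat A.η f (A.state s ω k)) + A.η • mode Q t (gradDev f (A.state s ω k).x) -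
      A.η • mode Q t (fun i => gradNoise A s f k i ω) := by
  rw [yStack_eq f, map_sub, map_add, map_sub, map_smul, map_smul]

/-- The one-step bound for each mode, summed. The two sums of inner products are kept because their
expectations vanish; the movement of the average is rewritten through the averaged gradients and
noise. -/
lemma checkHSq_succ_le (h : IsSpectralBound A.γ ρ lam) (hn : 0 < n)
    (hW : IsMixingMatrix A.G A.W) (hQ : IsSortedEigendecomposition A.W Q lam)
    (hf : IsSmoothBddBelow f L flow) (hγ : 0 ≤ A.γ) (k : ℕ) (ω : Ω) :
    checkHSq Q lam A.γ A.η f (A.state s ω (k + 1)) ≤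
      ((1 - ρ) * checkHSq Q lam A.γ A.η f (A.state s ω k) -
        A.η * ∑ t : Tail n, ⟪mode Q t (A.state s ω k).x,
          mode Q t (fun i => gradNoise A s f k i ω)⟫_ℝ +
        A.η ^ 2 / 2 * stackSq (fun i => gradNoise A s f k i ω)) / (1 - ρ / 2) +
      2 / ρ * (2 * A.η ^ 2 * L ^ 2 * checkHSq Q lam A.γ A.η f (A.state s ω k) +
        A.η ^ 4 * n * L ^ 2 / ρ *
          ‖meanGrad f (A.state s ω k).x + mean fun i => gradNoise A s f k i ω‖ ^ 2) +
      ∑ t : Tail n, ⟪dualNoise Q lam A s f k t ω, mode Q t (fun i => compNoise A s k i ω)⟫_ℝ +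
      A.γ * stackSq (fun i => compNoise A s k i ω) := by
  have hρ := h.pos
  have hρ1 := h.le_half
  have hstep : ∀ t : Tail n, modeEnergy (tildeEig A.γ (lam t)) (mode Q t (A.state s ω (k + 1)).x)
      (mode Q t (rHat A.η f (A.state s ω (k + 1)))) ≤
      ((1 - ρ) * modeEnergy (tildeEig A.γ (lam t)) (mode Q t (A.state s ω k).x)
          (mode Q t (rHat A.η f (A.state s ω k))) -
        A.η * ⟪mode Q t (A.state s ω k).x, mode Q t (fun i => gradNoise A s f k i ω)⟫_ℝ +
        A.η ^ 2 / 2 * ‖mode Q t (fun i => gradNoise A s f k i ω)‖ ^ 2) / (1 - ρ / 2) +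
      2 / ρ * (A.η ^ 2 * ‖mode Q t (gradDev f (A.state s ω k).x)‖ ^ 2 + A.η ^ 2 / ρ *
        ‖mode Q t (gradDiff f (mean (A.state s ω k).x) (mean (A.state s ω (k + 1)).x))‖ ^ 2) +
      ⟪dualNoise Q lam A s f k t ω, mode Q t (fun i => compNoise A s k i ω)⟫_ℝ +
      A.γ * ‖mode Q t (fun i => compNoise A s k i ω)‖ ^ 2 := fun t => by
    have hE := modeEnergy_nonneg (h.eig_pos t) (h.eig_lt_one t) (mode Q t (A.state s ω k).x)
      (mode Q t (rHat A.η f (A.state s ω k)))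
    have hgap := h.le_gap t
    have hgap2 := h.gap_le t
    have hhalf := h.half_le t
    have hl := h.eig_pos t
    rw [mode_state_succ_x hW hQ, mode_rHat_succ hW hQ f]
    refine (modeEnergy_step_le (h.eig_pos t) (h.eig_lt_one t) hρ (by linarith)
      (mode_yStack f t ω k)).trans ?_
    refine add_le_add (add_le_add (add_le_add ?_ ?_) le_rfl) ?_
    · refine div_le_div_of_nonneg_right ?_ (by linarith)
      have : tildeEig A.γ (lam t) * modeEnergy (tildeEig A.γ (lam t)) (mode Q t (A.state s ω k).x)
          (mode Q t (rHat A.η f (A.state s ω k))) ≤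
          (1 - ρ) * modeEnergy (tildeEig A.γ (lam t)) (mode Q t (A.state s ω k).x)
          (mode Q t (rHat A.η f (A.state s ω k))) := by
        apply mul_le_mul_of_nonneg_right _ hE
        linarith
      linarith
    · gcongr
      rw [div_mul_eq_mul_div]
      gcongr
    -- The weight (1-l)/(2l) is at most 1-l ≤ γ, since l ≥ 1/2.
    · rw [mul_div_right_comm]
      gcongr
      rw [div_div, div_le_iff₀ (by linarith)]
      nlinarith
  rw [h.checkHSq_eq]
  refine (Finset.sum_le_sum fun t _ => hstep t).trans ?_
  rw [Finset.sum_add_distrib, Finset.sum_add_distrib, Finset.sum_add_distrib, ← Finset.sum_div,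
    Finset.sum_add_distrib, Finset.sum_sub_distrib, ← Finset.mul_sum, ← Finset.mul_sum,
    ← Finset.mul_sum, ← Finset.mul_sum, ← Finset.mul_sum, Finset.sum_add_distrib,
    ← Finset.mul_sum, ← Finset.mul_sum, ← h.checkHSq_eq]
  have hx : mean (A.state s ω (k + 1)).x - mean (A.state s ω k).x =
      -(A.η • (meanGrad f (A.state s ω k).x + mean fun i => gradNoise A s f k i ω)) := by
    rw [mean_state_succ_x hW f]
    abel
  refine add_le_add (add_le_add (add_le_add ?_ ?_) le_rfl) ?_
  · refine div_le_div_of_nonneg_right ?_ (by linarith)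
    gcongr
    exact sum_tail_norm_mode_sq_le hQ.orthogonal _
  · refine mul_le_mul_of_nonneg_left (add_le_add ?_ ?_) (by positivity)
    · calc _ ≤ A.η ^ 2 * (L ^ 2 * (2 * checkHSq Q lam A.γ A.η f (A.state s ω k))) := by
            gcongr
            exact (sum_tail_norm_mode_sq_le hQ.orthogonal _).trans
              (h.stackSq_gradDev_le hn hW hQ hf _)
        _ = _ := by ring
    · calc _ ≤ A.η ^ 2 / ρ * (n * (L ^ 2 *
            ‖mean (A.state s ω (k + 1)).x - mean (A.state s ω k).x‖ ^ 2)) := by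
            gcongr
            exact (sum_tail_norm_mode_sq_le hQ.orthogonal _).trans (stackSq_gradDiff_le hf _ _)
        _ = _ := by
            rw [hx, norm_neg, norm_smul, mul_pow, Real.norm_eq_abs, sq_abs]
            ring
  · gcongr
    exact sum_tail_norm_mode_sq_le hQ.orthogonal _

/-- The Laplacian annihilates the mean, so only the tail modes of y matter, and these are controlled
by the consensus energy and the gradient noise. -/
lemma stackSq_lap_yStack_le (h : IsSpectralBound A.γ ρ lam) (hn : 0 < n)
    (hW : IsMixingMatrix A.G A.W) (hQ : IsSortedEigendecomposition A.W Q lam)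
    (hf : IsSmoothBddBelow f L flow) (k : ℕ) (ω : Ω) :
    stackSq (lap A.γ A.W (yStack A s k ω)) ≤
      4 * A.γ ^ 2 * ((2 + 2 * A.η ^ 2 * L ^ 2) * checkHSq Q lam A.γ A.η f (A.state s ω k) +
        A.η ^ 2 * stackSq (fun i => gradNoise A s f k i ω)) := by
  have hstep : ∀ t : Tail n, (1 - tildeEig A.γ (lam t)) ^ 2 * ‖mode Q t (yStack A s k ω)‖ ^ 2 ≤
      A.γ ^ 2 * (4 * (2 * modeEnergy (tildeEig A.γ (lam t)) (mode Q t (A.state s ω k).x)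
          (mode Q t (rHat A.η f (A.state s ω k))) +
        A.η ^ 2 * ‖mode Q t (gradDev f (A.state s ω k).x)‖ ^ 2 +
        A.η ^ 2 * ‖mode Q t (fun i => gradNoise A s f k i ω)‖ ^ 2)) := fun t => by
    have h1 := h.le_gap t
    have h2 := h.gap_le t
    have h3 := h.pos
    have h4 := norm_add_four_sq_le (mode Q t (A.state s ω k).x)
      (-mode Q t (rHat A.η f (A.state s ω k))) (A.η • mode Q t (gradDev f (A.state s ω k).x))
      (-(A.η • mode Q t (fun i => gradNoise A s f k i ω)))
    rw [← sub_eq_add_neg, ← sub_eq_add_neg, ← mode_yStack f, norm_neg, norm_neg, norm_smul,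
      norm_smul, mul_pow, mul_pow, Real.norm_eq_abs, sq_abs] at h4
    have h5 := norm_sq_add_norm_sq_le_modeEnergy (h.eig_pos t) (h.eig_lt_one t)
      (mode Q t (A.state s ω k).x) (mode Q t (rHat A.η f (A.state s ω k)))
    gcongr
    · linarith
    · linarith
  rw [h.stackSq_lap hn hW hQ]
  refine (Finset.sum_le_sum fun t _ => hstep t).trans ?_
  rw [← Finset.mul_sum, ← Finset.mul_sum, Finset.sum_add_distrib, Finset.sum_add_distrib,
    ← Finset.mul_sum, ← Finset.mul_sum, ← Finset.mul_sum, ← h.checkHSq_eq]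
  have h1 := (sum_tail_norm_mode_sq_le hQ.orthogonal (gradDev f (A.state s ω k).x)).trans
    (h.stackSq_gradDev_le (η := A.η) hn hW hQ hf _)
  have h2 := sum_tail_norm_mode_sq_le hQ.orthogonal (fun i => gradNoise A s f k i ω)
  calc _ ≤ A.γ ^ 2 * (4 * (2 * checkHSq Q lam A.γ A.η f (A.state s ω k) +
        A.η ^ 2 * (L ^ 2 * (2 * checkHSq Q lam A.γ A.η f (A.state s ω k))) +
        A.η ^ 2 * stackSq (fun i => gradNoise A s f k i ω))) := by gcongr
    _ = _ := by ring

/-- The conditional mean of `y_k - h_k` given the history before the gradient samples are drawn. -/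
def compDrift (A : Algorithm n p Ξ Z) (s : Samples n Ω Ξ Z) (f : Fin n → Vec p → ℝ)
    (k : ℕ) (i : Fin n) (ω : Ω) : Vec p :=
  (A.state s ω k).x i - A.η • gradient (f i) ((A.state s ω k).x i) - (A.state s ω k).d i -
    (A.state s ω k).h i

lemma compInput_eq (f : Fin n → Vec p → ℝ) (k : ℕ) (i : Fin n) (ω : Ω) :
    compInput A s k i ω = compDrift A s f k i ω - A.η • gradNoise A s f k i ω := by
  simp only [compInput, Algorithm.y, compDrift, gradNoise]
  module

/-- Separates the contracting part of y - H from the driving terms. Grouping the new gradient step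
and correction as r̂ keeps the latter small near consensus and stationarity. -/
lemma compDrift_succ (hW : IsMixingMatrix A.G A.W) (f : Fin n → Vec p → ℝ)
    (k : ℕ) (i : Fin n) (ω : Ω) :
    compDrift A s f (k + 1) i ω =
      ((1 - A.α) • compInput A s k i ω - A.α • compNoise A s k i ω) +
      (-lap A.γ A.W (yStack A s k ω) i + -lap A.γ A.W (fun i => compNoise A s k i ω) i +
        -rHat A.η f (A.state s ω (k + 1)) i + A.η • gradDev f (A.state s ω (k + 1)).x i) := by
  have hlap : lap A.γ A.W (fun i => yStack A s k ω i + compNoise A s k i ω) =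
      lap A.γ A.W (yStack A s k ω) + lap A.γ A.W (fun i => compNoise A s k i ω) := by
    have := mulStack_add A.W (yStack A s k ω) (fun i => compNoise A s k i ω)
    have e : (fun i => yStack A s k ω i + compNoise A s k i ω) =
      yStack A s k ω + fun i => compNoise A s k i ω := rfl
    rw [e, lap, lap, lap, this]
    module
  have hx := congrFun (state_succ_x (s := s) hW ω k) i
  rw [hlap] at hx
  simp only [Pi.sub_apply, Pi.add_apply] at hx
  have hy : yStack A s k ω i = compInput A s k i ω + (A.state s ω k).h i := by
    simp [yStack, compInput]
  have hr : A.η • gradDev f (A.state s ω (k + 1)).x i - rHat A.η f (A.state s ω (k + 1)) i =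
      -(A.η • gradient (f i) ((A.state s ω (k + 1)).x i)) - (A.state s ω (k + 1)).d i := by
    simp only [gradDev, rHat]
    module
  calc compDrift A s f (k + 1) i ω = (A.state s ω (k + 1)).x i +
        (-(A.η • gradient (f i) ((A.state s ω (k + 1)).x i)) - (A.state s ω (k + 1)).d i) -
        (A.state s ω (k + 1)).h i := by simp only [compDrift]; module
    _ = _ := by
        rw [← hr, hx, state_succ_h, hy]
        module

lemma stackSq_add_four_le (a b c d : Fin n → Vec p) :
    stackSq (fun i => a i + b i + c i + d i) ≤
      4 * (stackSq a + stackSq b + stackSq c + stackSq d) := by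
  unfold stackSq
  rw [← Finset.sum_add_distrib, ← Finset.sum_add_distrib, ← Finset.sum_add_distrib,
    Finset.mul_sum]
  exact Finset.sum_le_sum fun i _ => norm_add_four_sq_le _ _ _ _

lemma stackSq_neg (v : Fin n → Vec p) : stackSq (fun i => -v i) = stackSq v := by
  simp [stackSq]

/-- Young's inequality with weights 1-α/2 and α/2 separates the contraction from the four driving
terms; their factor 8/α is 4 divided by α/2. The new gradient noise is expanded exactly, since its
cross term averages to zero. -/
lemma compErrSq_succ_le (h : IsSpectralBound A.γ ρ lam) (hn : 0 < n)
    (hW : IsMixingMatrix A.G A.W) (hQ : IsSortedEigendecomposition A.W Q lam)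
    (hf : IsSmoothBddBelow f L flow) (hα : 0 < A.α) (hα1 : A.α ≤ 1) (k : ℕ) (ω : Ω) :
    compErrSq A s (k + 1) ω ≤
      ((1 - A.α) ^ 2 * compErrSq A s k ω -
        2 * A.α * (1 - A.α) * ∑ i, ⟪compInput A s k i ω, compNoise A s k i ω⟫_ℝ +
        A.α ^ 2 * stackSq (fun i => compNoise A s k i ω)) / (1 - A.α / 2) +
      8 / A.α * (4 * A.γ ^ 2 * ((2 + 2 * A.η ^ 2 * L ^ 2) *
          checkHSq Q lam A.γ A.η f (A.state s ω k) +
            A.η ^ 2 * stackSq (fun i => gradNoise A s f k i ω)) +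
        A.γ ^ 2 * stackSq (fun i => compNoise A s k i ω) +
        (2 * A.γ + 2 * A.η ^ 2 * L ^ 2) * checkHSq Q lam A.γ A.η f (A.state s ω (k + 1)) +
        n * A.η ^ 2 * gradSq A s f (k + 1) ω) -
      2 * A.η * ∑ i, ⟪compDrift A s f (k + 1) i ω, gradNoise A s f (k + 1) i ω⟫_ℝ +
      A.η ^ 2 * stackSq (fun i => gradNoise A s f (k + 1) i ω) := by
  have e1 : compErrSq A s (k + 1) ω = stackSq (fun i => compDrift A s f (k + 1) i ω -
      A.η • gradNoise A s f (k + 1) i ω) := by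
    simp_rw [← compInput_eq]
    rfl
  rw [e1, stackSq_sub_smul]
  have e2 : stackSq (fun i => (1 - A.α) • compInput A s k i ω - A.α • compNoise A s k i ω) =
      (1 - A.α) ^ 2 * compErrSq A s k ω -
        2 * A.α * (1 - A.α) * ∑ i, ⟪compInput A s k i ω, compNoise A s k i ω⟫_ℝ +
        A.α ^ 2 * stackSq (fun i => compNoise A s k i ω) := by
    rw [stackSq_sub_smul, stackSq_smul]
    simp_rw [real_inner_smul_left]
    rw [← Finset.mul_sum, ← mul_assoc]
    rfl
  have e3 := (congrArg stackSq (funext fun i => compDrift_succ (s := s) hW f k i ω)).trans_le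
    (stackSq_add_le_div (θ := 1 - A.α / 2) (by linarith) (by linarith) _ _)
  rw [e2] at e3
  have e4 := stackSq_add_four_le (fun i => -lap A.γ A.W (yStack A s k ω) i)
    (fun i => -lap A.γ A.W (fun i => compNoise A s k i ω) i)
    (fun i => -rHat A.η f (A.state s ω (k + 1)) i)
    (fun i => A.η • gradDev f (A.state s ω (k + 1)).x i)
  rw [stackSq_neg, stackSq_neg, stackSq_neg, stackSq_smul] at e4
  have e5 := stackSq_lap_yStack_le (s := s) h hn hW hQ hf k ω
  have e6 := h.stackSq_lap_le hn hW hQ (fun i => compNoise A s k i ω)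
  have e7 := h.stackSq_rHat_le (s := s) hn hW hQ hf (k + 1) ω
  have e8 := mul_le_mul_of_nonneg_left
    (h.stackSq_gradDev_le (η := A.η) hn hW hQ hf (A.state s ω (k + 1))) (sq_nonneg A.η)
  have e9 : ∀ a b : ℝ, a ≤ 4 * b → a / (1 - (1 - A.α / 2)) ≤ 8 / A.α * b := fun a b hab => by
    rw [show 1 - (1 - A.α / 2) = A.α / 2 by ring, div_le_iff₀ (by positivity)]
    calc a ≤ 4 * b := hab
      _ = _ := by field_simp; ring
  have e10 := e9 _ _ (e4.trans (mul_le_mul_of_nonneg_left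
    (add_le_add (add_le_add (add_le_add e5 e6) e7) e8) (by norm_num)))
  refine add_le_add (sub_le_sub_right (e3.trans (add_le_add le_rfl (e10.trans_eq ?_))) _) le_rfl
  ring

end Pathwise

end Cedas

namespace Cedas
open scoped InnerProductSpace

/-! ### Expectations -/

section HasMean

variable {Ω : Type*} {mΩ : MeasurableSpace Ω} {μ : Measure Ω}

/-- The random variable `X` is integrable with expectation `c`. -/
structure HasMean (μ : Measure Ω) (X : Ω → ℝ) (c : ℝ) : Prop where
  integrable : Integrable X μ
  integral_eq : ∫ ω, X ω ∂μ = c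

namespace HasMean

variable {X Y : Ω → ℝ} {a b : ℝ}

lemma of_integrable (hX : Integrable X μ) : HasMean μ X (∫ ω, X ω ∂μ) := ⟨hX, rfl⟩

lemma add (hX : HasMean μ X a) (hY : HasMean μ Y b) :
    HasMean μ (fun ω => X ω + Y ω) (a + b) :=
  ⟨hX.1.add hY.1, by rw [integral_add hX.1 hY.1, hX.2, hY.2]⟩

lemma sub (hX : HasMean μ X a) (hY : HasMean μ Y b) :
    HasMean μ (fun ω => X ω - Y ω) (a - b) :=
  ⟨hX.1.sub hY.1, by rw [integral_sub hX.1 hY.1, hX.2, hY.2]⟩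

lemma const_mul (c : ℝ) (hX : HasMean μ X a) : HasMean μ (fun ω => c * X ω) (c * a) :=
  ⟨hX.1.const_mul c, by rw [integral_const_mul, hX.2]⟩

lemma div_const (hX : HasMean μ X a) (c : ℝ) : HasMean μ (fun ω => X ω / c) (a / c) :=
  ⟨hX.1.div_const c, by rw [integral_div, hX.2]⟩

lemma sum_zero {ι : Type*} [Fintype ι] {X : ι → Ω → ℝ} (hX : ∀ i, HasMean μ (X i) 0) :
    HasMean μ (fun ω => ∑ i, X i ω) 0 :=
  ⟨integrable_finsetSum _ fun i _ => (hX i).1, by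
    rw [integral_finsetSum _ fun i _ => (hX i).1]
    simp [fun i => (hX i).2]⟩

lemma le (hX : HasMean μ X a) (hY : HasMean μ Y b) (h : ∀ ω, X ω ≤ Y ω) : a ≤ b := by
  rw [← hX.2, ← hY.2]
  exact integral_mono hX.1 hY.1 h

end HasMean

variable {n p : ℕ}

lemma hasMean_inner_mode {X : Ω → Vec p} {v : Fin n → Ω → Vec p} (hX : MemLp X 2 μ)
    (hv : ∀ i, MemLp (v i) 2 μ) (h : ∀ i, ∫ ω, ⟪X ω, v i ω⟫_ℝ ∂μ = 0)
    (Q : Matrix (Fin n) (Fin n) ℝ) (t : Fin n) :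
    HasMean μ (fun ω => ⟪X ω, mode Q t (fun i => v i ω)⟫_ℝ) 0 := by
  simp_rw [mode_apply, inner_sum, real_inner_smul_right]
  refine HasMean.sum_zero fun i => ?_
  simpa using HasMean.const_mul (Q i t) ⟨integrable_inner_of_memLp hX (hv i), h i⟩

lemma hasMean_inner_mean {X : Ω → Vec p} {v : Fin n → Ω → Vec p} (hX : MemLp X 2 μ)
    (hv : ∀ i, MemLp (v i) 2 μ) (h : ∀ i, ∫ ω, ⟪X ω, v i ω⟫_ℝ ∂μ = 0) :
    HasMean μ (fun ω => ⟪X ω, mean (fun i => v i ω)⟫_ℝ) 0 := by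
  simp_rw [mean, real_inner_smul_right, inner_sum]
  simpa using HasMean.const_mul (1 / (n : ℝ))
    (HasMean.sum_zero fun i => ⟨integrable_inner_of_memLp hX (hv i), h i⟩)

end HasMean

/-! ### Square integrable vectors determined by a history -/

section Past

variable {n p : ℕ} {Ω : Type*} {mΩ : MeasurableSpace Ω} {μ : Measure Ω}

/-- The square integrable `m`-measurable random vectors. -/
def pastSubmodule (p : ℕ) (m : MeasurableSpace Ω) {mΩ : MeasurableSpace Ω} (μ : Measure Ω) :
    Submodule ℝ (Ω → Vec p) :=
  measurableSubmodule p m ⊓ memLpSubmodule p μ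

lemma IsSmoothBddBelow.gradient_mem [IsFiniteMeasure μ] {f : Fin n → Vec p → ℝ} {L : ℝ}
    {flow : Fin n → ℝ} (hf : IsSmoothBddBelow f L flow) {m : MeasurableSpace Ω} {X : Ω → Vec p}
    (hX : X ∈ pastSubmodule p m μ) (i : Fin n) :
    (fun ω => gradient (f i) (X ω)) ∈ pastSubmodule p m μ :=
  ⟨(hf.continuous_gradient i).measurable.comp hX.1,
    memLp_comp_of_norm_sub_le (hf.lipschitz i) hX.2⟩

lemma pastSubmodule_mono {m m' : MeasurableSpace Ω} (hm : m ≤ m') :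
    pastSubmodule p m μ ≤ pastSubmodule p m' μ :=
  fun _ hX => ⟨Measurable.mono hX.1 hm le_rfl, hX.2⟩

end Past

/-! ### The descent inequality -/

section Descent

variable {n p : ℕ} {f : Fin n → Vec p → ℝ} {L : ℝ} {flow : Fin n → ℝ}

lemma norm_gradient_sub_meanGrad_sq_le (hn : 0 < n) (hf : IsSmoothBddBelow f L flow)
    (x : Fin n → Vec p) :
    ‖gradient (avgObj f) (mean x) - meanGrad f x‖ ^ 2 ≤
      L ^ 2 / n * stackSq (fun i => x i - mean x) := by
  have hn' : (0 : ℝ) < n := by positivity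
  rw [hf.gradient_avgObj, meanGrad, ← mean_sub]
  have h1 := norm_mean_sq_le hn (gradDev f x)
  have h2 : stackSq (gradDev f x) ≤ L ^ 2 * stackSq (fun i => x i - mean x) := by
    unfold stackSq
    rw [Finset.mul_sum]
    refine Finset.sum_le_sum fun i _ => ?_
    rw [← mul_pow, norm_sub_rev (x i)]
    exact pow_le_pow_left₀ (norm_nonneg _) (hf.lipschitz i _ _) 2
  rw [div_mul_eq_mul_div, le_div_iff₀ hn', mul_comm]
  exact h1.trans h2

/-- The inner product of ∇f(x̄) with the averaged gradient is polarized. The resulting negative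
square of the averaged gradient is kept: it later pays for the movement of x̄ in the consensus
recursion. -/
lemma avgObj_step_le (hn : 0 < n) (hf : IsSmoothBddBelow f L flow) {η : ℝ} (hη : 0 ≤ η)
    (x : Fin n → Vec p) (w : Vec p) :
    avgObj f (mean x - η • (meanGrad f x + w)) ≤ avgObj f (mean x) -
      η / 2 * ‖gradient (avgObj f) (mean x)‖ ^ 2 -
      η / 2 * (1 - L * η) * ‖meanGrad f x‖ ^ 2 +
      η * L ^ 2 / (2 * n) * stackSq (fun i => x i - mean x) +
      (L * η ^ 2 * ⟪meanGrad f x, w⟫_ℝ - η * ⟪gradient (avgObj f) (mean x), w⟫_ℝ) +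
      L * η ^ 2 / 2 * ‖w‖ ^ 2 := by
  have h := le_add_inner_gradient_add_sq hf.differentiable_avgObj (hf.lipschitz_avgObj hn)
    (mean x) (mean x - η • (meanGrad f x + w))
  rw [sub_sub_cancel_left, norm_neg, norm_smul, mul_pow, Real.norm_eq_abs, sq_abs, inner_neg_right,
    real_inner_smul_right, inner_add_right, norm_add_sq_real] at h
  have h2 := norm_gradient_sub_meanGrad_sq_le hn hf x
  rw [norm_sub_sq_real] at h2
  have h3 := mul_le_mul_of_nonneg_left h2 (by positivity : 0 ≤ η / 2)
  have h4 : η / 2 * (L ^ 2 / n * stackSq (fun i => x i - mean x)) =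
      η * L ^ 2 / (2 * n) * stackSq (fun i => x i - mean x) := by
    rw [← mul_assoc]
    congr 1
    rw [div_mul_div_comm]
  rw [h4] at h3
  linarith

variable {Ω : Type*} {mΩ : MeasurableSpace Ω} {μ : Measure Ω}

lemma integrable_stackSq_sub_mean {x : Ω → Fin n → Vec p}
    (hx : ∀ i, MemLp (fun ω => x ω i) 2 μ) :
    Integrable (fun ω => stackSq fun i => x ω i - mean (x ω)) μ :=
  integrable_stackSq (v := fun i ω => x ω i - mean (x ω)) fun i => (hx i).sub (memLp_mean hx)

variable [IsProbabilityMeasure μ]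

/-- The objective lies between its constant lower bound and the quadratic model at 0. -/
lemma integrable_avgObj (hn : 0 < n) (hf : IsSmoothBddBelow f L flow) {X : Ω → Vec p}
    (hX : MemLp X 2 μ) : Integrable (fun ω => avgObj f (X ω)) μ := by
  have hint : Integrable (fun ω => |(1 / (n : ℝ)) * ∑ i, flow i| + (|avgObj f 0| +
      |⟪gradient (avgObj f) 0, X ω⟫_ℝ| + |L / 2 * ‖X ω‖ ^ 2|)) μ := by
    refine (integrable_const _).add (((integrable_const _).add ?_).add ?_)
    · exact (integrable_inner_of_memLp (memLp_const _) hX).abs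
    · exact ((integrable_norm_sq_of_memLp hX).const_mul _).abs
  refine hint.mono' (hf.differentiable_avgObj.continuous.comp_aestronglyMeasurable hX.1)
    (Filter.Eventually.of_forall fun ω => ?_)
  have h1 := hf.le_avgObj (X ω)
  have h2 := le_add_inner_gradient_add_sq hf.differentiable_avgObj (hf.lipschitz_avgObj hn)
    0 (X ω)
  rw [sub_zero] at h2
  have h3 := neg_abs_le ((1 / (n : ℝ)) * ∑ i, flow i)
  have h4 := abs_nonneg ((1 / (n : ℝ)) * ∑ i, flow i)
  have h5 := le_abs_self (avgObj f 0)
  have h6 := le_abs_self ⟪gradient (avgObj f) 0, X ω⟫_ℝ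
  have h7 := le_abs_self (L / 2 * ‖X ω‖ ^ 2)
  have h8 := abs_nonneg (avgObj f 0)
  have h9 := abs_nonneg ⟪gradient (avgObj f) 0, X ω⟫_ℝ
  have h10 := abs_nonneg (L / 2 * ‖X ω‖ ^ 2)
  rw [Real.norm_eq_abs, abs_le]
  constructor <;> linarith

variable {m : MeasurableSpace Ω} {σ : ℝ} {v : Fin n → Ω → Vec p}

lemma meanGrad_mem (hf : IsSmoothBddBelow f L flow) {x : Ω → Fin n → Vec p}
    (hx : ∀ i, (fun ω => x ω i) ∈ pastSubmodule p m μ) :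
    (fun ω => meanGrad f (x ω)) ∈ pastSubmodule p m μ :=
  mean_mem (v := fun ω i => gradient (f i) (x ω i)) _ fun i => hf.gradient_mem (hx i) i

lemma integral_avgObj_step_le (hn : 0 < n) (hf : IsSmoothBddBelow f L flow) {η : ℝ}
    (hη : 0 ≤ η) (hL : 0 ≤ L) {x : Ω → Fin n → Vec p}
    (hx : ∀ i, (fun ω => x ω i) ∈ pastSubmodule p m μ) (hv : IsCenteredNoise m μ v σ)
    {z : Ω → Vec p} (hz : MemLp z 2 μ)
    (hzx : ∀ ω, z ω = mean (x ω) - η • (meanGrad f (x ω) + mean fun i => v i ω)) :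
    ∫ ω, avgObj f (z ω) ∂μ ≤ ∫ ω, avgObj f (mean (x ω)) ∂μ -
      η / 2 * ∫ ω, ‖gradient (avgObj f) (mean (x ω))‖ ^ 2 ∂μ -
      η / 2 * (1 - L * η) * ∫ ω, ‖meanGrad f (x ω)‖ ^ 2 ∂μ +
      η * L ^ 2 / (2 * n) * ∫ ω, stackSq (fun i => x ω i - mean (x ω)) ∂μ +
      L * η ^ 2 / 2 * (σ ^ 2 / n) := by
  have hxL : ∀ i, MemLp (fun ω => x ω i) 2 μ := fun i => (hx i).2
  have hxm : MemLp (fun ω => mean (x ω)) 2 μ := memLp_mean hxL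
  have hgm : (fun ω => gradient (avgObj f) (mean (x ω))) ∈ pastSubmodule p m μ :=
    ⟨(hf.continuous_gradient_avgObj hn).measurable.comp (mean_mem _ hx).1,
      memLp_comp_of_norm_sub_le (hf.lipschitz_avgObj hn) hxm⟩
  have hmg := meanGrad_mem hf hx
  have hw : MemLp (fun ω => mean fun i => v i ω) 2 μ := memLp_mean hv.memLp
  have h1 := hasMean_inner_mean hmg.2 hv.memLp fun i => hv.orthogonal i _ hmg.1 hmg.2
  have h2 := hasMean_inner_mean hgm.2 hv.memLp fun i => hv.orthogonal i _ hgm.1 hgm.2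
  have hV := HasMean.of_integrable (integrable_norm_sq_of_memLp hw)
  have h := HasMean.le (HasMean.of_integrable (integrable_avgObj hn hf hz))
    ((((((HasMean.of_integrable (integrable_avgObj hn hf hxm)).sub
      ((HasMean.of_integrable (integrable_norm_sq_of_memLp hgm.2)).const_mul (η / 2))).sub
      ((HasMean.of_integrable (integrable_norm_sq_of_memLp hmg.2)).const_mul
        (η / 2 * (1 - L * η)))).add
      ((HasMean.of_integrable (integrable_stackSq_sub_mean hxL)).const_mul
        (η * L ^ 2 / (2 * n)))).add
      ((h1.const_mul (L * η ^ 2)).sub (h2.const_mul η))).add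
      (hV.const_mul (L * η ^ 2 / 2)))
    fun ω => by
      rw [hzx ω]
      exact avgObj_step_le hn hf hη (x ω) _
  refine h.trans ?_
  rw [mul_zero, mul_zero, sub_zero, add_zero]
  gcongr
  exact hv.integral_norm_mean_sq_le hn

end Descent

/-! ### Recursions of the expected error quantities -/

section Recursions

variable {n p : ℕ} {Ω Ξ Z : Type*} [MeasurableSpace Ξ] [MeasurableSpace Z]
  {mΩ : MeasurableSpace Ω} {μ : Measure Ω} {ν : Measure Z} {A : Algorithm n p Ξ Z} {s : Samples n Ω Ξ Z}
  {f : Fin n → Vec p → ℝ} {flow : Fin n → ℝ} {L ρ σ C : ℝ}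
  {Q : Matrix (Fin n) (Fin n) ℝ} {lam : Fin n → ℝ}

lemma gradNoise_mem (hf : IsSmoothBddBelow f L flow)
    (hgrad : IsStochasticGradient μ A s f σ) (hcomp : IsUnbiasedCompressor ν A.comp C)
    (k : ℕ) (i : Fin n) :
    gradNoise A s f k i ∈ pastSubmodule p (s.compPast k) μ :=
  ⟨(measurable_gradNoise hf.continuous_gradient hgrad.measurable_grad hcomp.measurable k i).mono
    (sup_le (gradPast_le_compPast s k) (comap_xi_le_compPast s k i)) le_rfl, hgrad.memLp k i⟩

variable [IsProbabilityMeasure μ] [IsProbabilityMeasure ν]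

lemma state_mem_gradPast (hf : IsSmoothBddBelow f L flow)
    (hgrad : IsStochasticGradient μ A s f σ) (hcomp : IsUnbiasedCompressor ν A.comp C)
    (hseed : IsFreshSeeds μ ν s) (k : ℕ) :
    StateMem (pastSubmodule p (s.gradPast k) μ) fun ω => A.state s ω k := by
  have h1 := measurable_state (s := s) hgrad.measurable_grad hcomp.measurable k
  have h2 := memLp_state hf hgrad hcomp hseed k
  exact ⟨fun i => ⟨h1.x i, h2.x i⟩, fun i => ⟨h1.h i, h2.h i⟩, fun i => ⟨h1.hw i, h2.hw i⟩,
    fun i => ⟨h1.d i, h2.d i⟩⟩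

lemma rHat_mem {m : MeasurableSpace Ω} (hf : IsSmoothBddBelow f L flow) {S : Ω → State n p}
    (hS : StateMem (pastSubmodule p m μ) S) (η : ℝ) (i : Fin n) :
    (fun ω => rHat η f (S ω) i) ∈ pastSubmodule p m μ :=
  Submodule.add_mem _ (hS.d i)
    (Submodule.smul_mem _ η (hf.gradient_mem (mean_mem _ hS.x) i))

lemma yStack_mem (hf : IsSmoothBddBelow f L flow)
    (hgrad : IsStochasticGradient μ A s f σ) (hcomp : IsUnbiasedCompressor ν A.comp C)
    (hseed : IsFreshSeeds μ ν s) (k : ℕ) (i : Fin n) :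
    (fun ω => yStack A s k ω i) ∈ pastSubmodule p (s.compPast k) μ :=
  ⟨measurable_y hgrad.measurable_grad hcomp.measurable k i, memLp_y hf hgrad hcomp hseed k i⟩

/-- The next average is already known before the seeds of iteration k are drawn. This makes
`dualNoise`, which contains it, orthogonal to the compression error. -/
lemma mean_state_succ_mem (hW : IsMixingMatrix A.G A.W) (hf : IsSmoothBddBelow f L flow)
    (hgrad : IsStochasticGradient μ A s f σ) (hcomp : IsUnbiasedCompressor ν A.comp C)
    (hseed : IsFreshSeeds μ ν s) (k : ℕ) :
    (fun ω => mean (A.state s ω (k + 1)).x) ∈ pastSubmodule p (s.compPast k) μ := by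
  have hS := (state_mem_gradPast hf hgrad hcomp hseed k).mono
    (pastSubmodule_mono (gradPast_le_compPast s k))
  simp_rw [mean_state_succ_x hW f]
  exact Submodule.sub_mem _ (mean_mem _ hS.x) (Submodule.smul_mem _ _ (Submodule.add_mem _
    (meanGrad_mem hf hS.x) (mean_mem (v := fun ω i => gradNoise A s f k i ω) _
      fun i => gradNoise_mem hf hgrad hcomp k i)))

lemma dualNoise_mem (hW : IsMixingMatrix A.G A.W) (hf : IsSmoothBddBelow f L flow)
    (hgrad : IsStochasticGradient μ A s f σ) (hcomp : IsUnbiasedCompressor ν A.comp C)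
    (hseed : IsFreshSeeds μ ν s) (k : ℕ) (t : Fin n) :
    dualNoise Q lam A s f k t ∈ pastSubmodule p (s.compPast k) μ := by
  have hS := (state_mem_gradPast hf hgrad hcomp hseed k).mono
    (pastSubmodule_mono (gradPast_le_compPast s k))
  have hy := mode_mem _ (fun i => yStack_mem hf hgrad hcomp hseed k i) Q t
  refine Submodule.sub_mem _ (Submodule.add_mem _ (Submodule.add_mem _
    (mode_mem _ (fun i => rHat_mem hf hS A.η i) Q t) (Submodule.smul_mem _ _ hy))
    (Submodule.smul_mem _ A.η (mode_mem (v := fun ω => gradDiff f (mean (A.state s ω k).x)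
      (mean (A.state s ω (k + 1)).x)) _ (fun i => ?_) Q t)))
    (Submodule.smul_mem _ _ (Submodule.smul_mem _ _ hy))
  exact Submodule.sub_mem _
    (hf.gradient_mem (mean_state_succ_mem hW hf hgrad hcomp hseed k) i)
    (hf.gradient_mem (mean_mem _ hS.x) i)

lemma compDrift_mem (hf : IsSmoothBddBelow f L flow)
    (hgrad : IsStochasticGradient μ A s f σ) (hcomp : IsUnbiasedCompressor ν A.comp C)
    (hseed : IsFreshSeeds μ ν s) (k : ℕ) (i : Fin n) :
    compDrift A s f k i ∈ pastSubmodule p (s.gradPast k) μ := by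
  have hS := state_mem_gradPast hf hgrad hcomp hseed k
  exact Submodule.sub_mem _ (Submodule.sub_mem _ (Submodule.sub_mem _ (hS.x i)
    (Submodule.smul_mem _ A.η (hf.gradient_mem (hS.x i) i))) (hS.d i)) (hS.h i)

lemma integrable_checkHSq (h : IsSpectralBound A.γ ρ lam) (hf : IsSmoothBddBelow f L flow)
    (hgrad : IsStochasticGradient μ A s f σ) (hcomp : IsUnbiasedCompressor ν A.comp C)
    (hseed : IsFreshSeeds μ ν s) (k : ℕ) :
    Integrable (fun ω => checkHSq Q lam A.γ A.η f (A.state s ω k)) μ := by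
  have hS := state_mem_gradPast hf hgrad hcomp hseed k
  simp_rw [h.checkHSq_eq]
  refine integrable_finsetSum _ fun t _ => ?_
  exact (((integrable_norm_sq_of_memLp (mode_mem _ hS.x Q t).2).div_const _).add
    ((integrable_norm_sq_of_memLp
      (mode_mem _ (fun i => rHat_mem hf hS A.η i) Q t).2).div_const _)).div_const 2

lemma integrable_gradSq (hn : 0 < n) (hf : IsSmoothBddBelow f L flow)
    (hgrad : IsStochasticGradient μ A s f σ) (hcomp : IsUnbiasedCompressor ν A.comp C)
    (hseed : IsFreshSeeds μ ν s) (k : ℕ) : Integrable (gradSq A s f k) μ :=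
  integrable_norm_sq_of_memLp (memLp_comp_of_norm_sub_le (hf.lipschitz_avgObj hn)
    (mean_mem _ (memLp_state hf hgrad hcomp hseed k).x))

lemma integrable_compErrSq (hf : IsSmoothBddBelow f L flow)
    (hgrad : IsStochasticGradient μ A s f σ) (hcomp : IsUnbiasedCompressor ν A.comp C)
    (hseed : IsFreshSeeds μ ν s) (k : ℕ) : Integrable (compErrSq A s k) μ :=
  integrable_stackSq (memLp_compInput hf hgrad hcomp hseed k)

lemma hasMean_norm_meanGrad_add_sq (hf : IsSmoothBddBelow f L flow)
    (hgrad : IsStochasticGradient μ A s f σ) (hcomp : IsUnbiasedCompressor ν A.comp C)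
    (hseed : IsFreshSeeds μ ν s) (k : ℕ) :
    HasMean μ (fun ω => ‖meanGrad f (A.state s ω k).x + mean fun i => gradNoise A s f k i ω‖ ^ 2)
      (∫ ω, ‖meanGrad f (A.state s ω k).x‖ ^ 2 ∂μ +
        ∫ ω, ‖mean fun i => gradNoise A s f k i ω‖ ^ 2 ∂μ) := by
  have hS := state_mem_gradPast hf hgrad hcomp hseed k
  have hv := isCenteredNoise_gradNoise hf hgrad hcomp hseed k
  have hmg := meanGrad_mem hf hS.x
  simp_rw [norm_add_sq_real]
  simpa using ((HasMean.of_integrable (integrable_norm_sq_of_memLp hmg.2)).add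
    ((hasMean_inner_mean hmg.2 hv.memLp fun i => hv.orthogonal i _ hmg.1 hmg.2).const_mul 2)).add
    (HasMean.of_integrable (integrable_norm_sq_of_memLp (memLp_mean hv.memLp)))

lemma integral_checkHSq_succ_le (h : IsSpectralBound A.γ ρ lam) (hn : 0 < n)
    (hW : IsMixingMatrix A.G A.W) (hQ : IsSortedEigendecomposition A.W Q lam)
    (hf : IsSmoothBddBelow f L flow)
    (hgrad : IsStochasticGradient μ A s f σ) (hcomp : IsUnbiasedCompressor ν A.comp C)
    (hseed : IsFreshSeeds μ ν s) (hγ : 0 ≤ A.γ) (k : ℕ) :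
    ∫ ω, checkHSq Q lam A.γ A.η f (A.state s ω (k + 1)) ∂μ ≤
      ((1 - ρ) * ∫ ω, checkHSq Q lam A.γ A.η f (A.state s ω k) ∂μ +
        A.η ^ 2 / 2 * (n * σ ^ 2)) / (1 - ρ / 2) +
      2 / ρ * (2 * A.η ^ 2 * L ^ 2 * ∫ ω, checkHSq Q lam A.γ A.η f (A.state s ω k) ∂μ +
        A.η ^ 4 * n * L ^ 2 / ρ * (∫ ω, ‖meanGrad f (A.state s ω k).x‖ ^ 2 ∂μ + σ ^ 2 / n)) +
      A.γ * (C * ∫ ω, compErrSq A s k ω ∂μ) := by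
  have hS := state_mem_gradPast hf hgrad hcomp hseed k
  have hv := isCenteredNoise_gradNoise hf hgrad hcomp hseed k
  have hρ := h.pos
  have hρ1 := h.le_half
  have hN := fun k => HasMean.of_integrable
    (integrable_checkHSq (Q := Q) h hf hgrad hcomp hseed k)
  have h1 : HasMean μ (fun ω => ∑ t : Tail n, ⟪mode Q t (A.state s ω k).x,
      mode Q t (fun i => gradNoise A s f k i ω)⟫_ℝ) 0 := HasMean.sum_zero fun t => by
    have hm := mode_mem _ hS.x Q t
    exact hasMean_inner_mode hm.2 hv.memLp (fun i => hv.orthogonal i _ hm.1 hm.2) Q t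
  have h2 : HasMean μ (fun ω => ∑ t : Tail n, ⟪dualNoise Q lam A s f k t ω,
      mode Q t (fun i => compNoise A s k i ω)⟫_ℝ) 0 := HasMean.sum_zero fun t => by
    have hm := dualNoise_mem (Q := Q) (lam := lam) hW hf hgrad hcomp hseed k t
    exact hasMean_inner_mode hm.2 (memLp_compNoise hf hgrad hcomp hseed k)
      (fun i => integral_inner_compNoise hf hgrad hcomp hseed k i hm.1 hm.2) Q t
  have hV := HasMean.of_integrable (integrable_stackSq hv.memLp)
  have hE := HasMean.of_integrable (integrable_stackSq (memLp_compNoise hf hgrad hcomp hseed k))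
  have hG := hasMean_norm_meanGrad_add_sq hf hgrad hcomp hseed k
  have hle := HasMean.le (hN (k + 1))
    (((((((hN k).const_mul (1 - ρ)).sub (h1.const_mul A.η)).add
      (hV.const_mul (A.η ^ 2 / 2))).div_const (1 - ρ / 2)).add
      ((((hN k).const_mul (2 * A.η ^ 2 * L ^ 2)).add
        (hG.const_mul (A.η ^ 4 * n * L ^ 2 / ρ))).const_mul (2 / ρ))).add h2 |>.add
      (hE.const_mul A.γ))
    (checkHSq_succ_le h hn hW hQ hf hγ k)
  refine hle.trans ?_
  rw [mul_zero, sub_zero, add_zero]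
  have h3 := integral_stackSq_compNoise_le hf hgrad hcomp hseed k
  have h4 := hv.integral_stackSq_le
  have h5 := hv.integral_norm_mean_sq_le hn
  gcongr
  linarith

lemma integral_compErrSq_succ_le (h : IsSpectralBound A.γ ρ lam) (hn : 0 < n)
    (hW : IsMixingMatrix A.G A.W) (hQ : IsSortedEigendecomposition A.W Q lam)
    (hf : IsSmoothBddBelow f L flow)
    (hgrad : IsStochasticGradient μ A s f σ) (hcomp : IsUnbiasedCompressor ν A.comp C)
    (hseed : IsFreshSeeds μ ν s) (hα : 0 < A.α) (hα1 : A.α ≤ 1) (k : ℕ) :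
    ∫ ω, compErrSq A s (k + 1) ω ∂μ ≤
      ((1 - A.α) ^ 2 * ∫ ω, compErrSq A s k ω ∂μ +
        A.α ^ 2 * (C * ∫ ω, compErrSq A s k ω ∂μ)) / (1 - A.α / 2) +
      8 / A.α * (4 * A.γ ^ 2 * ((2 + 2 * A.η ^ 2 * L ^ 2) *
          ∫ ω, checkHSq Q lam A.γ A.η f (A.state s ω k) ∂μ + A.η ^ 2 * (n * σ ^ 2)) +
        A.γ ^ 2 * (C * ∫ ω, compErrSq A s k ω ∂μ) +
        (2 * A.γ + 2 * A.η ^ 2 * L ^ 2) *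
          ∫ ω, checkHSq Q lam A.γ A.η f (A.state s ω (k + 1)) ∂μ +
        n * A.η ^ 2 * ∫ ω, gradSq A s f (k + 1) ω ∂μ) +
      A.η ^ 2 * (n * σ ^ 2) := by
  have hv := isCenteredNoise_gradNoise hf hgrad hcomp hseed
  have hN := fun k => HasMean.of_integrable
    (integrable_checkHSq (Q := Q) h hf hgrad hcomp hseed k)
  have hc := fun k => HasMean.of_integrable (integrable_compErrSq hf hgrad hcomp hseed k)
  have hF := fun k => HasMean.of_integrable (integrable_gradSq hn hf hgrad hcomp hseed k)
  have h1 : HasMean μ (fun ω => ∑ i, ⟪compInput A s k i ω, compNoise A s k i ω⟫_ℝ) 0 :=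
    HasMean.sum_zero fun i => by
      have hm := memLp_compInput hf hgrad hcomp hseed k i
      exact ⟨integrable_inner_of_memLp hm (memLp_compNoise hf hgrad hcomp hseed k i),
        integral_inner_compNoise hf hgrad hcomp hseed k i
          (measurable_compInput hgrad.measurable_grad hcomp.measurable k i) hm⟩
  have h2 : HasMean μ (fun ω => ∑ i, ⟪compDrift A s f (k + 1) i ω,
      gradNoise A s f (k + 1) i ω⟫_ℝ) 0 := HasMean.sum_zero fun i => by
    have hm := compDrift_mem hf hgrad hcomp hseed (k + 1) i
    exact ⟨integrable_inner_of_memLp hm.2 ((hv (k + 1)).memLp i),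
      (hv (k + 1)).orthogonal i _ hm.1 hm.2⟩
  have hV := fun k => HasMean.of_integrable (integrable_stackSq (hv k).memLp)
  have hE := HasMean.of_integrable (integrable_stackSq (memLp_compNoise hf hgrad hcomp hseed k))
  have hle := HasMean.le (hc (k + 1))
    (((((((hc k).const_mul ((1 - A.α) ^ 2)).sub (h1.const_mul (2 * A.α * (1 - A.α)))).add
      (hE.const_mul (A.α ^ 2))).div_const (1 - A.α / 2)).add
      (((((((hN k).const_mul (2 + 2 * A.η ^ 2 * L ^ 2)).add
        ((hV k).const_mul (A.η ^ 2))).const_mul (4 * A.γ ^ 2)).add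
        (hE.const_mul (A.γ ^ 2))).add
        ((hN (k + 1)).const_mul (2 * A.γ + 2 * A.η ^ 2 * L ^ 2))).add
        ((hF (k + 1)).const_mul (n * A.η ^ 2)) |>.const_mul (8 / A.α))).sub
      (h2.const_mul (2 * A.η)) |>.add ((hV (k + 1)).const_mul (A.η ^ 2)))
    (compErrSq_succ_le h hn hW hQ hf hα hα1 k)
  refine hle.trans ?_
  rw [mul_zero, mul_zero, sub_zero, sub_zero]
  have h3 := integral_stackSq_compNoise_le hf hgrad hcomp hseed k
  have h4 := (hv k).integral_stackSq_le
  have h5 := (hv (k + 1)).integral_stackSq_le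
  gcongr
  linarith

lemma integral_stackSq_sub_mean_le (h : IsSpectralBound A.γ ρ lam) (hn : 0 < n)
    (hW : IsMixingMatrix A.G A.W) (hQ : IsSortedEigendecomposition A.W Q lam)
    (hf : IsSmoothBddBelow f L flow)
    (hgrad : IsStochasticGradient μ A s f σ) (hcomp : IsUnbiasedCompressor ν A.comp C)
    (hseed : IsFreshSeeds μ ν s) (k : ℕ) :
    ∫ ω, stackSq (fun i => (A.state s ω k).x i - mean (A.state s ω k).x) ∂μ ≤
      2 * ∫ ω, checkHSq Q lam A.γ A.η f (A.state s ω k) ∂μ :=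
  HasMean.le (HasMean.of_integrable
      (integrable_stackSq_sub_mean (memLp_state hf hgrad hcomp hseed k).x))
    ((HasMean.of_integrable (integrable_checkHSq h hf hgrad hcomp hseed k)).const_mul 2)
    fun _ => h.stackSq_sub_mean_le hn hW hQ _

lemma integral_avgObj_state_succ_le (h : IsSpectralBound A.γ ρ lam) (hn : 0 < n)
    (hW : IsMixingMatrix A.G A.W) (hQ : IsSortedEigendecomposition A.W Q lam)
    (hf : IsSmoothBddBelow f L flow)
    (hgrad : IsStochasticGradient μ A s f σ) (hcomp : IsUnbiasedCompressor ν A.comp C)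
    (hseed : IsFreshSeeds μ ν s) (hη : 0 ≤ A.η) (hL : 0 ≤ L) (k : ℕ) :
    ∫ ω, avgObj f (mean (A.state s ω (k + 1)).x) ∂μ ≤
      ∫ ω, avgObj f (mean (A.state s ω k).x) ∂μ - A.η / 2 * ∫ ω, gradSq A s f k ω ∂μ -
      A.η / 2 * (1 - L * A.η) * ∫ ω, ‖meanGrad f (A.state s ω k).x‖ ^ 2 ∂μ +
      A.η * L ^ 2 / (2 * n) * (2 * ∫ ω, checkHSq Q lam A.γ A.η f (A.state s ω k) ∂μ) +
      L * A.η ^ 2 / 2 * (σ ^ 2 / n) := by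
  have hS := state_mem_gradPast hf hgrad hcomp hseed
  refine (integral_avgObj_step_le hn hf hη hL (hS k).x
    (isCenteredNoise_gradNoise hf hgrad hcomp hseed k)
    (mean_mem _ (hS (k + 1)).x).2 (mean_state_succ_x hW f · k)).trans ?_
  have := integral_stackSq_sub_mean_le h hn hW hQ hf hgrad hcomp hseed k
  simp only [gradSq]
  gcongr

lemma integral_avgObj_state_zero_le (hn : 0 < n) (hf : IsSmoothBddBelow f L flow)
    (hgrad : IsStochasticGradient μ A s f σ) (hcomp : IsUnbiasedCompressor ν A.comp C)
    (hseed : IsFreshSeeds μ ν s) (hη : 0 ≤ A.η) (hL : 0 ≤ L) :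
    ∫ ω, avgObj f (mean (A.state s ω 0).x) ∂μ ≤
      avgObj f (mean A.xInit) - A.η / 2 * ‖gradient (avgObj f) (mean A.xInit)‖ ^ 2 -
      A.η / 2 * (1 - L * A.η) * ‖meanGrad f A.xInit‖ ^ 2 +
      A.η * L ^ 2 / (2 * n) * stackSq A.xInit + L * A.η ^ 2 / 2 * (σ ^ 2 / n) := by
  have hS := state_mem_gradPast hf hgrad hcomp hseed 0
  -- Iteration -1 starts from deterministic values, so its past is the trivial σ-algebra; there is
  -- no ȟ yet, and the consensus error is bounded by the full norm of `A.xInit`.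
  have h := integral_avgObj_step_le (x := fun _ : Ω => A.xInit) (m := ⊥) hn hf hη hL
    (fun i => ⟨measurable_const, memLp_const _⟩) (isCenteredNoise_gradNoiseInit hgrad)
    (mean_mem _ hS.x).2 (mean_state_zero_x f)
  simp only [integral_const, probReal_univ, one_smul] at h
  refine h.trans ?_
  have := stackSq_eq_stackSq_sub_mean_add hn A.xInit
  have h2 : stackSq (fun i => A.xInit i - mean A.xInit) ≤ stackSq A.xInit := by
    rw [this]
    exact le_add_of_nonneg_right (by positivity)
  gcongr

end Recursions

end Cedas

namespace Cedas

/-! ### Summation of the recursions -/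

section Summation

lemma mul_sum_range_le_of_recursion {x s : ℕ → ℝ} {θ : ℝ} (hx : ∀ k, 0 ≤ x k)
    (h : ∀ k, x (k + 1) ≤ (1 - θ) * x k + s k) (K : ℕ) :
    θ * ∑ k ∈ Finset.range K, x k ≤ x 0 + ∑ k ∈ Finset.range K, s k := by
  have key : θ * ∑ k ∈ Finset.range K, x k + x K ≤ x 0 + ∑ k ∈ Finset.range K, s k := by
    induction K with
    | zero => simp
    | succ K ih =>
      rw [Finset.sum_range_succ, Finset.sum_range_succ]
      linarith [h K]
  linarith [hx K]

lemma mul_sum_range_le_of_recursion_shift {c x F : ℕ → ℝ} {θ a b d e : ℝ} (hθ : θ ≤ 1)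
    (ha : 0 ≤ a) (hb : 0 ≤ b) (hd : 0 ≤ d) (he : 0 ≤ e)
    (hc : ∀ k, 0 ≤ c k) (hx : ∀ k, 0 ≤ x k) (hF : ∀ k, 0 ≤ F k)
    (h : ∀ k, c (k + 1) ≤ (1 - θ) * c k + a * x k + b * x (k + 1) + d + e * F (k + 1))
    {K : ℕ} (hK : 1 ≤ K) :
    θ * ∑ k ∈ Finset.range K, c k ≤ c 0 + (a + b) * ∑ k ∈ Finset.range K, x k + K * d +
      e * ∑ k ∈ Finset.range K, F k := by
  -- With K = m + 1 the recursion is applied only up to index K - 1, so no x or F at index K appears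
  -- on the right. The two extra terms on the left are what the next application consumes.
  have key : ∀ m : ℕ, θ * ∑ k ∈ Finset.range (m + 1), c k + (1 - θ) * c m + a * x m ≤
      c 0 + (a + b) * ∑ k ∈ Finset.range (m + 1), x k + m * d +
        e * ∑ k ∈ Finset.range (m + 1), F k := fun m => by
    induction m with
    | zero =>
      have h1 := mul_nonneg hb (hx 0)
      have h2 := mul_nonneg he (hF 0)
      simp
      linarith
    | succ m ih =>
      rw [Finset.sum_range_succ c, Finset.sum_range_succ x, Finset.sum_range_succ F]
      push_cast
      linarith [h m]
  obtain ⟨m, rfl⟩ : ∃ m, K = m + 1 := ⟨K - 1, by omega⟩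
  have h1 := mul_nonneg (sub_nonneg.2 hθ) (hc m)
  have h2 := mul_nonneg ha (hx m)
  have h3 := key m
  push_cast
  linarith

/-- Of the rate ρ/2 left by Young's inequality, the gradient deviation costs (4/ρ)(ρ²/64) = ρ/16,
hence 7ρ/16. The noise coefficients 2/3 and 1/32 are rounded up to 1. -/
lemma consensus_recursion_simplify {x x' g y ρ η L N σ : ℝ} (hx : 0 ≤ x) (hg : 0 ≤ g)
    (hρ : 0 < ρ) (hρ1 : ρ ≤ 1 / 2) (hη : 0 ≤ η) (hL : 0 ≤ L) (hLη : L * η ≤ ρ / 8) (hN : 1 ≤ N)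
    (h : x' ≤ ((1 - ρ) * x + η ^ 2 / 2 * (N * σ ^ 2)) / (1 - ρ / 2) +
      2 / ρ * (2 * η ^ 2 * L ^ 2 * x + η ^ 4 * N * L ^ 2 / ρ * (g + σ ^ 2 / N)) + y) :
    x' ≤ (1 - 7 * ρ / 16) * x + (N * η ^ 2 * σ ^ 2 + N * η ^ 2 / 32 * g + y) := by
  have hLη2 : L ^ 2 * η ^ 2 ≤ ρ ^ 2 / 64 := by
    have : (L * η) ^ 2 ≤ (ρ / 8) ^ 2 := by gcongr
    linarith [mul_pow L η 2, div_pow ρ 8 2]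
  have h1 : ((1 - ρ) * x + η ^ 2 / 2 * (N * σ ^ 2)) / (1 - ρ / 2) ≤
      (1 - ρ / 2) * x + 2 / 3 * (N * η ^ 2 * σ ^ 2) := by
    rw [div_le_iff₀ (by linarith)]
    have : 0 ≤ N * η ^ 2 * σ ^ 2 := by positivity
    have h2 : 0 ≤ (1 / 2 - ρ) * (N * η ^ 2 * σ ^ 2) := mul_nonneg (by linarith) this
    have h3 : 0 ≤ ρ ^ 2 * x := by positivity
    linarith
  have h2 : 2 / ρ * (2 * η ^ 2 * L ^ 2 * x) ≤ ρ / 16 * x := by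
    calc 2 / ρ * (2 * η ^ 2 * L ^ 2 * x) = 4 / ρ * (L ^ 2 * η ^ 2) * x := by ring
      _ ≤ 4 / ρ * (ρ ^ 2 / 64) * x := by gcongr
      _ = ρ / 16 * x := by field_simp; ring
  have h3 : 2 / ρ * (η ^ 4 * N * L ^ 2 / ρ * (g + σ ^ 2 / N)) ≤
      N * η ^ 2 / 32 * g + N * η ^ 2 * σ ^ 2 / 32 := by
    calc 2 / ρ * (η ^ 4 * N * L ^ 2 / ρ * (g + σ ^ 2 / N))
        = 2 / ρ ^ 2 * (L ^ 2 * η ^ 2) * (N * η ^ 2 * (g + σ ^ 2 / N)) := by field_simp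
      _ ≤ 2 / ρ ^ 2 * (ρ ^ 2 / 64) * (N * η ^ 2 * (g + σ ^ 2)) := by
          gcongr
          exact div_le_self (sq_nonneg _) hN
      _ = _ := by field_simp; ring
  have h4 : 0 ≤ N * η ^ 2 * σ ^ 2 := by positivity
  linarith

/-- The bound αC ≤ 1/12 gives the rate 5α/12; the compression error passed through the Laplacian
costs α/216, and 5/12 - 1/216 ≥ 2/5. -/
lemma compression_recursion_simplify {x x' c c' F ρ γ α η L N σ C : ℝ} (hx : 0 ≤ x)
    (hx' : 0 ≤ x') (hc : 0 ≤ c) (hρ : 0 < ρ) (hργ : ρ ≤ γ) (hγ : γ ≤ 1 / 2)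
    (hα : 0 < α) (hα1 : α ≤ 1) (hη : 0 ≤ η) (hL : 0 ≤ L) (hLη : L * η ≤ ρ / 8) (hN : 0 ≤ N)
    (hαC : α * C ≤ 1 / 12) (hγC : γ * C ≤ α ^ 2 / 864)
    (h : c' ≤ ((1 - α) ^ 2 * c + α ^ 2 * (C * c)) / (1 - α / 2) +
      8 / α * (4 * γ ^ 2 * ((2 + 2 * η ^ 2 * L ^ 2) * x + η ^ 2 * (N * σ ^ 2)) +
        γ ^ 2 * (C * c) + (2 * γ + 2 * η ^ 2 * L ^ 2) * x' + N * η ^ 2 * F) +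
      η ^ 2 * (N * σ ^ 2)) :
    c' ≤ (1 - 2 * α / 5) * c + 36 * γ / α * x + 17 * γ / α * x' +
      (16 * γ / α + 1) * (N * η ^ 2 * σ ^ 2) + 8 / α * (N * η ^ 2) * F := by
  have hγ0 : 0 < γ := hρ.trans_le hργ
  have hLη2 : η ^ 2 * L ^ 2 ≤ γ / 128 := by
    have h1 : (L * η) ^ 2 ≤ (ρ / 8) ^ 2 := by gcongr
    have h2 : ρ ^ 2 ≤ γ ^ 2 := by gcongr
    nlinarith [mul_pow L η 2, div_pow ρ 8 2]
  have h1 : ((1 - α) ^ 2 * c + α ^ 2 * (C * c)) / (1 - α / 2) ≤ (1 - 5 * α / 12) * c := by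
    rw [div_le_iff₀ (by linarith)]
    have h2 : α * (α * C) * c ≤ α * (1 / 12) * c := by gcongr
    have h3 : 0 ≤ (α - α ^ 2) * c := mul_nonneg (by nlinarith) hc
    have h4 : 0 ≤ α ^ 2 * c := by positivity
    linarith
  have h2 : 8 / α * (γ ^ 2 * (C * c)) ≤ α / 216 * c := by
    have : γ * (γ * C) ≤ 1 / 2 * (α ^ 2 / 864) := by
      calc γ * (γ * C) ≤ γ * (α ^ 2 / 864) := by gcongr
        _ ≤ _ := by gcongr
    calc 8 / α * (γ ^ 2 * (C * c)) = 8 / α * (γ * (γ * C)) * c := by ring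
      _ ≤ 8 / α * (1 / 2 * (α ^ 2 / 864)) * c := by gcongr
      _ = _ := by field_simp; ring
  have h3 : 8 / α * (4 * γ ^ 2 * ((2 + 2 * η ^ 2 * L ^ 2) * x)) ≤ 36 * γ / α * x := by
    have : γ * (2 + 2 * (η ^ 2 * L ^ 2)) ≤ 9 / 8 := by nlinarith
    calc 8 / α * (4 * γ ^ 2 * ((2 + 2 * η ^ 2 * L ^ 2) * x))
        = 32 * γ / α * x * (γ * (2 + 2 * (η ^ 2 * L ^ 2))) := by ring
      _ ≤ 32 * γ / α * x * (9 / 8) := by gcongr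
      _ = _ := by ring
  have h4 : 8 / α * (4 * γ ^ 2 * (η ^ 2 * (N * σ ^ 2))) ≤ 16 * γ / α * (N * η ^ 2 * σ ^ 2) := by
    calc 8 / α * (4 * γ ^ 2 * (η ^ 2 * (N * σ ^ 2)))
        = 32 * γ / α * (N * η ^ 2 * σ ^ 2) * γ := by ring
      _ ≤ 32 * γ / α * (N * η ^ 2 * σ ^ 2) * (1 / 2) := by gcongr
      _ = _ := by ring
  have h5 : 8 / α * ((2 * γ + 2 * η ^ 2 * L ^ 2) * x') ≤ 17 * γ / α * x' := by
    calc 8 / α * ((2 * γ + 2 * η ^ 2 * L ^ 2) * x')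
        = 8 / α * ((2 * γ + 2 * (η ^ 2 * L ^ 2)) * x') := by ring
      _ ≤ 8 / α * ((17 / 8 * γ) * x') := by
          gcongr
          linarith
      _ = _ := by ring
  have h6 : 0 ≤ α * c := by positivity
  have h7 : 8 / α * (4 * γ ^ 2 * ((2 + 2 * η ^ 2 * L ^ 2) * x + η ^ 2 * (N * σ ^ 2)) +
        γ ^ 2 * (C * c) + (2 * γ + 2 * η ^ 2 * L ^ 2) * x' + N * η ^ 2 * F) =
      8 / α * (4 * γ ^ 2 * ((2 + 2 * η ^ 2 * L ^ 2) * x)) +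
      8 / α * (4 * γ ^ 2 * (η ^ 2 * (N * σ ^ 2))) + 8 / α * (γ ^ 2 * (C * c)) +
      8 / α * ((2 * γ + 2 * η ^ 2 * L ^ 2) * x') + 8 / α * (N * η ^ 2) * F := by ring
  rw [h7] at h
  linarith

/-- Small gain: inserting the compression sum returns (5/2)·53·γ²C/α² ≤ (265/1728)ρ times `Sx`, less
than the available 7ρ/16 = (756/1728)ρ. Division by the remaining 491/1728 gives the constants after
rounding up. -/
lemma sum_consensus_le {Sx Sc Sg SF x₀ c₀ ρ γ α η N σ C K : ℝ} (hSx : 0 ≤ Sx)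
    (hSF : 0 ≤ SF) (hSg : 0 ≤ Sg) (hc₀ : 0 ≤ c₀)
    (hγ0 : 0 < γ) (hγ : γ ≤ 1 / 2) (hα : 0 < α) (hα1 : α ≤ 1)
    (hN : 0 ≤ N) (hK : 0 ≤ K) (hC : 0 < C) (hγρ : γ ^ 2 * C ≤ α ^ 2 * ρ / 864)
    (hγC : γ * C ≤ α ^ 2 / 864)
    (h1 : 2 * α / 5 * Sc ≤ c₀ + (36 * γ / α + 17 * γ / α) * Sx +
      K * ((16 * γ / α + 1) * (N * η ^ 2 * σ ^ 2)) + 8 / α * (N * η ^ 2) * SF)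
    (h2 : 7 * ρ / 16 * Sx ≤ x₀ + (K * (N * η ^ 2 * σ ^ 2) + N * η ^ 2 / 32 * Sg +
      γ * C * Sc)) :
    ρ * Sx ≤ 4 * x₀ + 10 * (γ * C / α * c₀) + 5 * (K * (N * η ^ 2 * σ ^ 2)) +
      N * η ^ 2 / 8 * Sg + N * η ^ 2 / 8 * SF := by
  have hT : 0 ≤ K * (N * η ^ 2 * σ ^ 2) := by positivity
  have hρSx : 0 ≤ ρ * Sx := by
    refine mul_nonneg ?_ hSx
    by_contra! hρ
    have : 0 < γ ^ 2 * C := by positivity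
    nlinarith [pow_pos hα 2]
  have hc : γ * C / α * c₀ ≥ 0 := by positivity
  have h3 : γ * C * Sc ≤ 5 / 2 * (γ * C / α * c₀) + 265 / 1728 * (ρ * Sx) +
      45 / 1728 * (K * (N * η ^ 2 * σ ^ 2)) + 40 / 1728 * (N * η ^ 2 * SF) := by
    have h4 : γ * C * Sc = 5 / 2 * (γ * C / α) * (2 * α / 5 * Sc) := by field_simp
    have h5 : 5 / 2 * (γ * C / α) * (2 * α / 5 * Sc) ≤ 5 / 2 * (γ * C / α) * (c₀ +
        (36 * γ / α + 17 * γ / α) * Sx + K * ((16 * γ / α + 1) * (N * η ^ 2 * σ ^ 2)) +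
        8 / α * (N * η ^ 2) * SF) := by gcongr
    have h6 : 5 / 2 * (γ * C / α) * (c₀ +
        (36 * γ / α + 17 * γ / α) * Sx + K * ((16 * γ / α + 1) * (N * η ^ 2 * σ ^ 2)) +
        8 / α * (N * η ^ 2) * SF) = 5 / 2 * (γ * C / α * c₀) +
        265 / 2 * (γ ^ 2 * C / α ^ 2) * Sx +
        (40 * γ + 5 / 2 * α) * (γ * C / α ^ 2) * (K * (N * η ^ 2 * σ ^ 2)) +
        20 * (γ * C / α ^ 2) * (N * η ^ 2 * SF) := by
      field_simp
      ring
    have h7 : γ ^ 2 * C / α ^ 2 ≤ ρ / 864 := by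
      rw [div_le_iff₀ (by positivity)]
      linarith
    have h8 : γ * C / α ^ 2 ≤ 1 / 864 := by
      rw [div_le_iff₀ (by positivity)]
      linarith
    have h9 : 265 / 2 * (γ ^ 2 * C / α ^ 2) * Sx ≤ 265 / 2 * (ρ / 864) * Sx := by gcongr
    have h10 : (40 * γ + 5 / 2 * α) * (γ * C / α ^ 2) * (K * (N * η ^ 2 * σ ^ 2)) ≤
        (45 / 2) * (1 / 864) * (K * (N * η ^ 2 * σ ^ 2)) := by
      gcongr
      linarith
    have h11 : 20 * (γ * C / α ^ 2) * (N * η ^ 2 * SF) ≤ 20 * (1 / 864) * (N * η ^ 2 * SF) := by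
      gcongr
    linarith
  have h12 : 0 ≤ N * η ^ 2 * SF := by positivity
  have h13 : 0 ≤ N * η ^ 2 * Sg := by positivity
  linarith

lemma sum_gradient_le {Sx Sg SF F₀ g₀ X x₀ c₀ φ₀ φ φmin ρ γ α η L N σ C K : ℝ}
    (hSg : 0 ≤ Sg) (hSF : 0 ≤ SF) (hF₀ : 0 ≤ F₀) (hg₀ : 0 ≤ g₀) (hX : 0 ≤ X) (hx₀ : 0 ≤ x₀)
    (hc₀ : 0 ≤ c₀) (hρ : 0 < ρ) (hρ1 : ρ ≤ 1 / 2) (hγ : 0 < γ) (hα : 0 < α) (hη : 0 < η)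
    (hL : 0 < L) (hLη : L * η ≤ ρ / 8) (hN : 0 < N) (hC : 0 < C) (hK : 0 ≤ K)
    (h1 : ρ * Sx ≤ 4 * x₀ + 10 * (γ * C / α * c₀) + 5 * (K * (N * η ^ 2 * σ ^ 2)) +
      N * η ^ 2 / 8 * Sg + N * η ^ 2 / 8 * SF)
    (h2 : φ ≤ φ₀ - η / 2 * F₀ - η / 2 * (1 - L * η) * g₀ + η * L ^ 2 / (2 * N) * X +
      L * η ^ 2 / 2 * (σ ^ 2 / N))
    (h3 : φmin ≤ φ - η / 2 * SF - η / 2 * (1 - L * η) * Sg + η * L ^ 2 / (2 * N) * (2 * Sx) +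
      K * (L * η ^ 2 / 2 * (σ ^ 2 / N))) :
    F₀ + SF ≤ 4 * (φ₀ - φmin) / η + 32 * L ^ 2 * x₀ / (N * ρ) +
      384 * γ * C * L ^ 2 * c₀ / (N * α * ρ) + K * (4 * L * η * σ ^ 2 / N) +
      K * (168 * η ^ 2 * L ^ 2 * σ ^ 2 / ρ) + 4 * L ^ 2 * X / N + 2 * L * η * σ ^ 2 / N := by
  have hLη2 : L ^ 2 * η ^ 2 ≤ ρ ^ 2 / 64 := by
    have : (L * η) ^ 2 ≤ (ρ / 8) ^ 2 := by gcongr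
    linarith [mul_pow L η 2, div_pow ρ 8 2]
  have hr : L ^ 2 * η ^ 2 / ρ ≤ 1 / 128 := by
    rw [div_le_iff₀ hρ]
    nlinarith
  -- The multiplier 4/η reproduces the coefficient of φ₀ - φmin exactly and leaves 2(F₀ + SF) on the
  -- left; the surplus absorbs the gradient sums that return through `Sx`, whose coefficients are at
  -- most 1/256.
  have h4 : 4 / η * (φmin + (η / 2 * F₀ + η / 2 * (1 - L * η) * g₀ + η / 2 * SF +
      η / 2 * (1 - L * η) * Sg)) ≤ 4 / η * (φ₀ + η * L ^ 2 / (2 * N) * X +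
      L * η ^ 2 / 2 * (σ ^ 2 / N) + η * L ^ 2 / (2 * N) * (2 * Sx) +
      K * (L * η ^ 2 / 2 * (σ ^ 2 / N))) := by
    gcongr 4 / η * ?_
    linarith
  have h5 : 4 / η * (φmin + (η / 2 * F₀ + η / 2 * (1 - L * η) * g₀ + η / 2 * SF +
      η / 2 * (1 - L * η) * Sg)) = 4 * φmin / η + 2 * F₀ + 2 * (1 - L * η) * g₀ + 2 * SF +
      2 * (1 - L * η) * Sg := by
    field_simp
    ring
  have h6 : 4 / η * (φ₀ + η * L ^ 2 / (2 * N) * X +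
      L * η ^ 2 / 2 * (σ ^ 2 / N) + η * L ^ 2 / (2 * N) * (2 * Sx) +
      K * (L * η ^ 2 / 2 * (σ ^ 2 / N))) = 4 * φ₀ / η + 2 * (L ^ 2 * X / N) +
      2 * L * η * σ ^ 2 / N + 4 * L ^ 2 / (N * ρ) * (ρ * Sx) +
      2 * (K * (L * η * σ ^ 2 / N)) := by
    field_simp
    ring
  have h7 : 4 * L ^ 2 / (N * ρ) * (ρ * Sx) ≤ 4 * L ^ 2 / (N * ρ) * (4 * x₀ +
      10 * (γ * C / α * c₀) + 5 * (K * (N * η ^ 2 * σ ^ 2)) +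
      N * η ^ 2 / 8 * Sg + N * η ^ 2 / 8 * SF) := by gcongr
  have h8 : 4 * L ^ 2 / (N * ρ) * (4 * x₀ +
      10 * (γ * C / α * c₀) + 5 * (K * (N * η ^ 2 * σ ^ 2)) +
      N * η ^ 2 / 8 * Sg + N * η ^ 2 / 8 * SF) = 16 * (L ^ 2 * x₀ / (N * ρ)) +
      40 * (γ * C * L ^ 2 * c₀ / (N * α * ρ)) + 20 * (K * (η ^ 2 * L ^ 2 * σ ^ 2 / ρ)) +
      L ^ 2 * η ^ 2 / ρ * Sg / 2 + L ^ 2 * η ^ 2 / ρ * SF / 2 := by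
    field_simp
    ring
  have h9 : L ^ 2 * η ^ 2 / ρ * Sg ≤ 1 / 128 * Sg := by gcongr
  have h10 : L ^ 2 * η ^ 2 / ρ * SF ≤ 1 / 128 * SF := by gcongr
  have h11 : 15 / 16 * g₀ ≤ (1 - L * η) * g₀ := by
    gcongr
    linarith
  have h12 : 15 / 16 * Sg ≤ (1 - L * η) * Sg := by
    gcongr
    linarith
  have e1 : 4 * (φ₀ - φmin) / η = 4 * φ₀ / η - 4 * φmin / η := by ring
  have e2 : 32 * L ^ 2 * x₀ / (N * ρ) = 32 * (L ^ 2 * x₀ / (N * ρ)) := by ring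
  have e3 : 384 * γ * C * L ^ 2 * c₀ / (N * α * ρ) =
    384 * (γ * C * L ^ 2 * c₀ / (N * α * ρ)) := by ring
  have e4 : K * (4 * L * η * σ ^ 2 / N) = 4 * (K * (L * η * σ ^ 2 / N)) := by ring
  have e5 : K * (168 * η ^ 2 * L ^ 2 * σ ^ 2 / ρ) =
    168 * (K * (η ^ 2 * L ^ 2 * σ ^ 2 / ρ)) := by ring
  have e6 : 4 * L ^ 2 * X / N = 4 * (L ^ 2 * X / N) := by ring
  have p1 : 0 ≤ L ^ 2 * x₀ / (N * ρ) := by positivity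
  have p2 : 0 ≤ γ * C * L ^ 2 * c₀ / (N * α * ρ) := by positivity
  have p3 : 0 ≤ K * (L * η * σ ^ 2 / N) := by positivity
  have p4 : 0 ≤ K * (η ^ 2 * L ^ 2 * σ ^ 2 / ρ) := by positivity
  have p5 : 0 ≤ L ^ 2 * X / N := by positivity
  rw [h5, h6] at h4
  rw [h8] at h7
  rw [e1, e2, e3, e4, e5, e6]
  linarith

/-- The ordering places the smallest tail gap at the second eigenvalue, and λ ≥ -1 bounds every gap
by γ ≤ 1/2. -/
lemma isSpectralBound_of_le {n : ℕ} (hn : 2 ≤ n) {G : SimpleGraph (Fin n)}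
    {W Q : Matrix (Fin n) (Fin n) ℝ} {lam : Fin n → ℝ} (hW : IsMixingMatrix G W)
    (hQ : IsSortedEigendecomposition W Q lam) {γ : ℝ} (hγ : 0 < γ) (hγ1 : γ ≤ 1 / 2)
    (hlam : lam ⟨1, hn⟩ < 1) :
    IsSpectralBound γ (1 - tildeEig γ (lam ⟨1, hn⟩)) lam := by
  have hle : ∀ t : Tail n, lam t ≤ lam ⟨1, hn⟩ := fun t => hQ.antitone t.2
  have hge := neg_one_le_eigenvalue hW hQ
  constructor
  · unfold tildeEig
    have : 0 < γ / 2 * (1 - lam ⟨1, hn⟩) := mul_pos (by linarith) (by linarith)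
    linarith
  · unfold tildeEig
    nlinarith [hge ⟨1, hn⟩]
  · intro t
    unfold tildeEig
    nlinarith [hge t]
  · intro t
    unfold tildeEig
    nlinarith [hle t]
  · intro t
    unfold tildeEig
    nlinarith [hge t]

end Summation

end Cedas

end

/-! ### Assembly of the estimates -/

theorem theorem4 {n p : ℕ} (hn : 2 ≤ n)
    {Ω Ξ Z : Type*} [MeasurableSpace Ω] [MeasurableSpace Ξ] [MeasurableSpace Z]
    (μ : Measure Ω) [IsProbabilityMeasure μ] (ν : Measure Z) [IsProbabilityMeasure ν]
    (A : Cedas.Algorithm n p Ξ Z) (s : Cedas.Samples n Ω Ξ Z)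
    (f : Fin n → Cedas.Vec p → ℝ) (flow : Fin n → ℝ)
    (Q : Matrix (Fin n) (Fin n) ℝ) (lam : Fin n → ℝ) (lam₂ tlam₂ L σ C : ℝ)
    (hW : Cedas.IsMixingMatrix A.G A.W)
    (hQ : Cedas.IsSortedEigendecomposition A.W Q lam)
    (hlam₂ : lam₂ = lam ⟨1, hn⟩) (htlam₂ : tlam₂ = Cedas.tildeEig A.γ lam₂)
    (hL : 0 < L) (hf : Cedas.IsSmoothBddBelow f L flow)
    (hσ : 0 < σ) (hgrad : Cedas.IsStochasticGradient μ A s f σ)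
    (hcomp : Cedas.IsUnbiasedCompressor ν A.comp C) (hseed : Cedas.IsFreshSeeds μ ν s)
    (hα : 0 < A.α) (hα1 : A.α ≤ 1) (hγ : 0 < A.γ) (hη : 0 < A.η)
    (hαC : A.α ≤ 1 / (12 * C))
    (hγ_le : A.γ ≤ min (min (Real.sqrt A.α / (2 * Real.sqrt C)) (1 / 2))
      (A.α ^ 2 * (1 - lam₂) / (1728 * C)))
    (hη_le : A.η ≤ min (Real.sqrt A.α / (2 * Real.sqrt 3 * L)) (A.γ * (1 - lam₂) / (16 * L)))
    (K : ℕ) (hK : 1 ≤ K) :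
    (∀ k < K, Integrable (Cedas.gradSq A s f k) μ) ∧
    Integrable (fun ω => Cedas.checkHSq Q lam A.γ A.η f (A.state s ω 0)) μ ∧
    Integrable (Cedas.compErrSq A s 0) μ ∧
    (1 / (K : ℝ)) * (‖gradient (Cedas.avgObj f) (Cedas.mean A.xInit)‖ ^ 2 +
        ∑ k ∈ Finset.range K, ∫ ω, Cedas.gradSq A s f k ω ∂μ)
      ≤ 4 * (Cedas.avgObj f (Cedas.mean A.xInit) - (1 / (n : ℝ)) * ∑ i, flow i) / (A.η * K)
        + 32 * L ^ 2 * (∫ ω, Cedas.checkHSq Q lam A.γ A.η f (A.state s ω 0) ∂μ)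
            / (n * (1 - tlam₂) * K)
        + 384 * A.γ * C * L ^ 2 * (∫ ω, Cedas.compErrSq A s 0 ω ∂μ)
            / (n * A.α * (1 - tlam₂) * K)
        + 4 * L * A.η * σ ^ 2 / n
        + 168 * A.η ^ 2 * L ^ 2 * σ ^ 2 / (1 - tlam₂)
        + 4 * L ^ 2 * Cedas.stackSq A.xInit / (n * K)
        + 2 * L * A.η * σ ^ 2 / (n * K) := by
  have hn0 : 0 < n := by omega
  have hnR : (1 : ℝ) ≤ n := by exact_mod_cast hn0
  have hC := hcomp.pos
  have hγ1 : A.γ ≤ 1 / 2 := (hγ_le.trans (min_le_left _ _)).trans (min_le_right _ _)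
  have hγ2 : A.γ ≤ A.α ^ 2 * (1 - lam₂) / (1728 * C) := hγ_le.trans (min_le_right _ _)
  have hη2 : A.η ≤ A.γ * (1 - lam₂) / (16 * L) := hη_le.trans (min_le_right _ _)
  -- A positive γ satisfying the third bound forces a positive spectral gap.
  have hlam1 : lam₂ < 1 := by
    have h1 : 0 < A.α ^ 2 * (1 - lam₂) / (1728 * C) := hγ.trans_le hγ2
    by_contra! h2
    refine absurd h1 (not_lt.2 (div_nonpos_of_nonpos_of_nonneg ?_ (by positivity)))
    exact mul_nonpos_of_nonneg_of_nonpos (sq_nonneg _) (by linarith)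
  have hlam2 : -1 ≤ lam₂ := hlam₂ ▸ Cedas.neg_one_le_eigenvalue hW hQ ⟨1, hn⟩
  have hS : Cedas.IsSpectralBound A.γ (1 - tlam₂) lam := by
    rw [htlam₂, hlam₂]
    exact Cedas.isSpectralBound_of_le hn hW hQ hγ hγ1 (hlam₂ ▸ hlam1)
  have hρeq : 1 - tlam₂ = A.γ / 2 * (1 - lam₂) := by
    rw [htlam₂, Cedas.tildeEig]
    ring
  generalize 1 - tlam₂ = ρ at hS hρeq ⊢
  have hρ := hS.pos
  have hργ : ρ ≤ A.γ := by
    rw [hρeq]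
    nlinarith
  have hLη : L * A.η ≤ ρ / 8 := by
    rw [le_div_iff₀ (by positivity)] at hη2
    rw [hρeq]
    linarith
  rw [le_div_iff₀ (by positivity)] at hγ2 hαC
  have hαC' : A.α * C ≤ 1 / 12 := by linarith
  have hα2 := pow_pos hα 2
  have hγC : A.γ * C ≤ A.α ^ 2 / 864 := by
    have : A.α ^ 2 * (1 - lam₂) ≤ A.α ^ 2 * 2 := by
      gcongr
      linarith
    linarith
  -- The third bound on γ times γ, where γ(1-λ₂) = 2ρ turns 1728 into 864.
  have hγρ : A.γ ^ 2 * C ≤ A.α ^ 2 * ρ / 864 := by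
    have := mul_le_mul_of_nonneg_left hγ2 hγ.le
    rw [hρeq]
    linarith
  have hx0 : ∀ k, 0 ≤ ∫ ω, Cedas.checkHSq Q lam A.γ A.η f (A.state s ω k) ∂μ := fun k =>
    integral_nonneg fun _ => Cedas.IsSpectralBound.checkHSq_nonneg _
  have hc0 : ∀ k, 0 ≤ ∫ ω, Cedas.compErrSq A s k ω ∂μ := fun k =>
    integral_nonneg fun _ => Cedas.stackSq_nonneg _
  have hF0 : ∀ k, 0 ≤ ∫ ω, Cedas.gradSq A s f k ω ∂μ := fun k =>
    integral_nonneg fun _ => sq_nonneg _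
  have hg0 : ∀ k, 0 ≤ ∫ ω, ‖Cedas.meanGrad f (A.state s ω k).x‖ ^ 2 ∂μ := fun k =>
    integral_nonneg fun _ => sq_nonneg _
  have hcons := Cedas.mul_sum_range_le_of_recursion hx0 (fun k =>
    Cedas.consensus_recursion_simplify (hx0 k) (hg0 k) hρ hS.le_half hη.le hL.le hLη hnR
      (Cedas.integral_checkHSq_succ_le hS hn0 hW hQ hf hgrad hcomp hseed hγ.le k)) K
  have hcompr := Cedas.mul_sum_range_le_of_recursion_shift (by linarith) (by positivity)
    (by positivity) (by positivity) (by positivity) hc0 hx0 hF0 (fun k =>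
      Cedas.compression_recursion_simplify (hx0 k) (hx0 (k + 1)) (hc0 k) hρ hργ hγ1 hα hα1 hη.le
        hL.le hLη (by positivity) hαC' hγC
        (Cedas.integral_compErrSq_succ_le hS hn0 hW hQ hf hgrad hcomp hseed hα hα1 k)) hK
  -- The descent is telescoped from iteration 0; the step from -1 to 0 is added separately by
  -- `hfirst`.
  have hdesc : ∀ m : ℕ, ∫ ω, Cedas.avgObj f (Cedas.mean (A.state s ω m).x) ∂μ ≤
      ∫ ω, Cedas.avgObj f (Cedas.mean (A.state s ω 0).x) ∂μ -
      A.η / 2 * ∑ k ∈ Finset.range m, ∫ ω, Cedas.gradSq A s f k ω ∂μ -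
      A.η / 2 * (1 - L * A.η) *
        ∑ k ∈ Finset.range m, ∫ ω, ‖Cedas.meanGrad f (A.state s ω k).x‖ ^ 2 ∂μ +
      A.η * L ^ 2 / (2 * n) * (2 * ∑ k ∈ Finset.range m,
        ∫ ω, Cedas.checkHSq Q lam A.γ A.η f (A.state s ω k) ∂μ) +
      m * (L * A.η ^ 2 / 2 * (σ ^ 2 / n)) := fun m => by
    induction m with
    | zero => simp
    | succ m ih =>
      rw [Finset.sum_range_succ, Finset.sum_range_succ, Finset.sum_range_succ]
      push_cast
      linarith [Cedas.integral_avgObj_state_succ_le hS hn0 hW hQ hf hgrad hcomp hseed hη.le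
        hL.le m]
  have hlow : (1 / (n : ℝ)) * ∑ i, flow i ≤
      ∫ ω, Cedas.avgObj f (Cedas.mean (A.state s ω K).x) ∂μ := by
    have h := integral_mono (μ := μ) (integrable_const ((1 / (n : ℝ)) * ∑ i, flow i))
      (Cedas.integrable_avgObj hn0 hf
        (Cedas.mean_mem _ (Cedas.memLp_state hf hgrad hcomp hseed K).x))
      (fun ω => hf.le_avgObj (Cedas.mean (A.state s ω K).x))
    simpa using h
  have hfirst := Cedas.integral_avgObj_state_zero_le hn0 hf hgrad hcomp hseed hη.le hL.le
  refine ⟨fun k _ => Cedas.integrable_gradSq hn0 hf hgrad hcomp hseed k,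
    Cedas.integrable_checkHSq hS hf hgrad hcomp hseed 0,
    Cedas.integrable_compErrSq hf hgrad hcomp hseed 0, ?_⟩
  have hSx := Finset.sum_nonneg fun k (_ : k ∈ Finset.range K) => hx0 k
  have hSF := Finset.sum_nonneg fun k (_ : k ∈ Finset.range K) => hF0 k
  have hSg := Finset.sum_nonneg fun k (_ : k ∈ Finset.range K) => hg0 k
  have hKR : (0 : ℝ) < K := by exact_mod_cast hK
  have hnR' : (0 : ℝ) < n := by linarith
  rw [Finset.sum_add_distrib, Finset.sum_add_distrib, Finset.sum_const, Finset.card_range,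
    nsmul_eq_mul, ← Finset.mul_sum, ← Finset.mul_sum, ← Finset.mul_sum, ← mul_assoc A.γ] at hcons
  have hsum := Cedas.sum_consensus_le hSx hSF hSg (hc0 0) hγ hγ1 hα hα1 hnR'.le hKR.le hC
    hγρ hγC hcompr hcons
  have hfinal := Cedas.sum_gradient_le hSg hSF (sq_nonneg _) (sq_nonneg _)
    (Cedas.stackSq_nonneg A.xInit) (hx0 0) (hc0 0) hρ hS.le_half hγ hα hη hL hLη hnR' hC hKR.le
    hsum hfirst (hlow.trans (hdesc K))
  refine (mul_le_mul_of_nonneg_left hfinal (by positivity : 0 ≤ 1 / (K : ℝ))).trans_eq ?_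
  field_simp
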